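/- Flips and sliding moves. Let $G$ be a finite simple graph. A matching of $G$ is a set of edges of $G$ no two of which share an endpoint. Two matchings $M,M'$ of $G$ are adjacent if their symmetric difference $M\mathbin{\triangle}M'$ is either the edge set of a cycle of length four (a flip) or the edge set of a path on three vertices (a sliding move, which replaces an edge of the matching by another edge of $G$ sharing an endpoint with it). A reconfiguration sequence of length $q$ from $M$ to $M'$ is a sequence $M=M_0,M_1,\dots,M_q=M'$ of matchings of $G$ in which $M_{i-1}$ and $M_i$ are adjacent for $1\le i\le q$. General Matching Reconfiguration is the following problem: given a graph $G$ and two matchings $M_{\mathrm{ini}},M_{\mathrm{tar}}$ of $G$, decide whether there is a reconfiguration sequence from $M_{\mathrm{ini}}$ to $M_{\mathrm{tar}}$. A cograph is a graph that has no path on four vertices as an induced subgraph. Theorem. General Matching Reconfiguration restricted to cographs $G$ can be decided in polynomial time. Moreover, there are a constant $C$ and a polynomial-time algorithm that, given a YES-instance $(G,M_{\mathrm{ini}},M_{\mathrm{tar}})$ in which $G$ is a cograph with $n$ vertices, outputs a reconfiguration sequence from $M_{\mathrm{ini}}$ to $M_{\mathrm{tar}}$ of length at most $Cn$. -/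

import Mathlib

/-! ### Computation model

A first-order Lisp-style language.  Values are S-expressions (binary trees), programs are built from
the usual constructors and destructors by pairing, composition, a test and a while-loop.
Every visit of a program node with current value `v` costs `size v + 1` steps, so copying and
discarding data are paid for, and the total cost bounds the size of everything that is ever
computed.  Multitape Turing machines and this language simulate each other with polynomial
overhead. -/

namespace MatchReconf

/-- S-expressions. -/
inductive Data : Type
  | nil : Data
  | cons : Data → Data → Data

namespace Data

/-- The number of nodes of an S-expression. -/
def size : Data → ℕ
  | nil => 1
  | cons a b => size a + size b + 1

def fst : Data → Data
  | nil => nil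
  | cons a _ => a

def snd : Data → Data
  | nil => nil
  | cons _ b => b

/-- `false` is `nil`, `true` is `(nil . nil)`. -/
def ofBool : Bool → Data
  | false => nil
  | true => cons nil nil

/-- A list is a right comb of the codes of its entries, ended by `nil`. -/
def ofList {α : Type} (enc : α → Data) : List α → Data
  | [] => nil
  | a :: l => cons (enc a) (ofList enc l)

open Classical in
/-- A binary relation on `Fin n` is coded by its `n × n` Boolean matrix, as a list of rows. -/
noncomputable def ofRel {n : ℕ} (r : Fin n → Fin n → Prop) : Data :=
  ofList (ofList ofBool) (List.ofFn fun i => List.ofFn fun j => decide (r i j))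

end Data

/-- Programs.  `loop C P` means: while `C` holds, do `P`. -/
inductive Program : Type
  | id : Program
  | nil : Program
  | fst : Program
  | snd : Program
  | pair : Program → Program → Program
  | comp : Program → Program → Program
  | ite : Program → Program → Program → Program
  | loop : Program → Program → Program

/-- `Eval P v w t`: started on the value `v`, the program `P` halts with the value `w` after
exactly `t` steps.  In tests, `nil` counts as false and every other value as true. -/
inductive Eval : Program → Data → Data → ℕ → Prop
  | id (v : Data) : Eval .id v v (v.size + 1)
  | nil (v : Data) : Eval .nil v .nil (v.size + 1)
  | fst (v : Data) : Eval .fst v v.fst (v.size + 1)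
  | snd (v : Data) : Eval .snd v v.snd (v.size + 1)
  | pair {P Q : Program} {v a b : Data} {s t : ℕ} :
      Eval P v a s → Eval Q v b t → Eval (.pair P Q) v (.cons a b) (s + t + (v.size + 1))
  /-- First `Q`, then `P` on the result. -/
  | comp {P Q : Program} {v u w : Data} {s t : ℕ} :
      Eval Q v u s → Eval P u w t → Eval (.comp P Q) v w (s + t + (v.size + 1))
  | ite_true {C P Q : Program} {v c w : Data} {s t : ℕ} :
      Eval C v c s → c ≠ .nil → Eval P v w t → Eval (.ite C P Q) v w (s + t + (v.size + 1))
  | ite_false {C P Q : Program} {v w : Data} {s t : ℕ} :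
      Eval C v .nil s → Eval Q v w t → Eval (.ite C P Q) v w (s + t + (v.size + 1))
  | loop_done {C P : Program} {v : Data} {s : ℕ} :
      Eval C v .nil s → Eval (.loop C P) v v (s + (v.size + 1))
  | loop_step {C P : Program} {v c u w : Data} {s t r : ℕ} :
      Eval C v c s → c ≠ .nil → Eval P v u t → Eval (.loop C P) u w r →
      Eval (.loop C P) v w (s + t + r + (v.size + 1))

/-- Programs are deterministic: result and running time are determined by the input. -/
theorem Eval.deterministic {P : Program} {v w w' : Data} {t t' : ℕ}
    (h : Eval P v w t) (h' : Eval P v w' t') : w = w' ∧ t = t' := by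
  induction h generalizing w' t' with
  | id | nil | fst | snd => cases h'; exact ⟨rfl, rfl⟩
  | pair _ _ ih₁ ih₂ =>
    cases h' with
    | pair k₁ k₂ =>
      obtain ⟨rfl, rfl⟩ := ih₁ k₁
      obtain ⟨rfl, rfl⟩ := ih₂ k₂
      exact ⟨rfl, rfl⟩
  | comp _ _ ih₁ ih₂ =>
    cases h' with
    | comp k₁ k₂ =>
      obtain ⟨rfl, rfl⟩ := ih₁ k₁
      obtain ⟨rfl, rfl⟩ := ih₂ k₂
      exact ⟨rfl, rfl⟩
  | ite_true _ hc _ ih₁ ih₂ =>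
    cases h' with
    | ite_true k₁ _ k₂ =>
      obtain ⟨rfl, rfl⟩ := ih₁ k₁
      obtain ⟨rfl, rfl⟩ := ih₂ k₂
      exact ⟨rfl, rfl⟩
    | ite_false k₁ k₂ => exact absurd (ih₁ k₁).1 hc
  | ite_false _ _ ih₁ ih₂ =>
    cases h' with
    | ite_true k₁ hc k₂ => exact absurd (ih₁ k₁).1.symm hc
    | ite_false k₁ k₂ =>
      obtain ⟨_, rfl⟩ := ih₁ k₁
      obtain ⟨rfl, rfl⟩ := ih₂ k₂
      exact ⟨rfl, rfl⟩
  | loop_done _ ih₁ =>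
    cases h' with
    | loop_done k₁ =>
      obtain ⟨_, rfl⟩ := ih₁ k₁
      exact ⟨rfl, rfl⟩
    | loop_step k₁ hc _ _ => exact absurd (ih₁ k₁).1.symm hc
  | loop_step _ hc _ _ ih₁ ih₂ ih₃ =>
    cases h' with
    | loop_done k₁ => exact absurd (ih₁ k₁).1 hc
    | loop_step k₁ _ k₂ k₃ =>
      obtain ⟨rfl, rfl⟩ := ih₁ k₁
      obtain ⟨rfl, rfl⟩ := ih₂ k₂
      obtain ⟨rfl, rfl⟩ := ih₃ k₃
      exact ⟨rfl, rfl⟩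

/-- The result of a computation is never larger than its running time. -/
theorem Eval.size_le {P : Program} {v w : Data} {t : ℕ} (h : Eval P v w t) : w.size ≤ t := by
  induction h with
  | fst v => cases v <;> simp only [Data.fst, Data.size] <;> omega
  | snd v => cases v <;> simp only [Data.snd, Data.size] <;> omega
  | nil => simp only [Data.size]; omega
  | pair => simp only [Data.size]; omega
  | _ => omega

/-- One program, run on the code of any `a` with `D a`, halts within a number of steps polynomial
in the size of this code, with the code of some `b` that is a correct answer: `R a b`. -/
def SolvableInPolyTime {α : Type} {β : α → Type} (encIn : α → Data) (encOut : ∀ a, β a → Data)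
    (D : α → Prop) (R : ∀ a, β a → Prop) : Prop :=
  ∃ (P : Program) (p : Polynomial ℕ), ∀ a, D a →
    ∃ b, R a b ∧ ∃ t ≤ p.eval (encIn a).size, Eval P (encIn a) (encOut a b) t

/-- The yes/no question `L`, restricted to the instances `a` with `D a`, can be decided in
polynomial time. -/
def DecidableInPolyTime {α : Type} (encIn : α → Data) (D L : α → Prop) : Prop :=
  SolvableInPolyTime (β := fun _ => Bool) encIn (fun _ => Data.ofBool) D
    (fun a b => b = true ↔ L a)

/-! ### Cographs, matchings and their reconfiguration -/

/-- A cograph is a graph without a path on four vertices as an induced subgraph. -/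
def IsCograph {V : Type} (G : SimpleGraph V) : Prop :=
  ¬ (SimpleGraph.pathGraph 4).IsIndContained G

/-- A matching is a set of edges no two of which share an endpoint. -/
def IsMatching {V : Type} (G : SimpleGraph V) (M : Finset (Sym2 V)) : Prop :=
  (∀ e ∈ M, e ∈ G.edgeSet) ∧ ∀ e ∈ M, ∀ f ∈ M, e ≠ f → ∀ v, ¬ (v ∈ e ∧ v ∈ f)

/-- A flip: the symmetric difference is (the edge set of) a cycle of length four. -/
def IsFlip {V : Type} [DecidableEq V] (M N : Finset (Sym2 V)) : Prop :=
  ∃ a b c d : V, [a, b, c, d].Nodup ∧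
    symmDiff M N = {s(a, b), s(b, c), s(c, d), s(d, a)}

/-- A sliding move: the symmetric difference is (the edge set of) a path on three vertices, so for
matchings one edge is replaced by another edge that shares an endpoint with it. -/
def IsSlide {V : Type} [DecidableEq V] (M N : Finset (Sym2 V)) : Prop :=
  ∃ a b c : V, [a, b, c].Nodup ∧ symmDiff M N = {s(a, b), s(b, c)}

/-- `S = [M₀, …, M_q]` is a sequence of matchings of `G` from `M` to `N` in which each matching
arises from the preceding one by a flip or a sliding move.  Its length is the number
`q = S.length - 1` of moves. -/
def IsReconfSeq {V : Type} [DecidableEq V] (G : SimpleGraph V) (M N : Finset (Sym2 V))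
    (S : List (Finset (Sym2 V))) : Prop :=
  S.head? = some M ∧ S.getLast? = some N ∧ (∀ X ∈ S, IsMatching G X) ∧
    S.IsChain fun X Y => IsFlip X Y ∨ IsSlide X Y

/-- Inputs of General Matching Reconfiguration: a finite graph and two matchings of it. -/
structure Instance where
  n : ℕ
  G : SimpleGraph (Fin n)
  init : Finset (Sym2 (Fin n))
  target : Finset (Sym2 (Fin n))
  isMatching_init : IsMatching G init
  isMatching_target : IsMatching G target

/-- A set of edges is coded by its adjacency matrix. -/
noncomputable def encodeEdges {n : ℕ} (M : Finset (Sym2 (Fin n))) : Data :=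
  Data.ofRel fun i j => s(i, j) ∈ M

/-- The code of an instance: the three adjacency matrices. -/
noncomputable def Instance.encode (I : Instance) : Data :=
  .cons (Data.ofRel I.G.Adj) (.cons (encodeEdges I.init) (encodeEdges I.target))

/-- YES-instances: some sequence of flips and sliding moves leads from one matching to the other. -/
def Instance.IsYes (I : Instance) : Prop :=
  ∃ S, IsReconfSeq I.G I.init I.target S

end MatchReconf

/-! A flip and a sliding move are the same operation: for matchings, both replace the matching by
its image under a transposition of two vertices (opposite corners of the 4-cycle, or the ends of the
path). Conversely a transposition that maps a matching to a different one is a flip or a slide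
(`isFlip_conj`, `isSlide_conj`, `isFlip_or_isSlide`). So matchings become symmetric relations on
`Fin n`, and a move becomes `conj R x y`, legal when the image still uses only edges of the graph.

Each matching is led by legal moves to a normal form that a legal move cannot change (`Canonical`).
Two matchings are then connected exactly when their normal forms agree (`isYes_iff`), and going to
the normal form and back is the required sequence.

The normal form is built along the decomposition of a cograph: a vertex set with at least two
elements is disconnected, or its complement is (`splits_or`). A disjoint union is treated part by
part (`Canonical.union`). In a join, let `A` be the larger side, `B` the smaller one and `f` the
number of uncovered vertices, an invariant of the moves. If `|A| ≤ |B| + f`, all edges inside the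
two sides can be removed. Otherwise put `d = |A| - |B| - f`; once `B` is matched entirely into `A`,
exactly `d` vertices are covered by edges inside `A`. If `d` is less than the maximum possible and
either `B` spans an edge or `f > 0`, an edge inside `A` can jump to any edge whose ends are free
inside `A`, so the inner matching can be turned into a fixed piece of a fixed maximum matching
(`search_jumpPotential`). In the remaining case every matching of this kind sends all of `B` into
`A` (`allCross_of_not_jumpCase`), each move acts on `A` as at most one move of `A` (`Step.join`),
and the normal form of `A` is used recursively. Finally the edges between the sides are put into a
standard position determined by the inner edges and their number (`search_crossPotential`). These
cases are put together in `Canonical.join`.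

Every phase is a local search: a potential bounded linearly drops by brute force over at most four
moves (`search_spec`). A join recurses only into `A`, so `16 |S|` moves suffice on `S`
(`length_canonMoves_le`). Polynomial time is proved compositionally through `PolyT`; the recursion
is evaluated bottom-up by `PolyT.tree`, since the sets of one level are disjoint. -/

namespace MatchReconf

/-! ### Encodings and polynomial-time families of functions -/

/-- Types whose elements are coded by S-expressions. -/
class Enc (α : Type) where
  enc : α → Data

open Enc (enc)

/-- Unary numbers. -/
def unary : ℕ → Data
  | 0 => .nil
  | k + 1 => .cons .nil (unary k)

instance : Enc Data := ⟨fun d => d⟩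
instance : Enc Unit := ⟨fun _ => .nil⟩
open Classical in
noncomputable instance : Enc Prop := ⟨fun p => .ofBool (decide p)⟩
instance : Enc ℕ := ⟨unary⟩
instance {n : ℕ} : Enc (Fin n) := ⟨fun i => unary i⟩
instance {α β : Type} [Enc α] [Enc β] : Enc (α × β) := ⟨fun a => .cons (enc a.1) (enc a.2)⟩
instance {α : Type} [Enc α] : Enc (List α) := ⟨Data.ofList enc⟩
instance {n : ℕ} {β : Type} [Enc β] : Enc (Fin n → β) := ⟨fun f => Data.ofList enc (List.ofFn f)⟩

/-- The size of the code. -/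
def sz {α : Type} [Enc α] (a : α) : ℕ := (enc a).size

theorem size_unary (k : ℕ) : (unary k).size = 2 * k + 1 := by
  induction k with
  | zero => rfl
  | succ k ih => simp only [unary, Data.size, ih]; omega

theorem Data.one_le_size (d : Data) : 1 ≤ d.size := by
  cases d <;> simp only [Data.size] <;> omega

theorem one_le_sz {α : Type} [Enc α] (a : α) : 1 ≤ sz a := Data.one_le_size _

theorem sz_prod {α β : Type} [Enc α] [Enc β] (a : α × β) : sz a = sz a.1 + sz a.2 + 1 := rfl
theorem sz_cons {α : Type} [Enc α] (a : α) (l : List α) : sz (a :: l) = sz a + sz l + 1 := rfl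
theorem sz_nil {α : Type} [Enc α] : sz ([] : List α) = 1 := rfl
theorem sz_nat (k : ℕ) : sz k = 2 * k + 1 := size_unary k
theorem sz_fin {n : ℕ} (i : Fin n) : sz i = 2 * i.val + 1 := size_unary i.val
theorem sz_prop_le (p : Prop) : sz p ≤ 3 := by
  by_cases h : p <;> simp [sz, enc, h, Data.ofBool, Data.size]

theorem length_le_sz {α : Type} [Enc α] (l : List α) : l.length ≤ sz l := by
  induction l with
  | nil => simp
  | cons a l ih => rw [sz_cons, List.length_cons]; omega

theorem sz_list_le {α : Type} [Enc α] (l : List α) (b : ℕ) (h : ∀ a ∈ l, sz a ≤ b) :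
    sz l ≤ l.length * (b + 1) + 1 := by
  induction l with
  | nil => simp [sz_nil]
  | cons a l ih =>
    have h1 := h a (by simp)
    have h2 := ih fun x hx => h x (by simp [hx])
    rw [sz_cons, List.length_cons]
    have : (l.length + 1) * (b + 1) = l.length * (b + 1) + (b + 1) := by ring
    omega

theorem sz_mem_le {α : Type} [Enc α] {l : List α} {a : α} (h : a ∈ l) : sz a ≤ sz l := by
  induction l with
  | nil => simp at h
  | cons b l ih =>
    rw [sz_cons]
    rcases List.mem_cons.1 h with rfl | h
    · omega
    · have := ih h; omega

theorem sz_append {α : Type} [Enc α] (l l' : List α) : sz (l ++ l') + 1 = sz l + sz l' := by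
  induction l with
  | nil => simp [sz_nil]; omega
  | cons a l ih => rw [List.cons_append, sz_cons, sz_cons]; omega

theorem sz_suffix_le {α : Type} [Enc α] {l l' : List α} (h : l <:+ l') : sz l ≤ sz l' := by
  obtain ⟨r, rfl⟩ := h
  have := sz_append r l
  have := one_le_sz r
  omega

theorem enc_ne_nil_iff (p : Prop) : enc p ≠ Data.nil ↔ p := by
  by_cases h : p <;> simp [enc, h, Data.ofBool]

theorem enc_prop_false {p : Prop} (h : ¬ p) : enc p = Data.nil := by
  simp [enc, h, Data.ofBool]

theorem eval_mono (p : Polynomial ℕ) : Monotone fun x => p.eval x := by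
  intro x y h
  simp only [Polynomial.eval_eq_sum]
  exact Finset.sum_le_sum fun i _ => Nat.mul_le_mul_left _ (Nat.pow_le_pow_left h i)

theorem eval_le (p : Polynomial ℕ) {x y : ℕ} (h : x ≤ y) : p.eval x ≤ p.eval y := eval_mono p h

/-- One program computes all the functions of the family, in polynomial time; it is also given the
index in unary. -/
def PolyT {α β : ℕ → Type} [∀ n, Enc (α n)] [∀ n, Enc (β n)] (f : ∀ n, α n → β n) : Prop :=
  ∃ (P : Program) (p : Polynomial ℕ), ∀ n (a : α n), ∃ t ≤ p.eval (n + sz a),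
    Eval P (.cons (unary n) (enc a)) (enc (f n a)) t

namespace PolyT

variable {α β γ δ σ : ℕ → Type} [∀ n, Enc (α n)] [∀ n, Enc (β n)] [∀ n, Enc (γ n)]
  [∀ n, Enc (δ n)] [∀ n, Enc (σ n)]

theorem size_le {f : ∀ n, α n → β n} (hf : PolyT f) :
    ∃ p : Polynomial ℕ, ∀ n a, sz (f n a) ≤ p.eval (n + sz a) := by
  obtain ⟨P, p, h⟩ := hf
  refine ⟨p, fun n a => ?_⟩
  obtain ⟨t, ht, he⟩ := h n a
  exact he.size_le.trans ht

/-- Only the code of the result matters. -/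
theorem congr_enc {f : ∀ n, α n → β n} (hf : PolyT f) {g : ∀ n, α n → γ n}
    (h : ∀ n a, enc (f n a) = enc (g n a)) : PolyT g := by
  obtain ⟨P, p, hP⟩ := hf
  refine ⟨P, p, fun n a => ?_⟩
  rw [← h]
  exact hP n a

theorem congr {f : ∀ n, α n → β n} (hf : PolyT f) {g : ∀ n, α n → β n}
    (h : ∀ n a, f n a = g n a) : PolyT g :=
  hf.congr_enc fun n a => by rw [h]

theorem of_size_eq_self (n : ℕ) (a : α n) :
    (Data.cons (unary n) (enc a)).size + 1 ≤ 2 * (n + sz a) + 3 := by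
  simp only [Data.size, size_unary, sz]; omega

theorem id : PolyT fun n (a : α n) => a := by
  refine ⟨.snd, 2 * Polynomial.X + 3, fun n a => ⟨_, ?_, Eval.snd _⟩⟩
  have := of_size_eq_self n a
  simp
  omega

/-- Constant families, with a fixed code. -/
theorem constant {f : ∀ n, α n → β n} (d : Data) (h : ∀ n a, enc (f n a) = d) : PolyT f := by
  suffices ∃ (P : Program) (p : Polynomial ℕ), ∀ v : Data, ∃ t ≤ p.eval v.size, Eval P v d t by
    obtain ⟨P, p, hP⟩ := this
    refine ⟨P, p.comp (2 * Polynomial.X + 3), fun n a => ?_⟩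
    obtain ⟨t, ht, he⟩ := hP (.cons (unary n) (enc a))
    refine ⟨t, ht.trans ?_, h n a ▸ he⟩
    rw [Polynomial.eval_comp]
    refine eval_le p ?_
    have := of_size_eq_self n a
    simp
    omega
  clear h
  induction d with
  | nil => exact ⟨.nil, Polynomial.X + 1, fun v => ⟨_, by simp, Eval.nil v⟩⟩
  | cons a b iha ihb =>
    obtain ⟨P, p, hP⟩ := iha
    obtain ⟨Q, q, hQ⟩ := ihb
    refine ⟨.pair P Q, p + q + (Polynomial.X + 1), fun v => ?_⟩
    obtain ⟨t, ht, he⟩ := hP v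
    obtain ⟨s, hs, he'⟩ := hQ v
    exact ⟨_, by simp; omega, Eval.pair he he'⟩

theorem comp {g : ∀ n, β n → γ n} {f : ∀ n, α n → β n} (hg : PolyT g) (hf : PolyT f) :
    PolyT fun n a => g n (f n a) := by
  obtain ⟨P, p, hP⟩ := hf
  obtain ⟨Q, q, hQ⟩ := hg
  -- The second program needs the index too, so it is copied next to the result of the first. An
  -- output is no larger than the time spent on it, hence the composed polynomial.
  refine ⟨.comp Q (.pair .fst P), q.comp (Polynomial.X + p) + p + 3 * (2 * Polynomial.X + 3),
    fun n a => ?_⟩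
  obtain ⟨t, ht, he⟩ := hP n a
  obtain ⟨s, hs, he'⟩ := hQ n (f n a)
  refine ⟨_, ?_, Eval.comp (Eval.pair (Eval.fst _) he) he'⟩
  have h1 := he.size_le
  have h2 := of_size_eq_self n a
  have h3 : q.eval (n + sz (f n a)) ≤ q.eval (n + sz a + p.eval (n + sz a)) :=
    eval_le q (by simp only [sz] at *; omega)
  simp only [Polynomial.eval_add, Polynomial.eval_comp, Polynomial.eval_X, Polynomial.eval_mul,
    Polynomial.eval_ofNat]
  omega

theorem pair {f : ∀ n, α n → β n} {g : ∀ n, α n → γ n} (hf : PolyT f) (hg : PolyT g) :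
    PolyT fun n a => (f n a, g n a) := by
  obtain ⟨P, p, hP⟩ := hf
  obtain ⟨Q, q, hQ⟩ := hg
  refine ⟨.pair P Q, p + q + (2 * Polynomial.X + 3), fun n a => ?_⟩
  obtain ⟨t, ht, he⟩ := hP n a
  obtain ⟨s, hs, he'⟩ := hQ n a
  refine ⟨_, ?_, Eval.pair he he'⟩
  have h2 := of_size_eq_self n a
  simp only [Polynomial.eval_add, Polynomial.eval_X, Polynomial.eval_mul, Polynomial.eval_ofNat]
  omega

/-- A family computed by one more step of a program without index. -/
theorem step {f : ∀ n, α n → β n} (hf : PolyT f) (P : Program) {g : ∀ n, α n → γ n}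
    (h : ∀ n a, Eval P (enc (f n a)) (enc (g n a)) ((enc (f n a)).size + 1)) : PolyT g := by
  obtain ⟨Q, q, hQ⟩ := hf
  refine ⟨.comp P Q, 2 * q + 1 + (2 * Polynomial.X + 3), fun n a => ?_⟩
  obtain ⟨s, hs, he⟩ := hQ n a
  refine ⟨_, ?_, Eval.comp he (h n a)⟩
  have h2 := of_size_eq_self n a
  have h1 := he.size_le
  simp only [Polynomial.eval_add, Polynomial.eval_X, Polynomial.eval_mul, Polynomial.eval_ofNat,
    Polynomial.eval_one]
  omega

theorem fst {f : ∀ n, α n → β n × γ n} (hf : PolyT f) : PolyT fun n a => (f n a).1 :=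
  hf.step .fst fun n a => Eval.fst (enc (f n a))

theorem snd {f : ∀ n, α n → β n × γ n} (hf : PolyT f) : PolyT fun n a => (f n a).2 :=
  hf.step .snd fun n a => Eval.snd (enc (f n a))

/-- Use of a function of several arguments. -/
theorem comp₂ {g : ∀ n, β n × γ n → δ n} (hg : PolyT g) {f : ∀ n, α n → β n} {f' : ∀ n, α n → γ n}
    (hf : PolyT f) (hf' : PolyT f') : PolyT fun n a => g n (f n a, f' n a) :=
  hg.comp (hf.pair hf')

open Classical in
theorem ite {p : ∀ n, α n → Prop} {f g : ∀ n, α n → β n} (hp : PolyT p) (hf : PolyT f)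
    (hg : PolyT g) : PolyT fun n a => if p n a then f n a else g n a := by
  obtain ⟨C, c, hC⟩ := hp
  obtain ⟨P, p, hP⟩ := hf
  obtain ⟨Q, q, hQ⟩ := hg
  refine ⟨.ite C P Q, c + p + q + (2 * Polynomial.X + 3), fun n a => ?_⟩
  obtain ⟨r, hr, hc⟩ := hC n a
  obtain ⟨t, ht, he⟩ := hP n a
  obtain ⟨s, hs, he'⟩ := hQ n a
  have h2 := of_size_eq_self n a
  simp only [Polynomial.eval_add, Polynomial.eval_X, Polynomial.eval_mul, Polynomial.eval_ofNat]
  split_ifs with h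
  · exact ⟨_, by omega, Eval.ite_true hc ((enc_ne_nil_iff _).2 h) he⟩
  · exact ⟨_, by omega, Eval.ite_false (enc_prop_false h ▸ hc) he'⟩

/-- Iteration of a step along a list, if the intermediate results are polynomially bounded. -/
theorem foldl {l : ∀ n, α n → List (γ n)} {init : ∀ n, α n → σ n}
    {step : ∀ n, α n → σ n → γ n → σ n} (hl : PolyT l) (hi : PolyT init)
    (hs : PolyT fun n (x : (α n × σ n) × γ n) => step n x.1.1 x.1.2 x.2)
    (hb : ∃ q : Polynomial ℕ, ∀ n a l', l' <+: l n a →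
      sz (l'.foldl (step n a) (init n a)) ≤ q.eval (n + sz a)) :
    PolyT fun n a => (l n a).foldl (step n a) (init n a) := by
  obtain ⟨q, hq⟩ := hb
  obtain ⟨P, p, hP⟩ := hs
  -- `L` works on the state `((index, a), (remaining list, accumulator))`. `Z` bounds the codes of
  -- the list and of all later accumulators, so one polynomial bounds the cost of every round.
  suffices H : ∃ (L : Program) (r : Polynomial ℕ), ∀ n (a : α n) (l : List (γ n)) (s : σ n) (Z : ℕ),
      sz l ≤ Z → (∀ l', l' <+: l → sz (l'.foldl (step n a) s) ≤ Z) →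
      ∃ t ≤ (l.length + 1) * r.eval (n + sz a + Z),
        Eval L (.cons (.cons (unary n) (enc a)) (.cons (enc l) (enc s)))
          (.cons (.cons (unary n) (enc a)) (.cons .nil (enc (l.foldl (step n a) s)))) t by
    obtain ⟨L, r, hL⟩ := H
    obtain ⟨A, p₁, hA⟩ := hl
    obtain ⟨B, p₂, hB⟩ := hi
    refine ⟨.comp .snd (.comp .snd (.comp L (.pair .id (.pair A B)))),
      (p₁ + 1) * r.comp (Polynomial.X + (p₁ + q)) + p₁ + p₂ + 20 * (2 * Polynomial.X + 3) +
        3 * q, fun n a => ?_⟩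
    obtain ⟨t₁, ht₁, e₁⟩ := hA n a
    obtain ⟨t₂, ht₂, e₂⟩ := hB n a
    have h1 := e₁.size_le
    obtain ⟨t, ht, e⟩ := hL n a (l n a) (init n a) (p₁.eval (n + sz a) + q.eval (n + sz a))
      (by simp only [sz] at *; omega) (fun l' hl' => (hq n a l' hl').trans (by omega))
    refine ⟨_, ?_, Eval.comp (Eval.comp (Eval.comp (Eval.pair (Eval.id _) (Eval.pair e₁ e₂)) e)
      (Eval.snd _)) (Eval.snd _)⟩
    have h2 := of_size_eq_self n a
    have h3 := hq n a _ (List.prefix_refl _)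
    have h4 : (l n a).length ≤ p₁.eval (n + sz a) :=
      (length_le_sz _).trans (h1.trans ht₁)
    have h5 := ht.trans (Nat.mul_le_mul_right _ (Nat.succ_le_succ h4))
    simp only [Polynomial.eval_add, Polynomial.eval_X, Polynomial.eval_mul, Polynomial.eval_ofNat,
      Polynomial.eval_one, Polynomial.eval_comp, Data.size, Data.snd, Nat.succ_eq_add_one] at *
    have : sz (List.foldl (step n a) (init n a) (l n a)) =
      (enc (List.foldl (step n a) (init n a) (l n a))).size := rfl
    omega
  -- The test reads the remaining list, which is `nil` exactly when it is exhausted; the body drops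
  -- its head and rebuilds the accumulator.
  refine ⟨.loop (.comp .fst .snd) (.pair .fst (.pair (.comp .snd (.comp .fst .snd))
    (.comp P (.pair (.comp .fst .fst) (.pair (.pair (.comp .snd .fst) (.comp .snd .snd))
      (.comp .fst (.comp .fst .snd))))))), p.comp (4 * Polynomial.X + 2) +
        100 * (4 * Polynomial.X + 10), fun n a l => ?_⟩
  induction l with
  | nil =>
    intro s Z _ hs
    have h1 := hs [] (List.prefix_refl _)
    refine ⟨_, ?_, Eval.loop_done (Eval.comp (Eval.snd _) (Eval.fst _))⟩
    simp only [Polynomial.eval_add, Polynomial.eval_X, Polynomial.eval_mul, Polynomial.eval_ofNat,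
      Polynomial.eval_comp, Data.size, Data.snd, size_unary,
      List.length_nil, zero_add, one_mul, List.foldl_nil, enc, Data.ofList, sz] at *
    omega
  | cons g l ih =>
    intro s Z hZ hs
    have h0 := hs [] (List.nil_prefix)
    have h1 := hs [g] ⟨l, rfl⟩
    obtain ⟨t, ht, e⟩ := ih (step n a s g) Z (by rw [sz_cons] at hZ; omega)
      (fun l' hl' => hs (g :: l') (List.cons_prefix_cons.2 ⟨rfl, hl'⟩))
    obtain ⟨t', ht', e'⟩ := hP n ((a, s), g)
    have hc : ∀ d d' : Data, Data.cons d d' ≠ .nil := fun d d' h => by cases h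
    refine ⟨_, ?_, Eval.loop_step (Eval.comp (Eval.snd _) (Eval.fst _)) (hc (enc g) (enc l))
      (Eval.pair (Eval.fst _) (Eval.pair (Eval.comp (Eval.comp (Eval.snd _) (Eval.fst _))
        (Eval.snd _)) (Eval.comp (Eval.pair (Eval.comp (Eval.fst _) (Eval.fst _)) (Eval.pair
          (Eval.pair (Eval.comp (Eval.fst _) (Eval.snd _)) (Eval.comp (Eval.snd _) (Eval.snd _)))
          (Eval.comp (Eval.comp (Eval.snd _) (Eval.fst _)) (Eval.fst _)))) e'))) e⟩
    have h2 : p.eval (n + sz ((a, s), g)) ≤ p.eval (4 * (n + sz a + Z) + 2) := by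
      refine eval_le p ?_
      simp only [sz_prod, sz_cons, List.foldl_nil] at *
      omega
    have h3 : enc (g :: l) = .cons (enc g) (enc l) := rfl
    simp only [Polynomial.eval_add, Polynomial.eval_X, Polynomial.eval_mul, Polynomial.eval_ofNat,
      Polynomial.eval_comp, Data.size, Data.snd, Data.fst, size_unary,
      List.length_cons, h3, List.foldl_nil, List.foldl_cons, sz, add_mul, one_mul] at *
    omega

end PolyT
end MatchReconf

/-! ### Iteration, bounded state types and selection of a vertex -/

namespace MatchReconf
open Enc (enc)

theorem enc_replicate (k : ℕ) : enc (List.replicate k ()) = unary k := by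
  induction k with
  | zero => rfl
  | succ k ih => exact congrArg (Data.cons .nil) ih

theorem foldl_replicate {σ : Type} (f : σ → σ) (s : σ) (k : ℕ) :
    (List.replicate k ()).foldl (fun s _ => f s) s = f^[k] s := by
  induction k generalizing s with
  | zero => rfl
  | succ k ih => simp [List.replicate_succ, ih]

theorem snd_iterate_ofList {α : Type} (e : α → Data) (l : List α) (i : ℕ) :
    Data.snd^[i] (Data.ofList e l) = Data.ofList e (l.drop i) := by
  induction i generalizing l with
  | zero => rfl
  | succ i ih =>
    cases l with
    | nil => simpa [Data.ofList, Data.snd] using ih []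
    | cons a l => simpa [Data.ofList, Data.snd] using ih l

theorem size_snd_le (d : Data) : d.snd.size ≤ d.size := by
  cases d <;> simp only [Data.snd, Data.size] <;> omega

theorem size_snd_iterate_le (d : Data) (i : ℕ) : (Data.snd^[i] d).size ≤ d.size := by
  induction i with
  | zero => rfl
  | succ i ih => rw [Function.iterate_succ_apply']; exact (size_snd_le _).trans ih

/-- Types all of whose elements have polynomially bounded codes. -/
class Bdd (σ : ℕ → Type) [∀ n, Enc (σ n)] : Prop where
  bdd : ∃ q : Polynomial ℕ, ∀ n (s : σ n), sz s ≤ q.eval n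

instance : Bdd fun _ => Prop := ⟨3, fun _ s => by simpa using sz_prop_le s⟩

instance {σ : ℕ → Type} [∀ n, Enc (σ n)] [Bdd σ] : Bdd fun n => Fin n → σ n := by
  obtain ⟨p, hp⟩ := Bdd.bdd (σ := σ)
  refine ⟨Polynomial.X * (p + 1) + 1, fun n s => ?_⟩
  have h : sz s ≤ _ := sz_list_le (List.ofFn s) (p.eval n) (by simp [List.mem_ofFn, hp])
  simpa using h

/-- The last `g v` with `p v`, if any, else `d`. -/
noncomputable def pickVal {n : ℕ} {β : Type} (p : Fin n → Prop) (g : Fin n → β) (d : β) : β :=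
  open Classical in (List.finRange n).foldl (fun s v => if p v then g v else s) d

open Classical in
theorem pickVal_list {ι β : Type} (p : ι → Prop) (g : ι → β) (d : β) (l : List ι) :
    (∃ v ∈ l, p v ∧ l.foldl (fun s v => if p v then g v else s) d = g v) ∨
      (∀ v ∈ l, ¬ p v) ∧ l.foldl (fun s v => if p v then g v else s) d = d := by
  induction l generalizing d with
  | nil => simp
  | cons a l ih =>
    rw [List.foldl_cons]
    rcases ih (if p a then g a else d) with ⟨v, hv, hp, h⟩ | ⟨h, h'⟩
    · exact .inl ⟨v, by simp [hv], hp, h⟩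
    · rw [h']
      split_ifs with ha
      · exact .inl ⟨a, by simp, ha, rfl⟩
      · exact .inr ⟨by simpa [ha] using h, rfl⟩

theorem pickVal_cases {n : ℕ} {β : Type} (p : Fin n → Prop) (g : Fin n → β) (d : β) :
    (∃ v, p v ∧ pickVal p g d = g v) ∨ (∀ v, ¬ p v) ∧ pickVal p g d = d := by
  simpa [pickVal] using pickVal_list p g d (List.finRange n)

open Classical in
/-- The number of vertices with a given property. -/
noncomputable def cnt {n : ℕ} (p : Fin n → Prop) : ℕ := (Finset.univ.filter p).card

/-! ### Closure under iteration, logic, arithmetic, lists and tables -/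

namespace PolyT

variable {α β γ δ σ : ℕ → Type} [∀ n, Enc (α n)] [∀ n, Enc (β n)] [∀ n, Enc (γ n)]
  [∀ n, Enc (δ n)] [∀ n, Enc (σ n)]

theorem foldl_bdd [Bdd σ] {l : ∀ n, α n → List (γ n)} {init : ∀ n, α n → σ n}
    {step : ∀ n, α n → σ n → γ n → σ n} (hl : PolyT l) (hi : PolyT init)
    (hs : PolyT fun n (x : (α n × σ n) × γ n) => step n x.1.1 x.1.2 x.2) :
    PolyT fun n a => (l n a).foldl (step n a) (init n a) := by
  obtain ⟨q, hq⟩ := Bdd.bdd (σ := σ)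
  exact hl.foldl hi hs ⟨q, fun n a l' _ => (hq n _).trans (eval_le q (by omega))⟩

theorem dim : PolyT fun n (_ : α n) => n :=
  ⟨.fst, 2 * Polynomial.X + 3, fun n a => ⟨_, by
    have := of_size_eq_self n a
    simp
    omega, Eval.fst _⟩⟩

theorem replicate {k : ∀ n, α n → ℕ} (hk : PolyT k) :
    PolyT fun n a => List.replicate (k n a) () :=
  hk.congr_enc fun n a => (enc_replicate _).symm

/-- A unary number has the same code as a list of that many units, so iteration is a fold along this
list. -/
theorem iterate {k : ∀ n, α n → ℕ} {init : ∀ n, α n → σ n} {step : ∀ n, α n → σ n → σ n}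
    (hk : PolyT k) (hi : PolyT init) (hs : PolyT fun n (x : α n × σ n) => step n x.1 x.2)
    (hb : ∃ q : Polynomial ℕ, ∀ n a j, j ≤ k n a →
      sz ((step n a)^[j] (init n a)) ≤ q.eval (n + sz a)) :
    PolyT fun n a => (step n a)^[k n a] (init n a) := by
  obtain ⟨q, hq⟩ := hb
  refine (hk.replicate.foldl (γ := fun _ => Unit) (step := fun n a s (_ : Unit) => step n a s) hi
    (hs.comp id.fst) ⟨q, fun n a l' h => ?_⟩).congr fun n a => foldl_replicate _ _ _
  obtain ⟨hl, hl'⟩ := List.prefix_replicate_iff.1 h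
  rw [hl', foldl_replicate]
  exact hq n a _ hl

theorem iterate_bdd [Bdd σ] {k : ∀ n, α n → ℕ} {init : ∀ n, α n → σ n}
    {step : ∀ n, α n → σ n → σ n} (hk : PolyT k) (hi : PolyT init)
    (hs : PolyT fun n (x : α n × σ n) => step n x.1 x.2) :
    PolyT fun n a => (step n a)^[k n a] (init n a) := by
  obtain ⟨q, hq⟩ := Bdd.bdd (σ := σ)
  exact hk.iterate hi hs ⟨q, fun n a j _ => (hq n _).trans (eval_le q (by omega))⟩

/-! Logic -/

theorem true : PolyT fun n (_ : α n) => True :=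
  constant (.cons .nil .nil) fun _ _ => by simp [enc, Data.ofBool]

theorem false : PolyT fun n (_ : α n) => False :=
  constant .nil fun _ _ => by simp [enc, Data.ofBool]

theorem not {p : ∀ n, α n → Prop} (hp : PolyT p) : PolyT fun n a => ¬ p n a :=
  (hp.ite false true).congr fun n a => by by_cases h : p n a <;> simp [h]

theorem and {p q : ∀ n, α n → Prop} (hp : PolyT p) (hq : PolyT q) :
    PolyT fun n a => p n a ∧ q n a :=
  (hp.ite hq false).congr fun n a => by by_cases h : p n a <;> simp [h]

theorem or {p q : ∀ n, α n → Prop} (hp : PolyT p) (hq : PolyT q) :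
    PolyT fun n a => p n a ∨ q n a :=
  (hp.ite true hq).congr fun n a => by by_cases h : p n a <;> simp [h]

theorem imp {p q : ∀ n, α n → Prop} (hp : PolyT p) (hq : PolyT q) :
    PolyT fun n a => p n a → q n a :=
  (hp.not.or hq).congr fun n a => by rw [imp_iff_not_or]

theorem iff {p q : ∀ n, α n → Prop} (hp : PolyT p) (hq : PolyT q) :
    PolyT fun n a => p n a ↔ q n a :=
  ((hp.imp hq).and (hq.imp hp)).congr fun n a => by rw [iff_def]

/-! Numbers -/

theorem natConst (k : ℕ) : PolyT fun n (_ : α n) => k := constant (unary k) fun _ _ => rfl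

theorem succ {k : ∀ n, α n → ℕ} (hk : PolyT k) : PolyT fun n a => k n a + 1 :=
  ((constant (f := fun n (_ : α n) => ()) .nil fun _ _ => rfl).pair hk).congr_enc fun _ _ => rfl

theorem pred {k : ∀ n, α n → ℕ} (hk : PolyT k) : PolyT fun n a => k n a - 1 := by
  refine hk.step .snd fun n a => ?_
  have : enc (k n a - 1) = (enc (k n a)).snd := by cases k n a <;> rfl
  rw [this]
  exact Eval.snd _

theorem sub {k m : ∀ n, α n → ℕ} (hk : PolyT k) (hm : PolyT m) :
    PolyT fun n a => k n a - m n a := by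
  obtain ⟨q, hq⟩ := hk.size_le
  have h (n a j) : (fun s => s - 1)^[j] (k n a) = k n a - j := by
    induction j with
    | zero => rfl
    | succ j ih => rw [Function.iterate_succ_apply', ih]; omega
  refine (hm.iterate (step := fun n a s => s - 1) hk id.snd.pred ⟨q, fun n a j _ => ?_⟩).congr
    fun n a => h n a _
  rw [h]
  have := hq n a
  simp only [sz_nat] at *
  omega

theorem add {k m : ∀ n, α n → ℕ} (hk : PolyT k) (hm : PolyT m) :
    PolyT fun n a => k n a + m n a := by
  obtain ⟨q, hq⟩ := hk.size_le
  obtain ⟨r, hr⟩ := hm.size_le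
  have h (n a j) : (fun s => s + 1)^[j] (k n a) = k n a + j := by
    induction j with
    | zero => rfl
    | succ j ih => rw [Function.iterate_succ_apply', ih]; omega
  refine (hm.iterate (step := fun n a s => s + 1) hk id.snd.succ
    ⟨q + r, fun n a j hj => ?_⟩).congr fun n a => h n a _
  rw [h, Polynomial.eval_add]
  have := hq n a
  have := hr n a
  simp only [sz_nat] at *
  omega

theorem eq_zero {k : ∀ n, α n → ℕ} (hk : PolyT k) : PolyT fun n a => k n a = 0 := by
  obtain ⟨P, p, h⟩ := hk
  have : PolyT fun n (a : α n) => k n a ≠ 0 := by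
    -- Zero is coded by `nil`, so the built-in test decides `k ≠ 0`.
    refine ⟨.ite P (.pair .nil .nil) .nil, p + 4 * (2 * Polynomial.X + 3), fun n a => ?_⟩
    obtain ⟨t, ht, he⟩ := h n a
    have h2 := of_size_eq_self n a
    simp only [Polynomial.eval_add, Polynomial.eval_X, Polynomial.eval_mul, Polynomial.eval_ofNat]
    by_cases h0 : k n a = 0
    · rw [enc_prop_false (by simpa using h0)]
      rw [h0] at he
      exact ⟨_, by omega, Eval.ite_false he (Eval.nil _)⟩
    · have h3 : enc (k n a) ≠ .nil := by
        obtain ⟨j, hj⟩ := Nat.exists_eq_succ_of_ne_zero h0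
        rw [hj]
        exact fun h => by cases h
      have h4 : enc (k n a ≠ 0) = .cons .nil .nil := by simp [enc, h0, Data.ofBool]
      rw [h4]
      exact ⟨_, by omega, Eval.ite_true he h3 (Eval.pair (Eval.nil _) (Eval.nil _))⟩
  exact this.not.congr fun n a => by simp

theorem le {k m : ∀ n, α n → ℕ} (hk : PolyT k) (hm : PolyT m) :
    PolyT fun n a => k n a ≤ m n a :=
  (hk.sub hm).eq_zero.congr fun n a => by rw [Nat.sub_eq_zero_iff_le]

theorem lt {k m : ∀ n, α n → ℕ} (hk : PolyT k) (hm : PolyT m) :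
    PolyT fun n a => k n a < m n a :=
  (hm.le hk).not.congr fun n a => by rw [not_le]

theorem natEq {k m : ∀ n, α n → ℕ} (hk : PolyT k) (hm : PolyT m) :
    PolyT fun n a => k n a = m n a :=
  ((hk.le hm).and (hm.le hk)).congr fun n a => propext (by omega)

theorem finVal {i : ∀ n, α n → Fin n} (hi : PolyT i) : PolyT fun n a => (i n a : ℕ) :=
  hi.congr_enc fun _ _ => rfl

theorem finEq {i j : ∀ n, α n → Fin n} (hi : PolyT i) (hj : PolyT j) :
    PolyT fun n a => i n a = j n a :=
  (hi.finVal.natEq hj.finVal).congr fun n a => by rw [Fin.ext_iff]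

theorem finLt {i j : ∀ n, α n → Fin n} (hi : PolyT i) (hj : PolyT j) :
    PolyT fun n a => i n a < j n a :=
  (hi.finVal.lt hj.finVal).congr fun n a => by rw [Fin.lt_def]

theorem finLe {i j : ∀ n, α n → Fin n} (hi : PolyT i) (hj : PolyT j) :
    PolyT fun n a => i n a ≤ j n a :=
  (hi.finVal.le hj.finVal).congr fun n a => by rw [Fin.le_def]

/-! Lists -/

theorem nil : PolyT fun n (_ : α n) => ([] : List (β n)) := constant .nil fun _ _ => rfl

theorem cons {f : ∀ n, α n → β n} {l : ∀ n, α n → List (β n)} (hf : PolyT f) (hl : PolyT l) :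
    PolyT fun n a => f n a :: l n a :=
  (hf.pair hl).congr_enc fun _ _ => rfl

theorem foldl_cons_eq {A B : Type} (f : A → B) (l : List A) (s : List B) :
    l.foldl (fun acc g => f g :: acc) s = (l.map f).reverse ++ s := by
  induction l generalizing s with
  | nil => rfl
  | cons a l ih => simp [ih]

/-- A fold can only push onto the front of its accumulator, so the image list appears reversed. The
case of the identity then gives `reverse`, which repairs the order in `map`. -/
theorem mapReverse {l : ∀ n, α n → List (γ n)} {f : ∀ n, α n → γ n → β n} (hl : PolyT l)
    (hf : PolyT fun n (x : α n × γ n) => f n x.1 x.2) :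
    PolyT fun n a => ((l n a).map (f n a)).reverse := by
  obtain ⟨p, hp⟩ := hl.size_le
  obtain ⟨q, hq⟩ := hf.size_le
  refine (hl.foldl (init := fun n a => []) (step := fun n a s g => f n a g :: s) nil
    ((hf.comp (id.fst.fst.pair id.snd)).cons id.fst.snd)
    ⟨p * (q.comp (Polynomial.X + p + 1) + 1) + 1, fun n a l' h => ?_⟩).congr fun n a => by
      rw [foldl_cons_eq, List.append_nil]
  rw [foldl_cons_eq, List.append_nil]
  refine (sz_list_le _ (q.eval ((n + sz a) + p.eval (n + sz a) + 1)) fun b hb => ?_).trans ?_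
  · simp only [List.mem_reverse, List.mem_map] at hb
    obtain ⟨g, hg, rfl⟩ := hb
    refine (hq n (a, g)).trans (eval_le q ?_)
    have := (sz_mem_le (h.subset hg)).trans (hp n a)
    simp only [sz_prod] at *
    omega
  · have h1 : l'.length ≤ p.eval (n + sz a) := h.length_le.trans ((length_le_sz _).trans (hp n a))
    simp only [List.length_reverse, List.length_map, Polynomial.eval_add, Polynomial.eval_mul,
      Polynomial.eval_comp, Polynomial.eval_X, Polynomial.eval_one]
    gcongr

theorem reverse {l : ∀ n, α n → List (β n)} (hl : PolyT l) : PolyT fun n a => (l n a).reverse :=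
  (hl.mapReverse (f := fun n a g => g) id.snd).congr fun n a => by simp

theorem map {l : ∀ n, α n → List (γ n)} {f : ∀ n, α n → γ n → β n} (hl : PolyT l)
    (hf : PolyT fun n (x : α n × γ n) => f n x.1 x.2) :
    PolyT fun n a => (l n a).map (f n a) :=
  (hl.mapReverse hf).reverse.congr fun n a => by simp

theorem append {l l' : ∀ n, α n → List (β n)} (hl : PolyT l) (hl' : PolyT l') :
    PolyT fun n a => l n a ++ l' n a := by
  obtain ⟨p, hp⟩ := hl.size_le
  obtain ⟨q, hq⟩ := hl'.size_le
  refine (hl.reverse.foldl (step := fun n a s g => g :: s) hl' (id.snd.cons id.fst.snd)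
    ⟨p + q, fun n a l₁ h => ?_⟩).congr fun n a => by
      simp [foldl_cons_eq (fun x : β n => x) (l n a).reverse (l' n a)]
  have h2 := foldl_cons_eq (fun x : β n => x) l₁ (l' n a)
  rw [h2]
  have h3 := sz_append (List.map (fun x => x) l₁).reverse (l' n a)
  have h4 : (List.map (fun x => x) l₁).reverse <:+ l n a := by
    rw [List.map_id', ← List.reverse_reverse (l n a)]
    exact List.reverse_suffix.2 h
  have h5 := sz_suffix_le h4
  have := hp n a
  have := hq n a
  rw [Polynomial.eval_add]
  omega

theorem length {l : ∀ n, α n → List (β n)} (hl : PolyT l) : PolyT fun n a => (l n a).length := by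
  have h {B : Type} (l : List B) (k : ℕ) : l.foldl (fun k _ => k + 1) k = k + l.length := by
    induction l generalizing k with
    | nil => rfl
    | cons a l ih => rw [List.foldl_cons, ih, List.length_cons]; omega
  obtain ⟨p, hp⟩ := hl.size_le
  refine (hl.foldl (step := fun n a k _ => k + 1) (natConst 0) id.fst.snd.succ
    ⟨2 * p + 1, fun n a l' hl' => ?_⟩).congr fun n a => by rw [h]; simp
  have := hl'.length_le.trans ((length_le_sz _).trans (hp n a))
  rw [h, sz_nat]
  simp
  omega

theorem finRange : PolyT fun n (_ : α n) => List.finRange n := by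
  -- The list is built over `ℕ`, together with a counter; an element of `Fin n` has the same code as
  -- its value.
  have h (j : ℕ) : (fun s : ℕ × List ℕ => (s.1 + 1, s.1 :: s.2))^[j] (0, []) =
      (j, (List.range j).reverse) := by
    induction j with
    | zero => rfl
    | succ j ih => rw [Function.iterate_succ_apply', ih, List.range_succ]; simp
  refine ((dim.iterate (σ := fun _ => ℕ × List ℕ) (init := fun n (_ : α n) => (0, []))
    (step := fun n a s => (s.1 + 1, s.1 :: s.2))
    ((natConst 0).pair nil) (id.snd.fst.succ.pair (id.snd.fst.cons id.snd.snd))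
    ⟨Polynomial.X * (2 * Polynomial.X + 2) + 2 * Polynomial.X + 4, fun n a j hj => ?_⟩).congr
    (fun n a => h n)).snd.reverse.congr_enc fun n a => ?_
  · rw [h, sz_prod, sz_nat]
    have h1 := sz_list_le (List.range j).reverse (2 * n + 1) (by
      intro k hk
      rw [List.mem_reverse, List.mem_range] at hk
      rw [sz_nat]
      omega)
    simp only [Polynomial.eval_add, Polynomial.eval_mul, Polynomial.eval_X, Polynomial.eval_ofNat]
    rw [List.length_reverse, List.length_range] at h1
    have h2 : j * (2 * n + 1 + 1) ≤ (n + sz a) * (2 * (n + sz a) + 2) :=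
      Nat.mul_le_mul (by omega) (by omega)
    omega
  · have h2 (l : List (Fin n)) : Data.ofList enc (l.map Fin.val) = Data.ofList enc l := by
      induction l with
      | nil => rfl
      | cons a l ih => exact congrArg (Data.cons _) ih
    have h3 := h2 (List.finRange n)
    simp only [List.reverse_reverse]
    rw [List.map_coe_finRange_eq_range] at h3
    exact h3

/-! Functions on `Fin n` -/

/-- A function on `Fin n` is coded by the list of its values, so abstraction is tabulation. -/
theorem lam {f : ∀ n, α n → Fin n → β n} (hf : PolyT fun n (x : α n × Fin n) => f n x.1 x.2) :
    PolyT fun n a => f n a :=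
  (finRange.map hf).congr_enc fun n a => by
    change Data.ofList enc _ = Data.ofList enc _
    rw [List.ofFn_eq_map]

/-- The `i`-th entry of a table is the head after `i` tail steps. -/
theorem app {g : ∀ n, α n → Fin n → β n} {i : ∀ n, α n → Fin n} (hg : PolyT g) (hi : PolyT i) :
    PolyT fun n a => g n a (i n a) := by
  obtain ⟨p, hp⟩ := hg.size_le
  have h1 : PolyT fun n (x : α n × Data) => x.2.snd :=
    id.snd.step .snd fun n a => Eval.snd _
  have h2 := (hi.finVal.iterate (σ := fun _ => Data) (init := fun n a => enc (g n a))
    (step := fun n a s => s.snd) (hg.congr_enc fun _ _ => rfl) h1 ⟨p, fun n a j _ =>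
      (size_snd_iterate_le _ _).trans (hp n a)⟩)
  refine (h2.step (g := fun n a => (Data.snd^[(i n a : ℕ)] (enc (g n a))).fst) .fst
    fun n a => Eval.fst _).congr_enc fun n a => ?_
  change (Data.snd^[(i n a : ℕ)] (Data.ofList enc (List.ofFn (g n a)))).fst = _
  rw [snd_iterate_ofList, List.drop_eq_getElem_cons (by simp)]
  simp [Data.ofList, Data.fst]

theorem ex {p : ∀ n, α n → Fin n → Prop} (hp : PolyT fun n (x : α n × Fin n) => p n x.1 x.2) :
    PolyT fun n a => ∃ i, p n a i := by
  have h {A : Type} (l : List A) (q : A → Prop) (s : Prop) :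
      l.foldl (fun s i => s ∨ q i) s = (s ∨ ∃ i ∈ l, q i) := by
    induction l generalizing s with
    | nil => simp
    | cons a l ih => rw [List.foldl_cons, ih]; simp [or_assoc]
  exact (finRange.foldl_bdd (σ := fun _ => Prop) (init := fun n a => False)
    (step := fun n a s i => s ∨ p n a i) false
    (id.fst.snd.or (hp.comp (id.fst.fst.pair id.snd)))).congr fun n a => by rw [h]; simp

theorem all {p : ∀ n, α n → Fin n → Prop} (hp : PolyT fun n (x : α n × Fin n) => p n x.1 x.2) :
    PolyT fun n a => ∀ i, p n a i :=
  (ex (p := fun n a i => ¬ p n a i) hp.not).not.congr fun n a => by simp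

open Classical in
theorem count {p : ∀ n, α n → Fin n → Prop} (hp : PolyT fun n (x : α n × Fin n) => p n x.1 x.2) :
    PolyT fun n a => cnt (p n a) := by
  have h {A : Type} (l : List A) (q : A → Prop) (s : ℕ) :
      l.foldl (fun s i => if q i then s + 1 else s) s = s + (l.filter q).length := by
    induction l generalizing s with
    | nil => simp
    | cons a l ih => rw [List.foldl_cons, ih]; by_cases h : q a <;> simp [h]; omega
  refine (finRange.foldl (σ := fun _ => ℕ) (init := fun n a => 0)
    (step := fun n a s i => if p n a i then s + 1 else s) (natConst 0)
    ((hp.comp (id.fst.fst.pair id.snd)).ite id.fst.snd.succ id.fst.snd)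
    ⟨2 * Polynomial.X + 1, fun n a l' hl => ?_⟩).congr fun n a => ?_
  · rw [h, sz_nat]
    have h1 := List.length_filter_le (fun i => decide (p n a i)) l'
    have h2 := hl.length_le
    rw [List.length_finRange] at h2
    simp
    omega
  · rw [h, cnt, zero_add, ← List.toFinset_card_of_nodup]
    · congr 1; ext; simp
    · exact (List.nodup_finRange n).filter _

open Classical in
theorem pick {p : ∀ n, α n → Fin n → Prop} {g : ∀ n, α n → Fin n → β n} {d : ∀ n, α n → β n}
    (hp : PolyT fun n (x : α n × Fin n) => p n x.1 x.2)
    (hg : PolyT fun n (x : α n × Fin n) => g n x.1 x.2) (hd : PolyT d) :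
    PolyT fun n a => pickVal (p n a) (g n a) (d n a) := by
  obtain ⟨q, hq⟩ := hg.size_le
  obtain ⟨r, hr⟩ := hd.size_le
  refine finRange.foldl (init := d) (step := fun n a s v => if p n a v then g n a v else s) hd
    ((hp.comp (id.fst.fst.pair id.snd)).ite (hg.comp (id.fst.fst.pair id.snd)) id.fst.snd)
    ⟨q.comp (3 * Polynomial.X + 2) + r, fun n a l' hl => ?_⟩
  rw [Polynomial.eval_add, Polynomial.eval_comp]
  rcases pickVal_list (p n a) (g n a) (d n a) l' with ⟨v, _, _, h⟩ | ⟨_, h⟩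
  · rw [h]
    refine (hq n (a, v)).trans (le_trans (eval_le q ?_) (Nat.le_add_right _ _))
    have := v.isLt
    simp only [sz_prod, sz_fin, Polynomial.eval_add, Polynomial.eval_mul, Polynomial.eval_X,
      Polynomial.eval_ofNat]
    omega
  · rw [h]
    exact (hr n a).trans (Nat.le_add_left _ _)

theorem pickF {p : ∀ n, α n → Fin n → Prop} {g : ∀ n, α n → Fin n → β n} {d : ∀ n, α n → β n}
    (hp : PolyT p) (hg : PolyT g) (hd : PolyT d) :
    PolyT fun n a => pickVal (p n a) (g n a) (d n a) :=
  pick ((hp.comp id.fst).app id.snd) ((hg.comp id.fst).app id.snd) hd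

theorem iteD {p : ∀ n, α n → Prop} {f g : ∀ n, α n → β n} {_ : ∀ n a, Decidable (p n a)}
    (hp : PolyT p) (hf : PolyT f) (hg : PolyT g) :
    PolyT fun n a => if p n a then f n a else g n a :=
  (ite hp hf hg).congr fun n a => by congr

end PolyT
end MatchReconf

namespace MatchReconf
open Enc (enc)

/-- Sets of vertices. -/
abbrev VSet (n : ℕ) := Fin n → Prop

/-- Binary relations on the vertices. -/
abbrev Rel (n : ℕ) := Fin n → Fin n → Prop

/-! ### Divide and conquer -/

open Classical in
/-- Recursion of bounded depth along a splitting `S = lf S ∪ rt S` of vertex sets. -/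
noncomputable def tree {n : ℕ} {β : Type} (lf rt : VSet n → VSet n) (base : β)
    (comb : VSet n → β → β → β) : ℕ → VSet n → β
  | 0, _ => base
  | j + 1, S => if (∃ x, lf S x) ∧ ∃ x, rt S x then
      comb S (tree lf rt base comb j (lf S)) (tree lf rt base comb j (rt S)) else base

open Classical in
/-- One level further down in the tree of blocks; `L v` is the block of `v`. -/
noncomputable def blockStep {n : ℕ} (lf rt : VSet n → VSet n) (L : Fin n → VSet n) :
    Fin n → VSet n :=
  fun v => if lf (L v) v then lf (L v) else rt (L v)

section
variable {n : ℕ} {β : Type} {lf rt : VSet n → VSet n} {base : β} {comb : VSet n → β → β → β}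

theorem blockStep_subset (hl : ∀ S x, lf S x → S x) (hr : ∀ S x, rt S x → S x) {L v x}
    (h : blockStep lf rt L v x) : L v x := by
  unfold blockStep at h
  split_ifs at h
  exacts [hl _ _ h, hr _ _ h]

/-- Blocks of one level are disjoint, because the two parts of every set are. This is what allows
one table entry per vertex. -/
theorem block_eq (hl : ∀ S x, lf S x → S x) (hr : ∀ S x, rt S x → S x)
    (hd : ∀ S x, lf S x → ¬ rt S x) (S : VSet n) (i : ℕ) :
    ∀ v x, (blockStep lf rt)^[i] (fun _ => S) v x →
      (blockStep lf rt)^[i] (fun _ => S) x = (blockStep lf rt)^[i] (fun _ => S) v := by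
  induction i with
  | zero => intro v x _; rfl
  | succ i ih =>
    intro v x h
    rw [Function.iterate_succ_apply'] at h ⊢
    have h1 := ih v x (blockStep_subset hl hr h)
    generalize (blockStep lf rt)^[i] (fun _ => S) = L at *
    unfold blockStep at h ⊢
    rw [h1]
    split_ifs at h with h2
    · rw [if_pos h, if_pos h2]
    · rw [if_neg fun h3 => hd _ _ h3 h, if_neg h2]

open Classical in
/-- One round of the bottom-up evaluation of the recursion; `L` are the blocks, `T` the values of
the blocks of the level below. -/
noncomputable def tableStep (lf rt : VSet n → VSet n) (base : β) (comb : VSet n → β → β → β)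
    (L : Fin n → VSet n) (T : Fin n → β) : Fin n → β :=
  fun v => if L v v then if (∃ x, lf (L v) x) ∧ ∃ x, rt (L v) x then
    comb (L v) (pickVal (lf (L v)) T base) (pickVal (rt (L v)) T base) else base else base

open Classical in
-- The invariant of the bottom-up evaluation: after `j` rounds the entry of `v` is the depth-`j`
-- recursion on the block of `v` at level `k - j`. Entries of vertices outside their own block are
-- junk, set to `base`.
theorem table_eq (hl : ∀ S x, lf S x → S x) (hr : ∀ S x, rt S x → S x)
    (hd : ∀ S x, lf S x → ¬ rt S x) (S : VSet n) (k j : ℕ) (hj : j ≤ k) :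
    (fun s : ℕ × (Fin n → β) => (s.1 + 1, tableStep lf rt base comb
      ((blockStep lf rt)^[k - (s.1 + 1)] fun _ => S) s.2))^[j] (0, fun _ => base) =
    (j, fun v => if (blockStep lf rt)^[k - j] (fun _ => S) v v then
      tree lf rt base comb j ((blockStep lf rt)^[k - j] (fun _ => S) v) else base) := by
  induction j with
  | zero => simp [tree]
  | succ j ih =>
    rw [Function.iterate_succ_apply', ih (by omega)]
    refine Prod.ext rfl (funext fun v => ?_)
    have hk : k - j = (k - (j + 1)) + 1 := by omega
    dsimp only
    rw [hk]
    have hB := block_eq hl hr hd S (k - (j + 1)) v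
    generalize k - (j + 1) = i at *
    rw [Function.iterate_succ_apply']
    generalize (blockStep lf rt)^[i] (fun _ => S) = L at *
    unfold tableStep
    by_cases h1 : L v v
    · rw [if_pos h1, if_pos h1, tree]
      by_cases h2 : (∃ x, lf (L v) x) ∧ ∃ x, rt (L v) x
      · rw [if_pos h2, if_pos h2]
        congr 1
        -- All vertices of the left part carry the value of the left part, so it does not matter
        -- which one is picked.
        · rcases pickVal_cases (lf (L v)) (fun v => if blockStep lf rt L v v then
              tree lf rt base comb j (blockStep lf rt L v) else base) base with ⟨x, hx, h⟩ | h
          · have h3 : blockStep lf rt L x = lf (L v) := by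
              unfold blockStep
              rw [hB x (hl _ _ hx), if_pos hx]
            rw [h, h3, if_pos hx]
          · obtain ⟨x, hx⟩ := h2.1
            exact absurd hx (h.1 x)
        · rcases pickVal_cases (rt (L v)) (fun v => if blockStep lf rt L v v then
              tree lf rt base comb j (blockStep lf rt L v) else base) base with ⟨x, hx, h⟩ | h
          · have h3 : blockStep lf rt L x = rt (L v) := by
              unfold blockStep
              rw [hB x (hr _ _ hx), if_neg fun h' => hd _ _ h' hx]
            rw [h, h3, if_pos hx]
          · obtain ⟨x, hx⟩ := h2.2
            exact absurd hx (h.1 x)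
      · rw [if_neg h2, if_neg h2]
    · rw [if_neg h1, if_neg h1]

end

open Classical in
-- Unfolding the recursion may take exponentially many calls, but a level has at most `n` distinct
-- nonempty blocks. The `k` levels are therefore evaluated from the bottom with a table of `n`
-- values; `hb` keeps the entries polynomially small.
theorem PolyT.tree {α β : ℕ → Type} [∀ n, Enc (α n)] [∀ n, Enc (β n)]
    {lf rt : ∀ n, α n → VSet n → VSet n} {base : ∀ n, α n → β n}
    {comb : ∀ n, α n → VSet n → β n → β n → β n} {k : ∀ n, α n → ℕ} {S : ∀ n, α n → VSet n}
    (hk : PolyT k) (hS : PolyT S)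
    (hlf : PolyT fun n (x : α n × VSet n) => lf n x.1 x.2)
    (hrt : PolyT fun n (x : α n × VSet n) => rt n x.1 x.2) (hbase : PolyT base)
    (hcomb : PolyT fun n (x : (α n × VSet n) × β n × β n) => comb n x.1.1 x.1.2 x.2.1 x.2.2)
    (hl : ∀ n a S x, lf n a S x → S x) (hr : ∀ n a S x, rt n a S x → S x)
    (hd : ∀ n a S x, lf n a S x → ¬ rt n a S x)
    (hb : ∃ q : Polynomial ℕ, ∀ n a j S,
      sz (MatchReconf.tree (lf n a) (rt n a) (base n a) (comb n a) j S) ≤ q.eval (n + sz a)) :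
    PolyT fun n a => MatchReconf.tree (lf n a) (rt n a) (base n a) (comb n a) (k n a) (S n a) := by
  obtain ⟨q, hq⟩ := hb
  obtain ⟨r, hr'⟩ := hk.size_le
  have hblk : PolyT fun n (x : α n × ℕ) =>
      (blockStep (lf n x.1) (rt n x.1))^[x.2] (fun _ => S n x.1) := by
    refine id.snd.iterate_bdd (σ := fun n => Fin n → VSet n)
      (init := fun n (x : α n × ℕ) _ => S n x.1)
      (step := fun n x L => blockStep (lf n x.1) (rt n x.1) L) (lam (hS.comp id.fst.fst)) ?_
    refine lam (iteD ?_ ?_ ?_)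
    · exact app (hlf.comp₂ id.fst.fst.fst (id.fst.snd.app id.snd)) id.snd
    · exact hlf.comp₂ id.fst.fst.fst (id.fst.snd.app id.snd)
    · exact hrt.comp₂ id.fst.fst.fst (id.fst.snd.app id.snd)
  have htab : PolyT fun n (x : (α n × (Fin n → VSet n)) × (Fin n → β n)) =>
      tableStep (lf n x.1.1) (rt n x.1.1) (base n x.1.1) (comb n x.1.1) x.1.2 x.2 := by
    have hL : PolyT fun n (x : ((α n × (Fin n → VSet n)) × (Fin n → β n)) × Fin n) =>
      x.1.1.2 x.2 := id.fst.fst.snd.app id.snd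
    have hlf' : PolyT fun n (x : ((α n × (Fin n → VSet n)) × (Fin n → β n)) × Fin n) =>
      lf n x.1.1.1 (x.1.1.2 x.2) := hlf.comp₂ id.fst.fst.fst hL
    have hrt' : PolyT fun n (x : ((α n × (Fin n → VSet n)) × (Fin n → β n)) × Fin n) =>
      rt n x.1.1.1 (x.1.1.2 x.2) := hrt.comp₂ id.fst.fst.fst hL
    have hb : PolyT fun n (x : ((α n × (Fin n → VSet n)) × (Fin n → β n)) × Fin n) =>
      base n x.1.1.1 := hbase.comp id.fst.fst.fst
    have hT : PolyT fun n (x : ((α n × (Fin n → VSet n)) × (Fin n → β n)) × Fin n) =>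
      x.1.2 := id.fst.snd
    exact lam (iteD (hL.app id.snd) (iteD (and (ex ((hlf'.comp id.fst).app id.snd))
      (ex ((hrt'.comp id.fst).app id.snd)))
      (hcomb.comp₂ (id.fst.fst.fst.pair hL) (pair (hlf'.pickF hT hb) (hrt'.pickF hT hb))) hb) hb)
  have hmain := hk.iterate (σ := fun n => ℕ × (Fin n → β n))
    (init := fun n a => (0, fun _ => base n a))
    (step := fun n a s => (s.1 + 1, tableStep (lf n a) (rt n a) (base n a) (comb n a)
      ((blockStep (lf n a) (rt n a))^[k n a - (s.1 + 1)] fun _ => S n a) s.2))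
    ((natConst 0).pair (lam (hbase.comp id.fst)))
    (id.snd.fst.succ.pair (htab.comp₂ (id.fst.pair (hblk.comp₂ id.fst
      ((hk.comp id.fst).sub id.snd.fst.succ))) id.snd.snd))
    ⟨2 * r + 2 + (Polynomial.X * (q + 1) + 1), fun n a j hj => by
      rw [table_eq (hl n a) (hr n a) (hd n a) _ _ _ hj, sz_prod, sz_nat]
      set T : Fin n → β n := fun v => if (blockStep (lf n a) (rt n a))^[k n a - j]
        (fun _ => S n a) v v then MatchReconf.tree (lf n a) (rt n a) (base n a) (comb n a) j
          ((blockStep (lf n a) (rt n a))^[k n a - j] (fun _ => S n a) v) else base n a with hT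
      have h1 : sz T ≤ _ := sz_list_le (List.ofFn T) (q.eval (n + sz a)) (by
        intro b hb
        obtain ⟨v, rfl⟩ := List.mem_ofFn.1 hb
        rw [hT]
        dsimp only
        split_ifs
        · exact hq _ _ _ _
        · exact hq n a 0 (S n a))
      rw [List.length_ofFn] at h1
      have h2 := hr' n a
      rw [sz_nat] at h2
      have h3 : n * (q.eval (n + sz a) + 1) ≤ (n + sz a) * (q.eval (n + sz a) + 1) :=
        Nat.mul_le_mul_right _ (by omega)
      simp only [Polynomial.eval_add, Polynomial.eval_mul, Polynomial.eval_X,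
        Polynomial.eval_ofNat, Polynomial.eval_one]
      omega⟩
  -- At level `0` the block is `S`, so any vertex of `S` carries the answer; for empty `S` the
  -- recursion returns `base`.
  refine (hS.pickF hmain.snd hbase).congr fun n a => ?_
  rw [table_eq (hl n a) (hr n a) (hd n a) _ _ _ le_rfl]
  rcases pickVal_cases (S n a) (fun v => if (blockStep (lf n a) (rt n a))^[k n a - k n a]
        (fun _ => S n a) v v then MatchReconf.tree (lf n a) (rt n a) (base n a) (comb n a) (k n a)
          ((blockStep (lf n a) (rt n a))^[k n a - k n a] (fun _ => S n a) v) else base n a)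
    (base n a) with ⟨v, hv, h⟩ | ⟨h, h'⟩
  · rw [h, Nat.sub_self]
    exact if_pos hv
  · rw [h']
    cases k n a with
    | zero => rfl
    | succ j =>
      rw [MatchReconf.tree, if_neg]
      rintro ⟨⟨x, hx⟩, _⟩
      exact h x (hl _ _ _ _ hx)

end MatchReconf

namespace MatchReconf
open Enc (enc)

/-! ### The algorithm -/

section Definitions
variable {n : ℕ}

/-- The vertices that can be reached inside `S` from the set `s` in at most `n` steps. -/
def reach (E : Rel n) (S s : VSet n) : VSet n :=
  (fun (T : VSet n) x => T x ∨ S x ∧ ∃ y, T y ∧ E y x)^[n] s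

/-- The singleton of the first vertex of `S`. -/
def first (S : VSet n) : VSet n := fun x => S x ∧ ∀ y, S y → x ≤ y

/-- The component of the first vertex of `S`. -/
def component (E : Rel n) (S : VSet n) : VSet n := reach E S (first S)

def IsUnion (E : Rel n) (S : VSet n) : Prop := ∃ x, S x ∧ ¬ component E S x

/-- The first part of `S`: a component, or a co-component if `S` is connected. -/
def leftPart (E : Rel n) (S : VSet n) : VSet n := fun x =>
  (IsUnion E S ∧ component E S x) ∨ (¬ IsUnion E S ∧ component (fun x y => ¬ E x y) S x)

/-- The rest of `S`. -/
def rightPart (E : Rel n) (S : VSet n) : VSet n := fun x => S x ∧ ¬ leftPart E S x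

def LeftBig (E : Rel n) (S : VSet n) : Prop := cnt (rightPart E S) ≤ cnt (leftPart E S)

open Classical in
noncomputable def bigPart (E : Rel n) (S : VSet n) : VSet n :=
  if LeftBig E S then leftPart E S else rightPart E S

open Classical in
noncomputable def smallPart (E : Rel n) (S : VSet n) : VSet n :=
  if LeftBig E S then rightPart E S else leftPart E S

/-- The position of `x` in `P`, starting with `1`. -/
noncomputable def rank (P : VSet n) (x : Fin n) : ℕ := cnt fun y => P y ∧ y ≤ x

/-- The first `c` elements of `P` are joined to the first `c` elements of `Q`. -/
def zipRel (P Q : VSet n) (c : ℕ) : Rel n := fun x y =>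
  P x ∧ Q y ∧ rank P x = rank Q y ∧ rank P x ≤ c

/-- The vertices of `A` that `X` does not cover. -/
def uncovered (A : VSet n) (X : Rel n) : VSet n := fun x => A x ∧ ¬ ∃ y, X x y

/-- The smaller endpoints of the edges of `K`. -/
def lower (K : Rel n) : VSet n := fun x => ∃ y, K x y ∧ x < y

/-- The first edges of `K`, so many that at most `d` vertices are covered. -/
def trunc (d : ℕ) (K : Rel n) : Rel n := fun x y =>
  K x y ∧ ((x < y ∧ rank (lower K) x + rank (lower K) x ≤ d) ∨
    (y < x ∧ rank (lower K) y + rank (lower K) y ≤ d))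

/-- `X` together with `c` edges between `B` and the part of `A` not covered by `X`. -/
def joinMatching (A B : VSet n) (X : Rel n) (c : ℕ) : Rel n := fun x y =>
  X x y ∨ zipRel B (uncovered A X) c x y ∨ zipRel B (uncovered A X) c y x

open Classical in
-- In a join, `B` is matched completely into `A`, so at most `|A| - |B|` vertices of `A` may be
-- matched inside `A`. Hence only the matching of the larger side is needed.
noncomputable def maxComb (E : Rel n) (S : VSet n) (k₁ k₂ : Rel n) : Rel n :=
  if IsUnion E S then fun x y => k₁ x y ∨ k₂ x y else
    joinMatching (bigPart E S) (smallPart E S)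
      (trunc (cnt (bigPart E S) - cnt (smallPart E S)) (if LeftBig E S then k₁ else k₂)) n

/-- A maximum matching of the subgraph induced by `S`. -/
noncomputable def maxMatching (E : Rel n) (S : VSet n) : Rel n :=
  tree (leftPart E) (rightPart E) (fun _ _ => False) (maxComb E) n S

/-- The image of a matching under a transposition. -/
def conj (R : Rel n) (x y : Fin n) : Rel n := fun u v => R (Equiv.swap x y u) (Equiv.swap x y v)

def applyList (l : List (Fin n × Fin n)) (R : Rel n) : Rel n :=
  l.foldl (fun R s => conj R s.1 s.2) R

/-- The vertices of `S` covered by edges of `R` inside `S`. -/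
def cov (S : VSet n) (R : Rel n) : VSet n := fun x => S x ∧ ∃ y, S y ∧ R x y

/-- The edges of `R` inside `S` are edges of `E`. -/
def ValidOn (E : Rel n) (S : VSet n) (R : Rel n) : Prop := ∀ x y, S x → S y → R x y → E x y

/-- Swapping `x` and `y` is a legal move inside `S`. -/
def Legal (E : Rel n) (S : VSet n) (R : Rel n) (x y : Fin n) : Prop :=
  S x ∧ S y ∧ ValidOn E S (conj R x y)

/-- In at most `i` legal moves, the potential can be brought below `c`. -/
def Improvable (E : Rel n) (S : VSet n) (Φ : Rel n → ℕ) (c : ℕ) : ℕ → Rel n → Prop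
  | 0, R => Φ R < c
  | i + 1, R => Φ R < c ∨ ∃ x y, Legal E S R x y ∧ Improvable E S Φ c i (conj R x y)

open Classical in
/-- At most `i` legal moves that bring the potential below `c`. -/
noncomputable def improvement (E : Rel n) (S : VSet n) (Φ : Rel n → ℕ) (c : ℕ) :
    ℕ → Rel n → List (Fin n × Fin n)
  | 0, _ => []
  | i + 1, R => if Φ R < c then [] else
      pickVal (fun x => ∃ y, Legal E S R x y ∧ Improvable E S Φ c i (conj R x y))
        (fun x => pickVal (fun y => Legal E S R x y ∧ Improvable E S Φ c i (conj R x y))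
          (fun y => (x, y) :: improvement E S Φ c i (conj R x y)) []) []

open Classical in
/-- Local search with `k` rounds. -/
noncomputable def search (E : Rel n) (S : VSet n) (Φ : Rel n → ℕ) (R : Rel n) (k : ℕ) :
    List (Fin n × Fin n) :=
  (fun l => if Φ (applyList l R) = 0 then l else
    l ++ improvement E S Φ (Φ (applyList l R)) 4 (applyList l R))^[k] []

/-- The number of vertices matched inside `A` or inside `B`. -/
noncomputable def sideCount (A B : VSet n) (R : Rel n) : ℕ := cnt fun x => cov A R x ∨ cov B R x

/-- The number of vertices of `B` not matched to a vertex of `A`. -/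
noncomputable def slack (A B : VSet n) (R : Rel n) : ℕ := cnt fun y => B y ∧ ¬ ∃ x, A x ∧ R y x

/-- Counts the ends of the edges inside `A` that do not belong to the target `K`. -/
noncomputable def badCount (A : VSet n) (K R : Rel n) : ℕ :=
  cnt fun x => A x ∧ ∃ y, A y ∧ R x y ∧ ¬ K x y

open Classical in
-- Two nested targets are used, `K'` of the final size and `K` with one edge more: the spare edge
-- guarantees that some end of `K` is still uncovered inside `A`. The penalty `2n + 1` exceeds every
-- regular value, so the search never leaves the matchings that send all of `B` into `A`.
noncomputable def jumpPotential (A B : VSet n) (K K' R : Rel n) : ℕ :=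
  if slack A B R = 0 then badCount A K R + badCount A K' R else n + n + 1

def SameOn (A : VSet n) (R R' : Rel n) : Prop := ∀ x y, A x → A y → (R x y ↔ R' x y)

/-- The edges between `B` and `A` that are aimed at. -/
noncomputable def crossTarget (A B : VSet n) (R : Rel n) : Rel n :=
  zipRel B (fun x => A x ∧ ¬ cov A R x) (cnt fun b => B b ∧ ∃ x, A x ∧ R b x)

open Classical in
-- Regular values are at most `n`; the penalty `n + 1` forbids changing the edges inside either
-- side.
noncomputable def crossPotential (A B : VSet n) (R₀ R : Rel n) : ℕ :=
  if SameOn A R R₀ ∧ SameOn B R R₀ then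
    cnt fun b => B b ∧ ∃ x, A x ∧ R b x ∧ ¬ crossTarget A B R₀ b x else n + 1

/-- The number of vertices of `S` not covered inside `S`. -/
noncomputable def freeCount (S : VSet n) (R : Rel n) : ℕ := cnt S - cnt (cov S R)

/-- The condition under which no edge inside the larger side `A` is forced. -/
def BalancedCase (A B S : VSet n) (R : Rel n) : Prop := cnt A ≤ cnt B + freeCount S R

/-- The first condition says that `A` has room for an inner edge beyond the forced ones; the second
provides what a jump needs, an edge inside `B` or an uncovered vertex. -/
def JumpCase (E : Rel n) (A B S : VSet n) (R : Rel n) : Prop :=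
  cnt A - cnt B - freeCount S R < cnt (cov A (maxMatching E A)) ∧
    ((∃ y z, B y ∧ B z ∧ E y z) ∨ 0 < freeCount S R)

/-- Run one more search after the moves `l`. -/
noncomputable def andThen (E : Rel n) (S : VSet n) (Φ : Rel n → Rel n → ℕ) (k : ℕ) (R : Rel n)
    (l : List (Fin n × Fin n)) : List (Fin n × Fin n) :=
  l ++ search E S (Φ (applyList l R)) (applyList l R) k

open Classical in
-- Brings the edges inside `A` into normal form and removes those inside `B`. Only the last case
-- uses the recursive moves `l`.
noncomputable def joinMoves (E R : Rel n) (A B S : VSet n) (l : List (Fin n × Fin n)) :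
    List (Fin n × Fin n) :=
  if BalancedCase A B S R then search E S (sideCount A B) R (cnt S)
  else if JumpCase E A B S R then
    andThen E S (fun _ => jumpPotential A B
      (trunc (cnt A - cnt B - freeCount S R + 2) (maxMatching E A))
      (trunc (cnt A - cnt B - freeCount S R) (maxMatching E A))) (cnt S + cnt S) R
      (search E S (slack A B) R (cnt S))
  else l

open Classical in
noncomputable def moveComb (E R : Rel n) (S : VSet n) (l₁ l₂ : List (Fin n × Fin n)) :
    List (Fin n × Fin n) :=
  if IsUnion E S then l₁ ++ l₂ else
    andThen E S (crossPotential (bigPart E S) (smallPart E S)) (cnt (smallPart E S)) R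
      (joinMoves E R (bigPart E S) (smallPart E S) S (if LeftBig E S then l₁ else l₂))

/-- Moves inside `S` that lead from `R` to a canonical matching. -/
noncomputable def canonMoves (E R : Rel n) (S : VSet n) : ℕ → List (Fin n × Fin n) :=
  fun j => tree (leftPart E) (rightPart E) [] (moveComb E R) j S

end Definitions

/-! ### Running time of the splitting and matching constructions -/

namespace PolyT

variable {α β γ δ σ : ℕ → Type} [∀ n, Enc (α n)] [∀ n, Enc (β n)] [∀ n, Enc (γ n)]
  [∀ n, Enc (δ n)] [∀ n, Enc (σ n)]

variable {E R R' K K' : ∀ n, α n → Rel n} {S s A B P Q : ∀ n, α n → VSet n} {x y : ∀ n, α n → Fin n}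
  {c d : ∀ n, α n → ℕ}

theorem cntF {p : ∀ n, α n → VSet n} (hp : PolyT p) : PolyT fun n a => cnt (p n a) :=
  count ((hp.comp id.fst).app id.snd)


theorem reach (hE : PolyT E) (hS : PolyT S) (hs : PolyT s) :
    PolyT fun n a => reach (E n a) (S n a) (s n a) := by
  refine dim.iterate_bdd (σ := VSet) (step := fun n a T x => T x ∨ S n a x ∧ ∃ y, T y ∧ E n a y x)
    hs (lam ?_)
  apply_rules [id, fst, snd, or, and, ex, hE.comp, hS.comp, app]

theorem first (hS : PolyT S) : PolyT fun n a => first (S n a) := by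
  refine lam (f := fun n a => MatchReconf.first (S n a)) ?_
  unfold MatchReconf.first
  apply_rules [id, fst, snd, and, imp, all, finLe, hS.comp, app]

theorem component (hE : PolyT E) (hS : PolyT S) : PolyT fun n a => component (E n a) (S n a) :=
  reach hE hS (first hS)

theorem isUnion (hE : PolyT E) (hS : PolyT S) : PolyT fun n a => IsUnion (E n a) (S n a) := by
  have h := component hE hS
  unfold IsUnion
  apply_rules [id, fst, snd, and, not, ex, hS.comp, h.comp, app]

theorem leftPart (hE : PolyT E) (hS : PolyT S) : PolyT fun n a => leftPart (E n a) (S n a) := by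
  have h := component hE hS
  have h₁ := isUnion hE hS
  have h₂ : PolyT fun n a x y => ¬ E n a x y := by
    refine lam (lam ?_)
    apply_rules [id, fst, snd, not, hE.comp, app]
  have h₃ := component h₂ hS
  refine lam (f := fun n a => MatchReconf.leftPart (E n a) (S n a)) ?_
  unfold MatchReconf.leftPart
  exact or (and (h₁.comp id.fst) ((h.comp id.fst).app id.snd))
    (and (not (h₁.comp id.fst)) ((h₃.comp id.fst).app id.snd))

theorem rightPart (hE : PolyT E) (hS : PolyT S) : PolyT fun n a => rightPart (E n a) (S n a) :=
  lam (and ((hS.comp id.fst).app id.snd) (not (((leftPart hE hS).comp id.fst).app id.snd)))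

theorem leftBig (hE : PolyT E) (hS : PolyT S) : PolyT fun n a => LeftBig (E n a) (S n a) :=
  (rightPart hE hS).cntF.le (leftPart hE hS).cntF

theorem bigPart (hE : PolyT E) (hS : PolyT S) : PolyT fun n a => bigPart (E n a) (S n a) :=
  iteD (leftBig hE hS) (leftPart hE hS) (rightPart hE hS)

theorem smallPart (hE : PolyT E) (hS : PolyT S) : PolyT fun n a => smallPart (E n a) (S n a) :=
  iteD (leftBig hE hS) (rightPart hE hS) (leftPart hE hS)

theorem rank (hP : PolyT P) (hx : PolyT x) : PolyT fun n a => rank (P n a) (x n a) :=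
  count (and ((hP.comp id.fst).app id.snd) (finLe id.snd (hx.comp id.fst)))

theorem zipRel (hP : PolyT P) (hQ : PolyT Q) (hc : PolyT c) :
    PolyT fun n a => zipRel (P n a) (Q n a) (c n a) := by
  refine lam (f := fun n a => MatchReconf.zipRel (P n a) (Q n a) (c n a)) (lam ?_)
  unfold MatchReconf.zipRel
  apply_rules [id, fst, snd, and, rank, natEq, le, hP.comp, hQ.comp, hc.comp, app]

theorem uncovered (hA : PolyT A) (hR : PolyT R) : PolyT fun n a => uncovered (A n a) (R n a) := by
  refine lam (f := fun n a => MatchReconf.uncovered (A n a) (R n a)) ?_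
  unfold MatchReconf.uncovered
  apply_rules [id, fst, snd, and, not, ex, hA.comp, hR.comp, app]

theorem lower (hR : PolyT R) : PolyT fun n a => lower (R n a) := by
  refine lam (f := fun n a => MatchReconf.lower (R n a)) ?_
  unfold MatchReconf.lower
  apply_rules [id, fst, snd, and, ex, finLt, hR.comp, app]

theorem trunc (hd : PolyT d) (hR : PolyT R) : PolyT fun n a => trunc (d n a) (R n a) := by
  refine lam (f := fun n a => MatchReconf.trunc (d n a) (R n a)) (lam ?_)
  unfold MatchReconf.trunc
  have h := lower hR
  have h₁ : PolyT fun n (x : α n × Fin n) => MatchReconf.rank (MatchReconf.lower (R n x.1)) x.2 +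
      MatchReconf.rank (MatchReconf.lower (R n x.1)) x.2 ≤ d n x.1 :=
    ((rank (h.comp id.fst) id.snd).add (rank (h.comp id.fst) id.snd)).le (hd.comp id.fst)
  exact and (((hR.comp id.fst.fst).app id.fst.snd).app id.snd)
    (or (and (finLt id.fst.snd id.snd) (h₁.comp₂ id.fst.fst id.fst.snd))
      (and (finLt id.snd id.fst.snd) (h₁.comp₂ id.fst.fst id.snd)))

theorem joinMatching (hA : PolyT A) (hB : PolyT B) (hR : PolyT R) (hc : PolyT c) :
    PolyT fun n a => joinMatching (A n a) (B n a) (R n a) (c n a) := by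
  refine lam (f := fun n a => MatchReconf.joinMatching (A n a) (B n a) (R n a) (c n a)) (lam ?_)
  unfold MatchReconf.joinMatching
  have h := zipRel hB (uncovered hA hR) hc
  apply_rules [id, fst, snd, or, hR.comp, h.comp, app]

theorem maxComb (hE : PolyT E) (hS : PolyT S) (hK : PolyT K) (hK' : PolyT K') :
    PolyT fun n a => maxComb (E n a) (S n a) (K n a) (K' n a) := by
  have hA := bigPart hE hS
  have hB := smallPart hE hS
  refine iteD (isUnion hE hS) (lam (lam ?_))
    (joinMatching hA hB (trunc (hA.cntF.sub hB.cntF) (iteD (leftBig hE hS) hK hK')) dim)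
  apply_rules [id, fst, snd, or, hK.comp, hK'.comp, app]

end PolyT

/-! ### Elementary properties of the parts and linear length of the move lists -/

section
variable {n : ℕ} {E : Rel n} {S : VSet n}

theorem reach_subset {s : VSet n} (hs : ∀ x, s x → S x) {x : Fin n} (h : reach E S s x) : S x := by
  have (k : ℕ) : ∀ x, (fun (T : VSet n) x => T x ∨ S x ∧ ∃ y, T y ∧ E y x)^[k] s x → S x := by
    induction k with
    | zero => exact hs
    | succ k ih =>
      intro x hx
      rw [Function.iterate_succ_apply'] at hx
      rcases hx with hx | hx
      exacts [ih x hx, hx.1]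
  exact this n x h

theorem component_subset {x : Fin n} (h : component E S x) : S x :=
  reach_subset (fun _ h => h.1) h

theorem leftPart_subset (E : Rel n) (S : VSet n) (x : Fin n) (h : leftPart E S x) : S x :=
  h.elim (fun h => component_subset h.2) fun h => component_subset h.2

theorem rightPart_subset (E : Rel n) (S : VSet n) (x : Fin n) (h : rightPart E S x) : S x := h.1

theorem left_right_disjoint (E : Rel n) (S : VSet n) (x : Fin n) (h : leftPart E S x) :
    ¬ rightPart E S x := fun h' => h'.2 h

theorem cnt_mono {p q : VSet n} (h : ∀ x, p x → q x) : cnt p ≤ cnt q :=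
  Finset.card_le_card fun x hx => by simp at hx ⊢; exact h x hx

theorem cnt_le (p : VSet n) : cnt p ≤ n := by
  classical
  simpa [cnt] using Finset.card_le_univ (Finset.univ.filter p)

theorem cnt_or {p q : VSet n} (h : ∀ x, p x → ¬ q x) : cnt (fun x => p x ∨ q x) = cnt p + cnt q := by
  classical
  unfold cnt
  rw [← Finset.card_union_of_disjoint (Finset.disjoint_filter.2 fun x _ hx => h x hx),
    ← Finset.filter_or]
  congr

theorem cnt_congr {p q : VSet n} (h : ∀ x, p x ↔ q x) : cnt p = cnt q :=
  congrArg cnt (funext fun x => propext (h x))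

theorem cnt_left_add_right (E : Rel n) (S : VSet n) :
    cnt (leftPart E S) + cnt (rightPart E S) = cnt S := by
  rw [← cnt_or (left_right_disjoint E S)]
  refine cnt_congr fun x => ⟨fun h => h.elim (leftPart_subset E S x) (rightPart_subset E S x),
    fun h => ?_⟩
  by_cases h' : leftPart E S x
  exacts [.inl h', .inr ⟨h, h'⟩]

theorem cnt_big_add_small (E : Rel n) (S : VSet n) :
    cnt (bigPart E S) + cnt (smallPart E S) = cnt S := by
  have := cnt_left_add_right E S
  unfold bigPart smallPart
  split_ifs <;> omega

theorem cnt_small_le_big (E : Rel n) (S : VSet n) : cnt (smallPart E S) ≤ cnt (bigPart E S) := by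
  unfold smallPart bigPart
  split_ifs with h <;> unfold LeftBig at h <;> omega

theorem length_improvement_le (Φ : Rel n → ℕ) (c i : ℕ) (R : Rel n) :
    (improvement E S Φ c i R).length ≤ i := by
  induction i generalizing R with
  | zero => simp [improvement]
  | succ i ih =>
    unfold improvement
    split_ifs
    · simp
    · rcases pickVal_cases (fun x => ∃ y, Legal E S R x y ∧ Improvable E S Φ c i (conj R x y))
        (fun x => pickVal (fun y => Legal E S R x y ∧ Improvable E S Φ c i (conj R x y))
          (fun y => (x, y) :: improvement E S Φ c i (conj R x y)) []) [] with ⟨x, _, h⟩ | ⟨_, h⟩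
      · rw [h]
        rcases pickVal_cases (fun y => Legal E S R x y ∧ Improvable E S Φ c i (conj R x y))
          (fun y => (x, y) :: improvement E S Φ c i (conj R x y)) [] with ⟨y, _, h⟩ | ⟨_, h⟩
        · rw [h, List.length_cons]
          exact Nat.succ_le_succ (ih _)
        · rw [h]; simp
      · rw [h]; simp

theorem length_search_le (Φ : Rel n → ℕ) (R : Rel n) (k : ℕ) :
    (search E S Φ R k).length ≤ 4 * k := by
  unfold search
  induction k with
  | zero => simp
  | succ k ih =>
    rw [Function.iterate_succ_apply']
    have := length_improvement_le (E := E) (S := S) Φ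
    split_ifs
    · omega
    · rw [List.length_append]
      refine (Nat.add_le_add ih (this _ _ _)).trans (by omega)

theorem length_andThen_le (Φ : Rel n → Rel n → ℕ) (k : ℕ) (R : Rel n)
    (l : List (Fin n × Fin n)) : (andThen E S Φ k R l).length ≤ l.length + 4 * k := by
  rw [andThen, List.length_append]
  exact Nat.add_le_add_left (length_search_le _ _ _) _

/-- The worst search case is the jump case: `|S|` rounds for the slack and `2|S|` for the jumps,
each of at most four moves, which makes `12 |S|`. -/
theorem length_joinMoves_le {R : Rel n} {A B : VSet n} {l : List (Fin n × Fin n)}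
    (hl : l.length ≤ 16 * cnt A) :
    (joinMoves E R A B S l).length ≤ max (12 * cnt S) (16 * cnt A) := by
  unfold joinMoves
  split_ifs
  · have := length_search_le (E := E) (S := S) (sideCount A B) R (cnt S)
    omega
  · refine (length_andThen_le _ _ _ _).trans ?_
    have := length_search_le (E := E) (S := S) (slack A B) R (cnt S)
    omega
  · omega

/-- A union adds up. A join spends at most `max (12|S|) (16|A|)`, followed by `4|B|` moves for the
cross edges; both sums are at most `16|S|`. It is essential that only one side is treated
recursively. -/
theorem length_moveComb_le {R : Rel n} {l₁ l₂ : List (Fin n × Fin n)}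
    (h₁ : l₁.length ≤ 16 * cnt (leftPart E S)) (h₂ : l₂.length ≤ 16 * cnt (rightPart E S)) :
    (moveComb E R S l₁ l₂).length ≤ 16 * cnt S := by
  have h₃ := cnt_left_add_right E S
  have h₄ := cnt_big_add_small E S
  unfold moveComb
  split_ifs with h₅ h₆
  · rw [List.length_append]; omega
  all_goals
    refine (length_andThen_le _ _ _ _).trans ?_
    refine (Nat.add_le_add_right (length_joinMoves_le ?_) _).trans (b := _) ?_
    · simpa [bigPart, h₆] using by assumption
    · have := cnt_small_le_big E S
      omega

theorem length_canonMoves_le (R : Rel n) (S : VSet n) (j : ℕ) :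
    (canonMoves E R S j).length ≤ 16 * cnt S := by
  unfold canonMoves
  induction j generalizing S with
  | zero => simp [tree]
  | succ j ih =>
    rw [tree]
    split_ifs
    · exact length_moveComb_le (ih _) (ih _)
    · simp

theorem sz_moves_le (l : List (Fin n × Fin n)) : sz l ≤ l.length * (4 * n + 4) + 1 :=
  sz_list_le l (4 * n + 3) fun a _ => by
    have h₁ := a.1.isLt
    have h₂ := a.2.isLt
    simp only [sz_prod, sz_fin]
    omega

end

/-! ### Running time of the local search and of the canonical moves -/

namespace PolyT

variable {α β γ δ σ : ℕ → Type} [∀ n, Enc (α n)] [∀ n, Enc (β n)] [∀ n, Enc (γ n)]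
  [∀ n, Enc (δ n)] [∀ n, Enc (σ n)]

variable {E R R' K K' : ∀ n, α n → Rel n} {S s A B P Q : ∀ n, α n → VSet n} {x y : ∀ n, α n → Fin n}
  {c d k : ∀ n, α n → ℕ} {Φ : ∀ n, α n → Rel n → ℕ} {l l' : ∀ n, α n → List (Fin n × Fin n)}

theorem maxMatching (hE : PolyT E) (hS : PolyT S) :
    PolyT fun n a => maxMatching (E n a) (S n a) := by
  obtain ⟨q, hq⟩ := Bdd.bdd (σ := Rel)
  exact tree (lf := fun n a => MatchReconf.leftPart (E n a))
    (rt := fun n a => MatchReconf.rightPart (E n a)) (comb := fun n a => MatchReconf.maxComb (E n a))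
    dim hS (leftPart (hE.comp id.fst) id.snd) (rightPart (hE.comp id.fst) id.snd) (lam (lam false))
    (maxComb (hE.comp id.fst.fst) id.fst.snd id.snd.fst id.snd.snd)
    (fun n a => leftPart_subset _) (fun n a => rightPart_subset _)
    (fun n a => left_right_disjoint _) ⟨q, fun n a j S => (hq n _).trans (eval_le q (by omega))⟩

theorem conj (hR : PolyT R) (hx : PolyT x) (hy : PolyT y) :
    PolyT fun n a => conj (R n a) (x n a) (y n a) := by
  have h : PolyT fun n (z : α n × Fin n) => Equiv.swap (x n z.1) (y n z.1) z.2 := by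
    simp only [Equiv.swap_apply_def]
    exact iteD (finEq id.snd (hx.comp id.fst)) (hy.comp id.fst)
      (iteD (finEq id.snd (hy.comp id.fst)) (hx.comp id.fst) id.snd)
  exact lam (lam (((hR.comp id.fst.fst).app (h.comp₂ id.fst.fst id.fst.snd)).app
    (h.comp₂ id.fst.fst id.snd)))

theorem applyList (hl : PolyT l) (hR : PolyT R) :
    PolyT fun n a => applyList (l n a) (R n a) :=
  hl.foldl_bdd (σ := Rel) (γ := fun n => Fin n × Fin n) (step := fun n a R s => MatchReconf.conj R s.1 s.2) hR
    (conj (α := fun n => (α n × Rel n) × Fin n × Fin n) (x := fun n a => a.2.1)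
      (y := fun n a => a.2.2) id.fst.snd id.snd.fst id.snd.snd)

theorem cov (hS : PolyT S) (hR : PolyT R) : PolyT fun n a => cov (S n a) (R n a) := by
  refine lam (f := fun n a => MatchReconf.cov (S n a) (R n a)) ?_
  unfold MatchReconf.cov
  apply_rules [id, fst, snd, and, ex, hS.comp, hR.comp, app]

theorem validOn (hE : PolyT E) (hS : PolyT S) (hR : PolyT R) :
    PolyT fun n a => ValidOn (E n a) (S n a) (R n a) := by
  unfold ValidOn
  apply_rules [id, fst, snd, imp, all, hE.comp, hS.comp, hR.comp, app]

theorem legal (hE : PolyT E) (hS : PolyT S) (hR : PolyT R) (hx : PolyT x) (hy : PolyT y) :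
    PolyT fun n a => Legal (E n a) (S n a) (R n a) (x n a) (y n a) :=
  and (hS.app hx) (and (hS.app hy) (validOn hE hS (conj hR hx hy)))

/-- The depth `i` is a constant outside the family, so `i` nested searches over all pairs of
vertices remain polynomial. -/
theorem improvable (hE : PolyT E) (hS : PolyT S)
    (hΦ : PolyT fun n (x : α n × Rel n) => Φ n x.1 x.2) (i : ℕ) :
    PolyT fun n (x : (α n × ℕ) × Rel n) =>
      Improvable (E n x.1.1) (S n x.1.1) (Φ n x.1.1) x.1.2 i x.2 := by
  have h₀ : PolyT fun n (x : (α n × ℕ) × Rel n) => Φ n x.1.1 x.2 < x.1.2 :=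
    (hΦ.comp₂ id.fst.fst id.snd).lt id.fst.snd
  induction i with
  | zero => exact h₀
  | succ i ih =>
    exact h₀.or (ex (ex (and (legal (hE.comp id.fst.fst.fst.fst) (hS.comp id.fst.fst.fst.fst)
      id.fst.fst.snd id.fst.snd id.snd) (ih.comp (id.fst.fst.fst.pair
        (conj id.fst.fst.snd id.fst.snd id.snd))))))

theorem improvement (hE : PolyT E) (hS : PolyT S)
    (hΦ : PolyT fun n (x : α n × Rel n) => Φ n x.1 x.2) (i : ℕ) :
    PolyT fun n (x : (α n × ℕ) × Rel n) =>
      improvement (E n x.1.1) (S n x.1.1) (Φ n x.1.1) x.1.2 i x.2 := by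
  have h₀ : PolyT fun n (x : (α n × ℕ) × Rel n) => Φ n x.1.1 x.2 < x.1.2 :=
    (hΦ.comp₂ id.fst.fst id.snd).lt id.fst.snd
  induction i with
  | zero => exact nil
  | succ i ih =>
    have h₁ : PolyT fun n (x : (((α n × ℕ) × Rel n) × Fin n) × Fin n) =>
        Legal (E n x.1.1.1.1) (S n x.1.1.1.1) x.1.1.2 x.1.2 x.2 ∧
        Improvable (E n x.1.1.1.1) (S n x.1.1.1.1) (Φ n x.1.1.1.1) x.1.1.1.2 i
          (MatchReconf.conj x.1.1.2 x.1.2 x.2) :=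
      and (legal (hE.comp id.fst.fst.fst.fst) (hS.comp id.fst.fst.fst.fst)
        id.fst.fst.snd id.fst.snd id.snd) ((improvable hE hS hΦ i).comp (id.fst.fst.fst.pair
        (conj id.fst.fst.snd id.fst.snd id.snd)))
    have h₂ : PolyT fun n (x : (((α n × ℕ) × Rel n) × Fin n) × Fin n) =>
        (x.1.2, x.2) :: MatchReconf.improvement (E n x.1.1.1.1) (S n x.1.1.1.1) (Φ n x.1.1.1.1)
          x.1.1.1.2 i (MatchReconf.conj x.1.1.2 x.1.2 x.2) :=
      (id.fst.snd.pair id.snd).cons (ih.comp (id.fst.fst.fst.pair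
        (conj id.fst.fst.snd id.fst.snd id.snd)))
    exact iteD h₀ nil (pickF (lam (ex h₁)) (lam (pickF (lam h₁) (lam h₂) nil)) nil)

theorem search (hE : PolyT E) (hS : PolyT S)
    (hΦ : PolyT fun n (x : α n × Rel n) => Φ n x.1 x.2) (hR : PolyT R) (hk : PolyT k) :
    PolyT fun n a => search (E n a) (S n a) (Φ n a) (R n a) (k n a) := by
  obtain ⟨r, hr⟩ := hk.size_le
  have h₁ : PolyT fun n (x : α n × List (Fin n × Fin n)) =>
      MatchReconf.applyList x.2 (R n x.1) := applyList id.snd (hR.comp id.fst)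
  have h₂ : PolyT fun n (x : α n × List (Fin n × Fin n)) =>
      Φ n x.1 (MatchReconf.applyList x.2 (R n x.1)) := hΦ.comp₂ id.fst h₁
  refine hk.iterate (σ := fun n => List (Fin n × Fin n)) (init := fun n a => [])
    (step := fun n a l => if Φ n a (MatchReconf.applyList l (R n a)) = 0 then l else
    l ++ MatchReconf.improvement (E n a) (S n a) (Φ n a)
      (Φ n a (MatchReconf.applyList l (R n a))) 4 (MatchReconf.applyList l (R n a))) nil
    (iteD h₂.eq_zero id.snd (id.snd.append ((improvement hE hS hΦ 4).comp₂ (id.fst.pair h₂) h₁)))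
    ⟨4 * r * (4 * Polynomial.X + 4) + 1, fun n a j hj => ?_⟩
  refine (sz_moves_le _).trans ?_
  have h₃ := length_search_le (E := E n a) (S := S n a) (Φ n a) (R n a) j
  have h₄ := hr n a
  rw [sz_nat] at h₄
  simp only [Polynomial.eval_add, Polynomial.eval_mul, Polynomial.eval_X,
    Polynomial.eval_ofNat, Polynomial.eval_one]
  refine Nat.succ_le_succ (Nat.mul_le_mul (h₃.trans (by omega)) (by omega))

theorem sideCount (hA : PolyT A) (hB : PolyT B) (hR : PolyT R) :
    PolyT fun n a => sideCount (A n a) (B n a) (R n a) :=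
  count (or (((cov hA hR).comp id.fst).app id.snd) (((cov hB hR).comp id.fst).app id.snd))

theorem slack (hA : PolyT A) (hB : PolyT B) (hR : PolyT R) :
    PolyT fun n a => slack (A n a) (B n a) (R n a) := by
  refine count ?_
  apply_rules [id, fst, snd, and, not, ex, hA.comp, hB.comp, hR.comp, app]

theorem badCount (hA : PolyT A) (hK : PolyT K) (hR : PolyT R) :
    PolyT fun n a => badCount (A n a) (K n a) (R n a) := by
  refine count ?_
  apply_rules [id, fst, snd, and, not, ex, hA.comp, hK.comp, hR.comp, app]

theorem jumpPotential (hA : PolyT A) (hB : PolyT B) (hK : PolyT K) (hK' : PolyT K') (hR : PolyT R) :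
    PolyT fun n a => jumpPotential (A n a) (B n a) (K n a) (K' n a) (R n a) :=
  iteD (slack hA hB hR).eq_zero ((badCount hA hK hR).add (badCount hA hK' hR)) (dim.add dim).succ

theorem sameOn (hA : PolyT A) (hR : PolyT R) (hR' : PolyT R') :
    PolyT fun n a => SameOn (A n a) (R n a) (R' n a) := by
  unfold SameOn
  apply_rules [id, fst, snd, imp, iff, all, hA.comp, hR.comp, hR'.comp, app]

theorem crossTarget (hA : PolyT A) (hB : PolyT B) (hR : PolyT R) :
    PolyT fun n a => crossTarget (A n a) (B n a) (R n a) := by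
  have h := cov hA hR
  refine zipRel hB (lam (and ((hA.comp id.fst).app id.snd) (not ((h.comp id.fst).app id.snd))))
    (count ?_)
  apply_rules [id, fst, snd, and, ex, hA.comp, hB.comp, hR.comp, app]

theorem crossPotential (hA : PolyT A) (hB : PolyT B) (hR : PolyT R) (hR' : PolyT R') :
    PolyT fun n a => crossPotential (A n a) (B n a) (R n a) (R' n a) := by
  have h := crossTarget hA hB hR
  refine iteD ((sameOn hA hR' hR).and (sameOn hB hR' hR)) (count ?_) dim.succ
  exact and ((hB.comp id.fst).app id.snd) (ex (and ((hA.comp id.fst.fst).app id.snd)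
    (and (((hR'.comp id.fst.fst).app id.fst.snd).app id.snd)
      (not (((h.comp id.fst.fst).app id.fst.snd).app id.snd)))))

theorem freeCount (hS : PolyT S) (hR : PolyT R) : PolyT fun n a => freeCount (S n a) (R n a) :=
  hS.cntF.sub (cov hS hR).cntF

theorem balancedCase (hA : PolyT A) (hB : PolyT B) (hS : PolyT S) (hR : PolyT R) :
    PolyT fun n a => BalancedCase (A n a) (B n a) (S n a) (R n a) :=
  hA.cntF.le (hB.cntF.add (freeCount hS hR))

theorem jumpCase (hE : PolyT E) (hA : PolyT A) (hB : PolyT B) (hS : PolyT S) (hR : PolyT R) :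
    PolyT fun n a => JumpCase (E n a) (A n a) (B n a) (S n a) (R n a) := by
  refine and (lt ((hA.cntF.sub hB.cntF).sub (freeCount hS hR)) (cov hA (maxMatching hE hA)).cntF)
    (or (ex (ex ?_)) (lt (natConst 0) (freeCount hS hR)))
  apply_rules [id, fst, snd, and, hE.comp, hB.comp, app]

theorem andThen {Φ : ∀ n, α n → Rel n → Rel n → ℕ} (hE : PolyT E) (hS : PolyT S)
    (hΦ : PolyT fun n (x : (α n × Rel n) × Rel n) => Φ n x.1.1 x.1.2 x.2) (hk : PolyT k)
    (hR : PolyT R) (hl : PolyT l) :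
    PolyT fun n a => andThen (E n a) (S n a) (Φ n a) (k n a) (R n a) (l n a) :=
  hl.append (search hE hS (Φ := fun n a => Φ n a (MatchReconf.applyList (l n a) (R n a)))
    (hΦ.comp₂ (id.fst.pair ((applyList hl hR).comp id.fst)) id.snd) (applyList hl hR) hk)

theorem joinMoves (hE : PolyT E) (hR : PolyT R) (hA : PolyT A) (hB : PolyT B) (hS : PolyT S)
    (hl : PolyT l) :
    PolyT fun n a => joinMoves (E n a) (R n a) (A n a) (B n a) (S n a) (l n a) := by
  have hM := maxMatching hE hA
  have hd := (hA.cntF.sub hB.cntF).sub (freeCount hS hR)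
  refine iteD (balancedCase hA hB hS hR)
    (search hE hS (sideCount (hA.comp id.fst) (hB.comp id.fst) id.snd) hR hS.cntF)
    (iteD (jumpCase hE hA hB hS hR) (andThen (Φ := fun n a _ => _) hE hS
      (jumpPotential (hA.comp id.fst.fst)
      (hB.comp id.fst.fst) ((trunc hd.succ.succ hM).comp id.fst.fst) ((trunc hd hM).comp id.fst.fst)
      id.snd) (hS.cntF.add hS.cntF) hR
      (search hE hS (slack (hA.comp id.fst) (hB.comp id.fst) id.snd) hR hS.cntF)) hl)

theorem moveComb (hE : PolyT E) (hR : PolyT R) (hS : PolyT S) (hl : PolyT l) (hl' : PolyT l') :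
    PolyT fun n a => moveComb (E n a) (R n a) (S n a) (l n a) (l' n a) := by
  have hA := bigPart hE hS
  have hB := smallPart hE hS
  exact iteD (isUnion hE hS) (hl.append hl') (andThen hE hS
    (crossPotential (hA.comp id.fst.fst) (hB.comp id.fst.fst) id.fst.snd id.snd)
    hB.cntF hR (joinMoves hE hR hA hB hS (iteD (leftBig hE hS) hl hl')))

theorem canonMoves (hE : PolyT E) (hR : PolyT R) (hS : PolyT S) (hk : PolyT k) :
    PolyT fun n a => canonMoves (E n a) (R n a) (S n a) (k n a) :=
  tree (lf := fun n a => MatchReconf.leftPart (E n a))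
    (rt := fun n a => MatchReconf.rightPart (E n a))
    (comb := fun n a => MatchReconf.moveComb (E n a) (R n a))
    hk hS (leftPart (hE.comp id.fst) id.snd) (rightPart (hE.comp id.fst) id.snd) nil
    (moveComb (hE.comp id.fst.fst) (hR.comp id.fst.fst) id.fst.snd id.snd.fst id.snd.snd)
    (fun n a => leftPart_subset _) (fun n a => rightPart_subset _)
    (fun n a => left_right_disjoint _) ⟨16 * Polynomial.X * (4 * Polynomial.X + 4) + 1,
      fun n a j S => by
        refine (sz_moves_le _).trans ?_
        have h₁ := length_canonMoves_le (E := E n a) (R n a) S j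
        have h₂ := cnt_le S
        simp only [Polynomial.eval_add, Polynomial.eval_mul, Polynomial.eval_X,
          Polynomial.eval_ofNat, Polynomial.eval_one]
        exact Nat.succ_le_succ (Nat.mul_le_mul (h₁.trans (by omega)) (by omega))⟩

end PolyT
end MatchReconf

namespace MatchReconf

variable {n : ℕ} {E R R' : Rel n} {S A B P Q : VSet n}

/-! ### Matchings as relations -/

/-- A matching, as a symmetric relation. -/
structure IsM (R : Rel n) : Prop where
  symm : ∀ {x y}, R x y → R y x
  func : ∀ {x y z}, R x y → R x z → y = z
  irrefl : ∀ {x}, ¬ R x x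

theorem conj_apply (R : Rel n) (x y u v : Fin n) :
    conj R x y u v ↔ R (if u = x then y else if u = y then x else u)
      (if v = x then y else if v = y then x else v) := by
  unfold conj
  rw [Equiv.swap_apply_def, Equiv.swap_apply_def]

theorem IsM.conj (h : IsM R) (x y : Fin n) : IsM (conj R x y) where
  symm h₁ := h.symm h₁
  func h₁ h₂ := (Equiv.swap x y).injective (h.func h₁ h₂)
  irrefl h₁ := h.irrefl h₁

theorem cnt_eq_zero_iff {p : VSet n} : cnt p = 0 ↔ ∀ x, ¬ p x := by
  classical
  simp [cnt, Finset.filter_eq_empty_iff]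

theorem cnt_pos_iff {p : VSet n} : 0 < cnt p ↔ ∃ x, p x := by
  rw [Nat.pos_iff_ne_zero, Ne, cnt_eq_zero_iff]
  simp

theorem cnt_lt {p q : VSet n} (h : ∀ x, p x → q x) {x : Fin n} (hq : q x) (hp : ¬ p x) :
    cnt p < cnt q := by
  classical
  refine Finset.card_lt_card ⟨fun y hy => ?_, fun h' => ?_⟩
  · simp at hy ⊢; exact h y hy
  · have : x ∈ Finset.univ.filter p := h' (by simpa using hq)
    exact hp (by simpa using this)

theorem cnt_le_of_rel {p q : VSet n} (T : Rel n) (h : ∀ x, p x → ∃ y, q y ∧ T x y)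
    (hT : ∀ x x' y, p x → p x' → q y → T x y → T x' y → x = x') : cnt p ≤ cnt q := by
  classical
  choose! f hf using h
  refine Finset.card_le_card_of_injOn f (fun x hx => ?_) fun x hx x' hx' he => ?_
  · simp at hx ⊢; exact (hf x hx).1
  · simp at hx hx'
    exact hT x x' (f x) hx hx' (hf x hx).1 (hf x hx).2 (he ▸ (hf x' hx').2)

theorem eq_of_cnt_le {p q : VSet n} (h : ∀ x, p x → q x) (hc : cnt q ≤ cnt p) (x : Fin n)
    (hx : q x) : p x := by
  by_contra hp
  exact absurd (cnt_lt h hx hp) (by omega)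

theorem cnt_eq_add {p q r : VSet n} (h : ∀ x, r x ↔ p x ∨ q x) (hd : ∀ x, p x → ¬ q x) :
    cnt r = cnt p + cnt q := by
  rw [← cnt_or hd]
  exact cnt_congr h

theorem cnt_equiv (p : VSet n) (e : Equiv.Perm (Fin n)) : cnt (fun x => p (e x)) = cnt p := by
  apply le_antisymm
  · exact cnt_le_of_rel (fun x y => y = e x) (fun x hx => ⟨e x, hx, rfl⟩)
      fun x x' y _ _ _ h h' => e.injective (h ▸ h')
  · exact cnt_le_of_rel (fun x y => x = e y) (fun x hx => ⟨e.symm x, by simpa using hx, by simp⟩)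
      fun x x' y _ _ _ h h' => h.trans h'.symm

theorem swap_mem {x y : Fin n} (hx : S x) (hy : S y) (u : Fin n) :
    S (Equiv.swap x y u) ↔ S u := by
  rw [Equiv.swap_apply_def]
  split_ifs with h h'
  · simp [h, hx, hy]
  · simp [h', hx, hy]
  · rfl

theorem cov_conj {x y : Fin n} (hx : S x) (hy : S y) (u : Fin n) :
    cov S (MatchReconf.conj R x y) u ↔ cov S R (Equiv.swap x y u) := by
  constructor
  · rintro ⟨hu, v, hv, h⟩
    exact ⟨(swap_mem hx hy u).2 hu, _, (swap_mem hx hy v).2 hv, h⟩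
  · rintro ⟨hu, v, hv, h⟩
    refine ⟨(swap_mem hx hy u).1 hu, Equiv.swap x y v, (swap_mem hx hy v).2 hv, ?_⟩
    simpa [MatchReconf.conj] using h

theorem cnt_cov_conj {x y : Fin n} (hx : S x) (hy : S y) :
    cnt (cov S (MatchReconf.conj R x y)) = cnt (cov S R) := by
  rw [← cnt_equiv (cov S R) (Equiv.swap x y)]
  exact cnt_congr (cov_conj hx hy)

/-! ### Sequences of moves -/

/-- All the moves of the list are legal, one after the other. -/
def LegalSeq (E : Rel n) (S : VSet n) : Rel n → List (Fin n × Fin n) → Prop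
  | _, [] => True
  | R, s :: l => Legal E S R s.1 s.2 ∧ LegalSeq E S (conj R s.1 s.2) l

def Reach (E : Rel n) (S : VSet n) : Rel n → Rel n → Prop :=
  Relation.ReflTransGen fun R R' => ∃ x y, Legal E S R x y ∧ R' = conj R x y

theorem applyList_append (l l' : List (Fin n × Fin n)) (R : Rel n) :
    applyList (l ++ l') R = applyList l' (applyList l R) :=
  List.foldl_append ..

theorem LegalSeq.append {l l' : List (Fin n × Fin n)} (h : LegalSeq E S R l)
    (h' : LegalSeq E S (applyList l R) l') : LegalSeq E S R (l ++ l') := by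
  induction l generalizing R with
  | nil => exact h'
  | cons s l ih => exact ⟨h.1, ih h.2 h'⟩

theorem LegalSeq.reach {l : List (Fin n × Fin n)} (h : LegalSeq E S R l) :
    Reach E S R (applyList l R) := by
  induction l generalizing R with
  | nil => exact .refl
  | cons s l ih => exact .head ⟨_, _, h.1, rfl⟩ (ih h.2)

theorem Reach.isM (h : Reach E S R R') (hR : IsM R) : IsM R' := by
  induction h with
  | refl => exact hR
  | tail _ h ih =>
    obtain ⟨x, y, _, rfl⟩ := h
    exact ih.conj x y

theorem Reach.validOn (h : Reach E S R R') (hR : ValidOn E S R) : ValidOn E S R' := by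
  induction h with
  | refl => exact hR
  | tail _ h ih =>
    obtain ⟨x, y, h, rfl⟩ := h
    exact h.2.2

theorem Reach.cnt_cov (h : Reach E S R R') : cnt (cov S R') = cnt (cov S R) := by
  induction h with
  | refl => rfl
  | tail _ h ih =>
    obtain ⟨x, y, h, rfl⟩ := h
    rw [cnt_cov_conj h.1 h.2.1, ih]

/-- The main invariant: transpositions inside `S` preserve the number of covered vertices, so the
case distinction for a join is the same for all reachable matchings. -/
theorem Reach.freeCount_eq (h : Reach E S R R') : freeCount S R' = freeCount S R := by
  rw [freeCount, freeCount, h.cnt_cov]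

/-- At most four legal moves lower the potential. -/
def Lowerable (E : Rel n) (S : VSet n) (Φ : Rel n → ℕ) (R : Rel n) : Prop :=
  ∃ l, l.length ≤ 4 ∧ LegalSeq E S R l ∧ Φ (applyList l R) < Φ R

theorem improvable_of_legalSeq {Φ : Rel n → ℕ} {c i : ℕ} {l : List (Fin n × Fin n)}
    (hl : l.length ≤ i) (h : LegalSeq E S R l) (hΦ : Φ (applyList l R) < c) :
    Improvable E S Φ c i R := by
  induction i generalizing R l with
  | zero =>
    obtain rfl := List.length_eq_zero_iff.1 (Nat.le_zero.1 hl)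
    exact hΦ
  | succ i ih =>
    cases l with
    | nil => exact .inl hΦ
    | cons s l => exact .inr ⟨s.1, s.2, h.1, ih (by simpa using hl) h.2 hΦ⟩

theorem improvement_spec {Φ : Rel n → ℕ} {c i : ℕ} (h : Improvable E S Φ c i R) :
    LegalSeq E S R (improvement E S Φ c i R) ∧
      Φ (applyList (improvement E S Φ c i R) R) < c := by
  induction i generalizing R with
  | zero => exact ⟨trivial, h⟩
  | succ i ih =>
    unfold improvement
    split_ifs with h₀
    · exact ⟨trivial, h₀⟩
    have h := h.resolve_left h₀
    rcases pickVal_cases (fun x => ∃ y, Legal E S R x y ∧ Improvable E S Φ c i (conj R x y))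
        (fun x => pickVal (fun y => Legal E S R x y ∧ Improvable E S Φ c i (conj R x y))
          (fun y => (x, y) :: improvement E S Φ c i (conj R x y)) []) [] with ⟨x, hx, e⟩ | ⟨e, _⟩
    · rw [e]
      rcases pickVal_cases (fun y => Legal E S R x y ∧ Improvable E S Φ c i (conj R x y))
        (fun y => (x, y) :: improvement E S Φ c i (conj R x y)) [] with ⟨y, hy, e'⟩ | ⟨e', _⟩
      · rw [e']
        have := ih hy.2
        exact ⟨⟨hy.1, this.1⟩, this.2⟩
      · obtain ⟨y, hy⟩ := hx
        exact absurd hy (e' y)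
    · obtain ⟨x, hx⟩ := h
      exact absurd hx (e x)

/-- Every round lowers a nonzero potential by at least one, so `Φ R` rounds reach zero. Lowering is
required only for reachable matchings whose potential does not exceed the initial one; this is how
penalty values exclude unwanted matchings. -/
theorem search_spec {Φ : Rel n → ℕ} {k : ℕ}
    (h : ∀ R', Reach E S R R' → Φ R' ≤ Φ R → Φ R' ≠ 0 → Lowerable E S Φ R') (hk : Φ R ≤ k) :
    LegalSeq E S R (search E S Φ R k) ∧ Φ (applyList (search E S Φ R k) R) = 0 := by
  suffices H : ∀ j, LegalSeq E S R (search E S Φ R j) ∧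
      Φ (applyList (search E S Φ R j) R) ≤ Φ R - j by
    have := H k
    exact ⟨this.1, by omega⟩
  intro j
  induction j with
  | zero => exact ⟨trivial, le_rfl⟩
  | succ j ih =>
    unfold search at ih ⊢
    rw [Function.iterate_succ_apply']
    split_ifs with h₀
    · exact ⟨ih.1, by omega⟩
    · obtain ⟨l, hl, hl', hΦ⟩ := h _ ih.1.reach (by omega) h₀
      have h₁ := improvement_spec (improvable_of_legalSeq hl hl' hΦ)
      refine ⟨ih.1.append h₁.1, ?_⟩
      rw [applyList_append]
      have := h₁.2
      have := ih.2
      omega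

/-! ### Matchings in a join -/

/-- `S` is the disjoint union of `A` and `B`, and all edges between `A` and `B` are present. -/
structure IsJoin (E : Rel n) (S A B : VSet n) : Prop where
  symm : ∀ {x y}, E x y → E y x
  mem_iff : ∀ x, S x ↔ A x ∨ B x
  disj : ∀ {x}, A x → ¬ B x
  adj : ∀ {x y}, A x → B y → E x y

theorem IsJoin.swap (h : IsJoin E S A B) : IsJoin E S B A where
  symm := h.symm
  mem_iff x := by rw [h.mem_iff, or_comm]
  disj h₁ h₂ := h.disj h₂ h₁
  adj h₁ h₂ := h.symm (h.adj h₂ h₁)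

/-- Replace the edge `x x'` inside `A` by the edge `x y`, where `y` is a vertex of `B` not matched
to `A`. -/
theorem cross_move (hJ : IsJoin E S A B) (hR : IsM R) (hv : ValidOn E S R) {x x' y : Fin n}
    (hx : A x) (hx' : A x') (h : R x x') (hy : B y) (hy' : ∀ a, A a → ¬ R y a) :
    Legal E S R x' y ∧ (∀ z, cov A (conj R x' y) z → cov A R z ∧ z ≠ x) ∧
      (∀ z, cov B (conj R x' y) z → cov B R z) ∧
      (∀ a b, A a → B b → R b a → ∃ a', A a' ∧ conj R x' y b a') ∧
      ∃ a', A a' ∧ conj R x' y y a' := by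
  have h₁ := @hJ.disj
  have h₂ := @hJ.symm
  have h₃ := hJ.mem_iff
  have h₄ := @hJ.adj
  have h₅ := @hR.symm
  have h₆ := @hR.func
  have h₇ := @hR.irrefl
  refine ⟨⟨(h₃ _).2 (.inl hx'), (h₃ _).2 (.inr hy), ?_⟩, ?_, ?_, ?_, ?_⟩
  · intro u v hu hv'
    rw [conj_apply]
    unfold ValidOn at hv
    grind
  · rintro z ⟨hz, w, hw, hzw⟩
    rw [conj_apply] at hzw
    unfold cov
    grind
  · rintro z ⟨hz, w, hw, hzw⟩
    rw [conj_apply] at hzw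
    unfold cov
    grind
  · intro a b ha hb hab
    refine ⟨if a = x' then y else a, ?_, ?_⟩
    · grind
    · rw [conj_apply]
      grind
  · refine ⟨x, hx, ?_⟩
    rw [conj_apply]
    grind

/-- Double counting: `A` consists of its inner covered vertices, the ends of cross edges and its
free vertices, while `B` consists of the ends of cross edges and its slack. The witness `t` is the
slack plus the free vertices of `B`, which are themselves part of the slack. -/
theorem cov_cross_count (hJ : IsJoin E S A B) (hR : IsM R) :
    ∃ t, slack A B R ≤ t ∧ t ≤ 2 * slack A B R ∧
      cnt A + t = cnt B + cnt (cov A R) + freeCount S R := by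
  have hd := @hJ.disj
  have hs := @hR.symm
  have hf := @hR.func
  have hS := hJ.mem_iff
  have e₁ : cnt A = cnt (cov A R) + cnt fun x => A x ∧ ¬ cov A R x :=
    cnt_eq_add (fun x => by unfold cov; tauto) (by tauto)
  have e₂ : (cnt fun x => A x ∧ ¬ cov A R x) = (cnt fun x => A x ∧ ∃ y, B y ∧ R x y) +
      cnt fun x => A x ∧ ¬ cov S R x := by
    refine cnt_eq_add (fun x => ?_) (fun x => ?_)
    · unfold cov; grind
    · unfold cov; grind
  have e₃ : cnt B = (cnt fun x => B x ∧ ∃ y, A y ∧ R x y) + slack A B R :=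
    cnt_eq_add (fun x => by grind) (by grind)
  have e₄ : slack A B R = cnt (cov B R) + cnt fun x => B x ∧ ¬ cov S R x := by
    refine cnt_eq_add (fun x => ?_) (fun x => ?_)
    · unfold cov; grind
    · unfold cov; grind
  have e₅ : cnt S = cnt (cov S R) +
      ((cnt fun x => A x ∧ ¬ cov S R x) + cnt fun x => B x ∧ ¬ cov S R x) := by
    rw [← cnt_or (by grind)]
    refine cnt_eq_add (fun x => ?_) (fun x => ?_)
    · unfold cov; grind
    · unfold cov; grind
  have e₆ : (cnt fun x => A x ∧ ∃ y, B y ∧ R x y) = cnt fun x => B x ∧ ∃ y, A y ∧ R x y := by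
    apply le_antisymm
    · exact cnt_le_of_rel R (fun x ⟨hx, y, hy, h⟩ => ⟨y, ⟨hy, x, hx, hs h⟩, h⟩)
        fun x x' y _ _ _ h h' => hf (hs h) (hs h')
    · exact cnt_le_of_rel R (fun x ⟨hx, y, hy, h⟩ => ⟨y, ⟨hy, x, hx, hs h⟩, h⟩)
        fun x x' y _ _ _ h h' => hf (hs h) (hs h')
  refine ⟨slack A B R + cnt fun x => B x ∧ ¬ cov S R x, by omega, by omega, ?_⟩
  unfold freeCount
  omega

theorem exists_slack {c : ℕ} (h : c < slack A B R) : ∃ y, B y ∧ ∀ a, A a → ¬ R y a := by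
  obtain ⟨y, hy, h'⟩ := cnt_pos_iff.1 (Nat.zero_lt_of_lt h)
  exact ⟨y, hy, fun a ha h => h' ⟨a, ha, h⟩⟩

theorem sideCount_comm (A B : VSet n) (R : Rel n) : sideCount A B R = sideCount B A R :=
  cnt_congr fun _ => or_comm

/-- If an edge lies inside `A`, the count and the balance force a vertex of `B` not matched to `A`;
`cross_move` then trades the inner edge for a cross edge. The two inequalities make the situation
symmetric in `A` and `B`. -/
theorem lowerable_sideCount (hJ : IsJoin E S A B) (hR : IsM R) (hv : ValidOn E S R)
    (h₁ : cnt A ≤ cnt B + freeCount S R) (h₂ : cnt B ≤ cnt A + freeCount S R)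
    (h : sideCount A B R ≠ 0) : Lowerable E S (sideCount A B) R := by
  obtain ⟨x, hx⟩ := cnt_pos_iff.1 (Nat.pos_of_ne_zero h)
  wlog hxA : cov A R x generalizing A B
  · have := this hJ.swap h₂ h₁ (by rwa [sideCount_comm]) hx.symm (hx.resolve_left hxA)
    rwa [show sideCount A B = sideCount B A from funext (sideCount_comm A B)]
  have hc := hxA
  obtain ⟨hx, x', hx', hxx'⟩ := hxA
  obtain ⟨t, _, ht, e⟩ := cov_cross_count hJ hR
  have : 0 < cnt (cov A R) := cnt_pos_iff.2 ⟨x, hc⟩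
  obtain ⟨y, hy, hy'⟩ := exists_slack (A := A) (B := B) (R := R) (c := 0) (by omega)
  obtain ⟨hl, h₃, h₄, _⟩ := cross_move hJ hR hv hx hx' hxx' hy hy'
  refine ⟨[(x', y)], by simp, ⟨hl, trivial⟩, ?_⟩
  refine cnt_lt (x := x) (fun z hz => ?_) (.inl hc) fun hz => ?_
  · exact hz.imp (fun hz => (h₃ z hz).1) (h₄ z)
  · exact hz.elim (fun hz => (h₃ x hz).2 rfl) fun hz => hJ.disj hx (h₄ x hz).1

/-- When `A` is too large, the count guarantees an edge inside `A`, and `cross_move` uses it to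
serve a vertex of `B` that is not matched to `A`. -/
theorem lowerable_slack (hJ : IsJoin E S A B) (hR : IsM R) (hv : ValidOn E S R)
    (h₁ : cnt B + freeCount S R < cnt A) (h : slack A B R ≠ 0) :
    Lowerable E S (slack A B) R := by
  obtain ⟨t, _, ht, e⟩ := cov_cross_count hJ hR
  obtain ⟨x, hx, x', hx', hxx'⟩ := cnt_pos_iff.1 (show 0 < cnt (cov A R) by omega)
  obtain ⟨y, hy, hy'⟩ := exists_slack (A := A) (B := B) (R := R) (c := 0) (by omega)
  obtain ⟨hl, _, _, h₃, h₄⟩ := cross_move hJ hR hv hx hx' hxx' hy hy'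
  refine ⟨[(x', y)], by simp, ⟨hl, trivial⟩, ?_⟩
  refine cnt_lt (x := y) (fun z hz => ⟨hz.1, fun ⟨a, ha, haz⟩ => hz.2 (h₃ a z ha hz.1 haz)⟩)
    ⟨hy, fun ⟨a, ha, h⟩ => hy' a ha h⟩ fun hz => hz.2 h₄

end MatchReconf

namespace MatchReconf

variable {n : ℕ} {E R R' R₀ : Rel n} {S A B P Q : VSet n}

/-! ### Ranks -/

theorem rank_lt {x y : Fin n} (hy : P y) (h : x < y) : rank P x < rank P y :=
  cnt_lt (x := y) (fun _ hz => ⟨hz.1, hz.2.trans h.le⟩) ⟨hy, le_rfl⟩ fun hz => absurd hz.2 h.not_ge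

theorem rank_inj {x y : Fin n} (hx : P x) (hy : P y) (h : rank P x = rank P y) : x = y := by
  rcases lt_trichotomy x y with h' | h' | h'
  · exact absurd (rank_lt hy h') (by omega)
  · exact h'
  · exact absurd (rank_lt hx h') (by omega)

theorem one_le_rank {x : Fin n} (hx : P x) : 1 ≤ rank P x := cnt_pos_iff.2 ⟨x, hx, le_rfl⟩

theorem rank_le_cnt (P : VSet n) (x : Fin n) : rank P x ≤ cnt P := cnt_mono fun _ h => h.1

open Classical in
-- The rank numbers the elements of `P` bijectively from `1` to `|P|`; injectivity gives one
-- inclusion and cardinality the rest.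
theorem image_rank (P : VSet n) :
    (Finset.univ.filter P).image (rank P) = Finset.Icc 1 (cnt P) := by
  apply Finset.eq_of_subset_of_card_le
  · intro k hk
    obtain ⟨x, hx, rfl⟩ := Finset.mem_image.1 hk
    rw [Finset.mem_Icc]
    exact ⟨one_le_rank (by simpa using hx), rank_le_cnt P x⟩
  · rw [Finset.card_image_of_injOn, Nat.card_Icc]
    · exact le_of_eq (Nat.add_sub_cancel ..)
    · intro x hx y hy h
      simp at hx hy
      exact rank_inj hx hy h

theorem exists_rank_eq {k : ℕ} (h₁ : 1 ≤ k) (h₂ : k ≤ cnt P) : ∃ x, P x ∧ rank P x = k := by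
  classical
  have : k ∈ (Finset.univ.filter P).image (rank P) := by
    rw [image_rank, Finset.mem_Icc]
    exact ⟨h₁, h₂⟩
  simpa using this

theorem cnt_rank_le (P : VSet n) (k : ℕ) : cnt (fun x => P x ∧ rank P x ≤ k) = min k (cnt P) := by
  classical
  have h : (Finset.univ.filter fun x => P x ∧ rank P x ≤ k).image (rank P) =
      Finset.Icc 1 (min k (cnt P)) := by
    ext j
    simp only [Finset.mem_image, Finset.mem_filter, Finset.mem_univ, true_and, Finset.mem_Icc,
      le_min_iff]
    constructor
    · rintro ⟨x, ⟨hx, hk⟩, rfl⟩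
      exact ⟨one_le_rank hx, hk, rank_le_cnt P x⟩
    · rintro ⟨h₁, h₂, h₃⟩
      obtain ⟨x, hx, rfl⟩ := exists_rank_eq h₁ h₃
      exact ⟨x, ⟨hx, h₂⟩, rfl⟩
  have h' := congrArg Finset.card h
  rw [Finset.card_image_of_injOn, Nat.card_Icc] at h'
  · refine Eq.trans ?_ (h'.trans (Nat.add_sub_cancel ..))
    rw [cnt]
    congr
  · intro x hx y hy h
    simp at hx hy
    exact rank_inj hx.1 hy.1 h

theorem zipRel_inj_right {c : ℕ} {x y z : Fin n} (h : zipRel P Q c x y) (h' : zipRel P Q c x z) :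
    y = z :=
  rank_inj h.2.1 h'.2.1 (h.2.2.1.symm.trans h'.2.2.1)

theorem zipRel_inj_left {c : ℕ} {x y z : Fin n} (h : zipRel P Q c x z) (h' : zipRel P Q c y z) :
    x = y :=
  rank_inj h.1 h'.1 (h.2.2.1.trans h'.2.2.1.symm)

theorem exists_zipRel_left {c : ℕ} {x : Fin n} (hc : c ≤ cnt Q) (hx : P x) (h : rank P x ≤ c) :
    ∃ y, zipRel P Q c x y := by
  obtain ⟨y, hy, e⟩ := exists_rank_eq (one_le_rank hx) (h.trans hc)
  exact ⟨y, hx, hy, e.symm, h⟩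

theorem cnt_zipRel_left {c : ℕ} (hP : c ≤ cnt P) (hQ : c ≤ cnt Q) :
    cnt (fun x => ∃ y, zipRel P Q c x y) = c := by
  rw [cnt_congr (q := fun x => P x ∧ rank P x ≤ c), cnt_rank_le, min_eq_left hP]
  exact fun x => ⟨fun ⟨y, h⟩ => ⟨h.1, h.2.2.2⟩, fun h => exists_zipRel_left hQ h.1 h.2⟩

/-! ### Rearranging the edges between the two sides of a join -/

/-- Swapping two vertices of `A` that are not matched inside `A`. -/
theorem inner_swap (hJ : IsJoin E S A B) (hv : ValidOn E S R) {x y : Fin n} (hR : IsM R)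
    (hx : A x) (hy : A y) (hx' : ¬ cov A R x) (hy' : ¬ cov A R y) :
    Legal E S R x y ∧ SameOn A (conj R x y) R ∧ SameOn B (conj R x y) R := by
  have h₁ := @hJ.disj
  have h₂ := @hJ.symm
  have h₃ := hJ.mem_iff
  have h₄ := @hJ.adj
  have h₅ := @hR.symm
  unfold cov at hx' hy'
  have hA : SameOn A (conj R x y) R := by
    intro u v hu hv
    rw [conj_apply]
    grind
  have hB : SameOn B (conj R x y) R := by
    intro u v hu hv
    rw [conj_apply]
    grind
  refine ⟨⟨(h₃ _).2 (.inl hx), (h₃ _).2 (.inl hy), ?_⟩, hA, hB⟩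
  intro u v hu hw h
  unfold SameOn at hA hB
  unfold ValidOn at hv
  rw [h₃] at hu hw
  rcases hu with hu | hu <;> rcases hw with hw | hw
  · exact hv u v ((h₃ _).2 (.inl hu)) ((h₃ _).2 (.inl hw)) ((hA u v hu hw).1 h)
  · exact h₄ hu hw
  · exact h₂ (h₄ hw hu)
  · exact hv u v ((h₃ _).2 (.inr hu)) ((h₃ _).2 (.inr hw)) ((hB u v hu hw).1 h)

theorem SameOn.refl (A : VSet n) (R : Rel n) : SameOn A R R := fun _ _ _ _ => Iff.rfl

theorem SameOn.trans {R₁ R₂ R₃ : Rel n} (h : SameOn A R₁ R₂) (h' : SameOn A R₂ R₃) :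
    SameOn A R₁ R₃ :=
  fun x y hx hy => (h x y hx hy).trans (h' x y hx hy)

theorem SameOn.symm (h : SameOn A R R') : SameOn A R' R := fun x y hx hy => (h x y hx hy).symm

theorem SameOn.cov_iff (h : SameOn A R R') (x : Fin n) : cov A R x ↔ cov A R' x := by
  unfold cov SameOn at *
  grind

theorem cov_count (hJ : IsJoin E S A B) (hR : IsM R) :
    cnt (cov S R) = cnt (cov A R) + cnt (cov B R) +
      ((cnt fun b => B b ∧ ∃ x, A x ∧ R b x) + cnt fun b => B b ∧ ∃ x, A x ∧ R b x) := by
  have hd := @hJ.disj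
  have hs := @hR.symm
  have hf := @hR.func
  have hS := hJ.mem_iff
  have e₁ : cnt (cov S R) = (cnt fun x => A x ∧ cov S R x) + cnt fun x => B x ∧ cov S R x :=
    cnt_eq_add (by unfold cov; grind) (by grind)
  have e₂ : (cnt fun x => A x ∧ cov S R x) = cnt (cov A R) + cnt fun x => A x ∧ ∃ y, B y ∧ R x y :=
    cnt_eq_add (by unfold cov; grind) (by unfold cov; grind)
  have e₃ : (cnt fun x => B x ∧ cov S R x) = cnt (cov B R) + cnt fun x => B x ∧ ∃ y, A y ∧ R x y :=
    cnt_eq_add (by unfold cov; grind) (by unfold cov; grind)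
  have e₆ : (cnt fun x => A x ∧ ∃ y, B y ∧ R x y) = cnt fun x => B x ∧ ∃ y, A y ∧ R x y := by
    apply le_antisymm
    · exact cnt_le_of_rel R (fun x ⟨hx, y, hy, h⟩ => ⟨y, ⟨hy, x, hx, hs h⟩, h⟩)
        fun x x' y _ _ _ h h' => hf (hs h) (hs h')
    · exact cnt_le_of_rel R (fun x ⟨hx, y, hy, h⟩ => ⟨y, ⟨hy, x, hx, hs h⟩, h⟩)
        fun x x' y _ _ _ h h' => hf (hs h) (hs h')
  omega

theorem crossCount_le (hR : IsM R) (hd : ∀ {x}, A x → ¬ B x) :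
    (cnt fun b => B b ∧ ∃ x, A x ∧ R b x) ≤ cnt fun x => A x ∧ ¬ cov A R x := by
  have hs := @hR.symm
  have hf := @hR.func
  refine cnt_le_of_rel R (fun x ⟨hx, y, hy, h⟩ => ⟨y, ⟨hy, fun ⟨_, z, hz, hz'⟩ => ?_⟩, h⟩)
    fun x x' y _ _ _ h h' => hf (hs h) (hs h')
  exact hd hz (hf hz' (hs h) ▸ hx)

theorem cnt_crossTarget (hR : IsM R) (hd : ∀ {x}, A x → ¬ B x) :
    cnt (fun b => ∃ x, crossTarget A B R b x) = cnt fun b => B b ∧ ∃ x, A x ∧ R b x :=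
  cnt_zipRel_left (cnt_mono fun _ h => h.1) (crossCount_le hR hd)

/-- The total number of covered vertices is invariant and the inner edges are fixed, so the number
of cross edges is determined. -/
theorem crossCount_eq (hJ : IsJoin E S A B) (h₀ : IsM R₀) (hr : Reach E S R₀ R)
    (hA : SameOn A R R₀) (hB : SameOn B R R₀) :
    (cnt fun b => B b ∧ ∃ x, A x ∧ R b x) = cnt fun b => B b ∧ ∃ x, A x ∧ R₀ b x := by
  have e₁ := cov_count hJ h₀
  have e₂ := cov_count hJ (hr.isM h₀)
  rw [cnt_congr hA.cov_iff, cnt_congr hB.cov_iff, hr.cnt_cov] at e₂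
  omega

/-- The target has as many edges as there are cross edges now, so a misplaced edge implies a missing
target edge `b x`. One or two swaps within the sides create `b x` without producing a new misplaced
end in `B`; here `B` must have no inner edges. -/
theorem lowerable_crossPotential (hJ : IsJoin E S A B) (h₀ : IsM R₀) (hv : ValidOn E S R₀)
    (hB₀ : ∀ x, ¬ cov B R₀ x) (hr : Reach E S R₀ R) (hn : crossPotential A B R₀ R ≤ n)
    (h : crossPotential A B R₀ R ≠ 0) : Lowerable E S (crossPotential A B R₀) R := by
  have hR := hr.isM h₀
  have hv' := hr.validOn hv
  have hd := @hJ.disj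
  have hs := @hR.symm
  have hf := @hR.func
  have hA : SameOn A R R₀ ∧ SameOn B R R₀ := by
    by_contra hA
    rw [crossPotential, if_neg hA] at hn
    omega
  rw [crossPotential, if_pos hA] at h
  obtain ⟨hA, hB⟩ := hA
  have hc := crossCount_eq hJ h₀ hr hA hB
  have hcA := hA.cov_iff
  have hcB : ∀ x, ¬ cov B R x := fun x hx => hB₀ x ((hB.cov_iff x).1 hx)
  have hz := cnt_crossTarget (B := B) h₀ hd
  have hZA : ∀ b x, crossTarget A B R₀ b x → B b ∧ A x ∧ ¬ cov A R x :=
    fun b x h => ⟨h.1, h.2.1.1, fun h' => h.2.1.2 ((hcA x).1 h')⟩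
  have hZr : ∀ b x y, crossTarget A B R₀ b x → crossTarget A B R₀ b y → x = y :=
    fun _ _ _ => zipRel_inj_right
  have hZl : ∀ b b' x, crossTarget A B R₀ b x → crossTarget A B R₀ b' x → b = b' :=
    fun _ _ _ => zipRel_inj_left
  set Z := crossTarget A B R₀ with hZ
  -- a missing edge of the target
  obtain ⟨b, x, hbx, hbx'⟩ : ∃ b x, Z b x ∧ ¬ R b x := by
    by_contra! hcon
    obtain ⟨b, hb, y, hy, hby, hZby⟩ := cnt_pos_iff.1 (Nat.pos_of_ne_zero h)
    have : cnt (fun b => ∃ x, Z b x) < cnt fun b => B b ∧ ∃ x, A x ∧ R b x := by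
      refine cnt_lt (x := b) (fun b' ⟨x, hx⟩ => ⟨(hZA _ _ hx).1, x, (hZA _ _ hx).2.1,
        hcon _ _ hx⟩) ⟨hb, y, hy, hby⟩ ?_
      rintro ⟨x, hx⟩
      exact hZby (hf (hcon _ _ hx) hby ▸ hx)
    omega
  obtain ⟨hb, hx, hxc⟩ := hZA b x hbx
  have key : ∀ l, l.length ≤ 4 → LegalSeq E S R l → SameOn A (applyList l R) R →
      SameOn B (applyList l R) R →
      (∀ z y, B z → A y → applyList l R z y → ¬ Z z y → ∃ y, A y ∧ R z y ∧ ¬ Z z y) →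
      (∃ z y, B z ∧ A y ∧ R z y ∧ ¬ Z z y ∧ ∀ y, A y → applyList l R z y → Z z y) →
      Lowerable E S (crossPotential A B R₀) R := by
    rintro l h₁ h₂ h₃ h₄ h₅ ⟨z, y, hz, hy, h₆, h₇, h₈⟩
    refine ⟨l, h₁, h₂, ?_⟩
    unfold crossPotential
    rw [if_pos ⟨h₃.trans hA, h₄.trans hB⟩, if_pos ⟨hA, hB⟩, ← hZ]
    exact cnt_lt (x := z) (fun w ⟨hw, v, hv, h, h'⟩ => ⟨hw, h₅ w v hw hv h h'⟩)
      ⟨hz, y, hy, h₆, h₇⟩ fun ⟨_, v, hv, h, h'⟩ => h' (h₈ v hv h)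
  by_cases hb' : ∃ x', A x' ∧ R b x'
  -- If `b` has the wrong mate `x'`, exchange `x` and `x'`.
  · obtain ⟨x', hx', hbx₁⟩ := hb'
    have hxc' : ¬ cov A R x' := by unfold cov; grind
    obtain ⟨hl, h₁, h₂⟩ := inner_swap hJ hv' hR hx hx' hxc hxc'
    refine key [(x, x')] (by simp) ⟨hl, trivial⟩ h₁ h₂ ?_ ⟨b, x', hb, hx', hbx₁, ?_, ?_⟩
    · intro z y hz hy h h'
      change conj R x x' z y at h
      rw [conj_apply] at h
      grind
    · grind
    · intro y hy h
      change conj R x x' b y at h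
      rw [conj_apply] at h
      grind
  by_cases hx' : ∃ b', B b' ∧ R b' x
  -- If `x` has the wrong mate `b'` and `b` has none in `A`, exchange `b` and `b'`.
  · obtain ⟨b', hb₁, hbx₁⟩ := hx'
    obtain ⟨hl, h₁, h₂⟩ := inner_swap hJ.swap hv' hR hb hb₁ (hcB _) (hcB _)
    refine key [(b, b')] (by simp) ⟨hl, trivial⟩ h₂ h₁ ?_ ⟨b', x, hb₁, hx, hbx₁, ?_, ?_⟩
    · intro z y hz hy h h'
      change conj R b b' z y at h
      rw [conj_apply] at h
      grind
    · grind
    · intro y hy h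
      change conj R b b' b' y at h
      rw [conj_apply] at h
      grind
  -- Neither `b` nor `x` is in a cross edge: move a misplaced edge `b₁ x₁` onto `b x`, one end at a
  -- time.
  obtain ⟨b₁, hb₁, x₁, hx₁, hbx₁, hZ₁⟩ := cnt_pos_iff.1 (Nat.pos_of_ne_zero h)
  have hxc₁ : ¬ cov A R x₁ := by unfold cov; grind
  obtain ⟨hl, h₁, h₂⟩ := inner_swap hJ.swap hv' hR hb hb₁ (hcB _) (hcB _)
  obtain ⟨hl', h₁', h₂'⟩ := inner_swap hJ hl.2.2 (hR.conj b b₁) hx hx₁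
    (fun h => hxc ((h₂.cov_iff _).1 h)) (fun h => hxc₁ ((h₂.cov_iff _).1 h))
  refine key [(b, b₁), (x, x₁)] (by simp) ⟨hl, hl', trivial⟩ (h₁'.trans h₂) (h₂'.trans h₁) ?_
    ⟨b₁, x₁, hb₁, hx₁, hbx₁, hZ₁, ?_⟩
  · intro z y hz hy h h'
    change conj (conj R b b₁) x x₁ z y at h
    rw [conj_apply, conj_apply] at h
    grind
  · intro y hy h
    change conj (conj R b b₁) x x₁ b₁ y at h
    rw [conj_apply, conj_apply] at h
    grind

theorem search_crossPotential (hJ : IsJoin E S A B) (h₀ : IsM R) (hv : ValidOn E S R)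
    (hB : ∀ x, ¬ cov B R x) :
    LegalSeq E S R (search E S (crossPotential A B R) R (cnt B)) ∧
      SameOn A (applyList (search E S (crossPotential A B R) R (cnt B)) R) R ∧
      SameOn B (applyList (search E S (crossPotential A B R) R (cnt B)) R) R ∧
      ∀ b x, B b → A x → (applyList (search E S (crossPotential A B R) R (cnt B)) R b x ↔
        crossTarget A B R b x) := by
  have hΦ : crossPotential A B R R ≤ cnt B := by
    rw [crossPotential, if_pos ⟨SameOn.refl _ _, SameOn.refl _ _⟩]
    exact cnt_mono fun _ h => h.1
  obtain ⟨h₁, h₂⟩ := search_spec (fun R' hR' hle hne => lowerable_crossPotential hJ h₀ hv hB hR'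
    (hle.trans (hΦ.trans (cnt_le _))) hne) hΦ
  have hr := h₁.reach
  generalize applyList (search E S (crossPotential A B R) R (cnt B)) R = R' at *
  have hR' := hr.isM h₀
  have hs : SameOn A R' R ∧ SameOn B R' R := by
    by_contra hs
    rw [crossPotential, if_neg hs] at h₂
    omega
  rw [crossPotential, if_pos hs, cnt_eq_zero_iff] at h₂
  have h₃ : ∀ b x, B b → A x → R' b x → crossTarget A B R b x := by
    intro b x hb hx h
    by_contra h'
    exact h₂ b ⟨hb, x, hx, h, h'⟩
  refine ⟨h₁, hs.1, hs.2, fun b x hb hx => ⟨h₃ b x hb hx, fun h => ?_⟩⟩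
  -- Zero potential gives only one inclusion; equal cardinalities give the other.
  have h₄ := crossCount_eq hJ h₀ hr hs.1 hs.2
  have h₅ := cnt_crossTarget (A := A) (B := B) h₀ hJ.disj
  obtain ⟨_, y, hy, h'⟩ := eq_of_cnt_le (p := fun b => B b ∧ ∃ x, A x ∧ R' b x)
    (q := fun b => ∃ x, crossTarget A B R b x)
    (fun b ⟨hb, x, hx, h⟩ => ⟨x, h₃ b x hb hx h⟩) (by omega) b ⟨x, h⟩
  rwa [zipRel_inj_right h (h₃ b y hb hy h')]

end MatchReconf

namespace MatchReconf

variable {n : ℕ} {E R R' R₀ K : Rel n} {S A B P Q : VSet n}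

/-! ### Splitting cographs -/

/-- There is no induced path `a b c d`. -/
def P4Free (E : Rel n) : Prop := ∀ a b c d, a ≠ b → a ≠ c → a ≠ d → b ≠ c → b ≠ d → c ≠ d →
  E a b → E b c → E c d → ¬ E a c → ¬ E b d → E a d

/-- `S` has two nonempty parts without edges between them. -/
def Splits (E : Rel n) (S : VSet n) : Prop :=
  ∃ T : VSet n, (∀ x, T x → S x) ∧ (∃ x, T x) ∧ (∃ x, S x ∧ ¬ T x) ∧
    ∀ x y, T x → S y → ¬ T y → ¬ E x y

theorem cnt_singleton (v : Fin n) : cnt (fun x => x = v) = 1 := by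
  classical
  rw [cnt, Finset.card_eq_one]
  exact ⟨v, by ext; simp⟩

theorem P4Free.compl (hs : ∀ {x y}, E x y → E y x) (h : P4Free E) : P4Free fun x y => ¬ E x y := by
  intro a b c d h₁ h₂ h₃ h₄ h₅ h₆ ab bc cd ac bd ad
  rw [not_not] at ac bd
  -- The complement of the path `a b c d` is the path `b d a c`.
  exact bc (h b d a c h₅ h₁.symm h₄ h₃.symm h₆.symm h₂ bd (hs ad) ac (fun h => ab (hs h))
    fun h => cd (hs h))

/-- If `v` has no neighbour on one of the two sides, that side remains separated. Otherwise consider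
a side containing non-neighbours of `v`: an edge `q p` there from a non-neighbour to a neighbour of
`v`, continued through `v` to a neighbour on the other side, would be an induced path on four
vertices. So the non-neighbours of that side split off. If there are none at all, `v` splits off in
the complement. -/
theorem Splits.insert (hs : ∀ {x y}, E x y → E y x) (hP : P4Free E) {v : Fin n} (hv : ¬ S v)
    (h : Splits E S) : Splits E (fun x => x = v ∨ S x) ∨
      Splits (fun x y => ¬ E x y) fun x => x = v ∨ S x := by
  obtain ⟨T, hT, ⟨t, ht⟩, ⟨u, hu, hu'⟩, hTU⟩ := h
  by_cases h₁ : ∃ r, T r ∧ E v r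
  swap
  · exact .inl ⟨T, fun x hx => .inr (hT x hx), ⟨t, ht⟩, ⟨v, .inl rfl, fun h => hv (hT v h)⟩, by grind⟩
  by_cases h₂ : ∃ r, S r ∧ ¬ T r ∧ E v r
  swap
  · exact .inl ⟨fun x => S x ∧ ¬ T x, fun x hx => .inr hx.1, ⟨u, hu, hu'⟩, ⟨t, .inr (hT t ht), by grind⟩,
      by grind⟩
  obtain ⟨r, hr, hvr⟩ := h₁
  obtain ⟨r', hr', hr'', hvr'⟩ := h₂
  by_cases h₃ : ∃ w, T w ∧ ¬ E v w
  · obtain ⟨w, hw, hvw⟩ := h₃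
    refine .inl ⟨fun x => T x ∧ ¬ E v x, fun x hx => .inr (hT x hx.1), ⟨w, hw, hvw⟩,
      ⟨v, .inl rfl, fun h => hv (hT v h.1)⟩, fun q p hq hp hp' hqp => ?_⟩
    rcases hp with rfl | hp
    · exact hq.2 (hs hqp)
    · by_cases hpT : T p
      · have hpv : E v p := by grind
        have := hP q p v r' (by grind) (by grind) (by grind) (by grind) (by grind) (by grind)
          hqp (hs hpv) hvr' (by grind) (by grind)
        exact hTU _ _ hq.1 hr' hr'' this
      · exact hTU _ _ hq.1 hp hpT hqp
  by_cases h₃ : ∃ w, S w ∧ ¬ T w ∧ ¬ E v w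
  · obtain ⟨w, hw, hw', hvw⟩ := h₃
    refine .inl ⟨fun x => S x ∧ ¬ T x ∧ ¬ E v x, fun x hx => .inr hx.1, ⟨w, hw, hw', hvw⟩,
      ⟨v, .inl rfl, fun h => hv h.1⟩, fun q p hq hp hp' hqp => ?_⟩
    rcases hp with rfl | hp
    · exact hq.2.2 (hs hqp)
    · by_cases hpT : T p
      · exact hTU _ _ hpT hq.1 hq.2.1 (hs hqp)
      · have hpv : E v p := by grind
        have := hP q p v r (by grind) (by grind) (by grind) (by grind) (by grind) (by grind)
          hqp (hs hpv) hvr (by grind) (by grind)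
        exact hTU _ _ hr hq.1 hq.2.1 (hs this)
  exact .inr ⟨fun x => x = v, fun x hx => .inl hx, ⟨v, rfl⟩, ⟨t, .inr (hT t ht), by grind⟩, by grind⟩

/-- Induction on `|S|`: remove a vertex and put it back with `Splits.insert`. The co-disconnected
case is the same argument in the complement, which is again free of induced paths on four vertices.
-/
theorem splits_or (hs : ∀ {x y}, E x y → E y x) (hP : P4Free E) (h : 2 ≤ cnt S) :
    Splits E S ∨ Splits (fun x y => ¬ E x y) S := by
  obtain ⟨k, hk⟩ : ∃ k, cnt S = k + 2 := ⟨cnt S - 2, by omega⟩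
  clear h
  induction k generalizing S with
  | zero =>
    obtain ⟨v, hv⟩ := cnt_pos_iff.1 (show 0 < cnt S by omega)
    have e : cnt S = cnt (fun x => x = v) + cnt fun x => S x ∧ x ≠ v :=
      cnt_eq_add (by grind) (by grind)
    have e' := cnt_singleton v
    have e'' : cnt (fun x => S x ∧ x ≠ v) = 1 := by omega
    obtain ⟨w, hw, hwv⟩ := cnt_pos_iff.1 (show 0 < cnt fun x => S x ∧ x ≠ v by omega)
    have hS : ∀ y, S y → y ≠ v → y = w := by
      intro y hy hyv
      by_contra hyw
      have := cnt_lt (p := fun x => x = w) (q := fun x => S x ∧ x ≠ v) (x := y) (by grind)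
        ⟨hy, hyv⟩ hyw
      have := cnt_singleton w
      omega
    by_cases hvw : E v w
    · exact .inr ⟨fun x => x = v, by grind, ⟨v, rfl⟩, ⟨w, hw, hwv⟩, by grind⟩
    · exact .inl ⟨fun x => x = v, by grind, ⟨v, rfl⟩, ⟨w, hw, hwv⟩, by grind⟩
  | succ k ih =>
    obtain ⟨v, hv⟩ := cnt_pos_iff.1 (show 0 < cnt S by omega)
    have e : cnt S = cnt (fun x => x = v) + cnt fun x => S x ∧ x ≠ v :=
      cnt_eq_add (by grind) (by grind)
    have e' := cnt_singleton v
    have hS : S = fun x => x = v ∨ S x ∧ x ≠ v := by funext x; grind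
    rw [hS]
    rcases ih (S := fun x => S x ∧ x ≠ v) (by omega) with h | h
    · exact h.insert hs hP (by simp)
    · refine (h.insert (fun h h' => h (hs h')) (hP.compl hs) (by simp)).symm.imp (fun h => ?_) id
      simpa using h

/-- As long as the growing set is not stable it gains a vertex in each round; hence after `n` rounds
it is stable or contains everything. -/
theorem reach_closed {s : VSet n} {x y : Fin n} (hx : reach E S s x) (hy : S y) (h : E x y) :
    reach E S s y := by
  set f : VSet n → VSet n := fun T x => T x ∨ S x ∧ ∃ y, T y ∧ E y x with hf
  have hmono (T : VSet n) : ∀ x, T x → f T x := fun x h => .inl h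
  have key (k : ℕ) : f (f^[k] s) = f^[k] s ∨ k ≤ cnt (f^[k] s) := by
    induction k with
    | zero => exact .inr (Nat.zero_le _)
    | succ k ih =>
      rw [Function.iterate_succ_apply']
      rcases ih with ih | ih
      · exact .inl (by rw [ih, ih])
      · by_cases h : ∃ x, f (f^[k] s) x ∧ ¬ f^[k] s x
        · obtain ⟨x, hx, hx'⟩ := h
          have := cnt_lt (hmono (f^[k] s)) hx hx'
          exact .inr (by omega)
        · push Not at h
          have : f (f^[k] s) = f^[k] s := funext fun x => propext ⟨h x, hmono _ x⟩
          exact .inl (by rw [this, this])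
  have hfix : f (reach E S s) = reach E S s := by
    rcases key n with h | h
    · exact h
    · have hall : ∀ x, reach E S s x :=
        fun x => eq_of_cnt_le (q := fun _ => True) (fun _ _ => trivial) ((cnt_le _).trans h) x trivial
      funext x
      exact propext ⟨fun _ => hall x, hmono _ x⟩
  rw [← hfix]
  exact .inr ⟨hy, x, hx, h⟩

theorem exists_first {x : Fin n} (hx : S x) : ∃ v, first S v := by
  classical
  have hne : (Finset.univ.filter S).Nonempty := ⟨x, by simpa using hx⟩
  refine ⟨(Finset.univ.filter S).min' hne, ?_, fun y hy => Finset.min'_le _ _ (by simpa using hy)⟩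
  simpa using Finset.min'_mem _ hne

theorem first_component {v : Fin n} (hv : first S v) : component E S v := by
  unfold component reach
  have (k : ℕ) : (fun (T : VSet n) x => T x ∨ S x ∧ ∃ y, T y ∧ E y x)^[k] (first S) v := by
    induction k with
    | zero => exact hv
    | succ k ih => rw [Function.iterate_succ_apply']; exact .inl ih
  exact this n

/-- The component cannot leave the side of the separation that contains the first vertex, so it
misses the other side. -/
theorem component_of_splits (hs : ∀ {x y}, E x y → E y x) (h : Splits E S) :
    ∃ x, S x ∧ ¬ component E S x := by
  obtain ⟨T, hT, ⟨t, ht⟩, ⟨u, hu, hu'⟩, hTU⟩ := h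
  obtain ⟨v, hv⟩ := exists_first (hT t ht)
  have hsub (T : VSet n) (hvT : T v) (hTU : ∀ x y, T x → S y → ¬ T y → ¬ E x y) :
      ∀ x, component E S x → T x := by
    have (k : ℕ) : ∀ x, (fun (T : VSet n) x => T x ∨ S x ∧ ∃ y, T y ∧ E y x)^[k] (first S) x →
        T x := by
      induction k with
      | zero => exact fun x hx => le_antisymm (hx.2 v hv.1) (hv.2 x hx.1) ▸ hvT
      | succ k ih =>
        intro x hx
        rw [Function.iterate_succ_apply'] at hx
        rcases hx with hx | ⟨hx, y, hy, hyx⟩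
        · exact ih x hx
        · by_contra hxT
          exact hTU y x (ih y hy) hx hxT hyx
    exact this n
  by_cases hvT : T v
  · exact ⟨u, hu, fun h => hu' (hsub T hvT hTU u h)⟩
  · refine ⟨t, hT t ht, fun h => ?_⟩
    have := hsub (fun x => S x ∧ ¬ T x) ⟨hv.1, hvT⟩
      (fun x y hx hy hy' hxy => hTU y x (by grind) hx.1 hx.2 (hs hxy)) t h
    exact this.2 ht

theorem leftPart_of_isUnion (h : IsUnion E S) : leftPart E S = component E S := by
  funext x; simp [leftPart, h]

theorem leftPart_of_not_isUnion (h : ¬ IsUnion E S) :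
    leftPart E S = component (fun x y => ¬ E x y) S := by
  funext x; simp [leftPart, h]

theorem not_adj_of_isUnion (h : IsUnion E S) {x y : Fin n} (hx : leftPart E S x)
    (hy : rightPart E S y) : ¬ E x y := by
  intro hxy
  refine hy.2 ?_
  rw [leftPart_of_isUnion h] at hx ⊢
  exact reach_closed hx hy.1 hxy

theorem mem_iff_left_right (E : Rel n) (S : VSet n) (x : Fin n) :
    S x ↔ leftPart E S x ∨ rightPart E S x :=
  ⟨fun hx => by unfold rightPart; tauto,
    fun hx => hx.elim (leftPart_subset E S x) (rightPart_subset E S x)⟩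

theorem isJoin_left_right (hs : ∀ {x y}, E x y → E y x) (h : ¬ IsUnion E S) :
    IsJoin E S (leftPart E S) (rightPart E S) where
  symm := hs
  mem_iff x := ⟨fun hx => by unfold rightPart; tauto,
    fun hx => hx.elim (leftPart_subset E S x) (rightPart_subset E S x)⟩
  disj hx := left_right_disjoint E S _ hx
  adj {x y} hx hy := by
    by_contra hxy
    refine hy.2 ?_
    rw [leftPart_of_not_isUnion h] at hx ⊢
    exact reach_closed (E := fun x y => ¬ E x y) hx hy.1 hxy

theorem parts_nonempty (hs : ∀ {x y}, E x y → E y x) (hP : P4Free E) (h : 2 ≤ cnt S) :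
    (∃ x, leftPart E S x) ∧ ∃ x, rightPart E S x := by
  obtain ⟨x, hx⟩ := cnt_pos_iff.1 (show 0 < cnt S by omega)
  obtain ⟨v, hv⟩ := exists_first hx
  by_cases hu : IsUnion E S
  · refine ⟨⟨v, by rw [leftPart_of_isUnion hu]; exact first_component hv⟩, ?_⟩
    obtain ⟨y, hy, hy'⟩ := hu
    exact ⟨y, hy, by rwa [leftPart_of_isUnion ⟨y, hy, hy'⟩]⟩
  · refine ⟨⟨v, by rw [leftPart_of_not_isUnion hu]; exact first_component hv⟩, ?_⟩
    have h₁ := (splits_or hs hP h).resolve_left fun h => hu (component_of_splits hs h)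
    obtain ⟨y, hy, hy'⟩ := component_of_splits (fun h h' => h (hs h')) h₁
    exact ⟨y, hy, by rwa [leftPart_of_not_isUnion hu]⟩

theorem isJoin_big_small (hs : ∀ {x y}, E x y → E y x) (h : ¬ IsUnion E S) :
    IsJoin E S (bigPart E S) (smallPart E S) := by
  unfold bigPart smallPart
  split_ifs
  exacts [isJoin_left_right hs h, (isJoin_left_right hs h).swap]

/-- Induction along the splittings of a cograph. -/
theorem tree_induction (hs : ∀ {x y}, E x y → E y x) (hP : P4Free E) {β : Type} {base : β}
    {comb : VSet n → β → β → β} {p : VSet n → β → Prop} (h₀ : ∀ S, cnt S ≤ 1 → p S base)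
    (h₁ : ∀ S b₁ b₂, p (leftPart E S) b₁ → p (rightPart E S) b₂ → 2 ≤ cnt S → p S (comb S b₁ b₂))
    (j : ℕ) (S : VSet n) (hj : cnt S ≤ j + 1) :
    p S (tree (leftPart E) (rightPart E) base comb j S) := by
  induction j generalizing S with
  | zero => exact h₀ S hj
  | succ j ih =>
    rw [tree]
    by_cases h : 2 ≤ cnt S
    · have hne := parts_nonempty (E := E) hs hP h
      have e := cnt_left_add_right E S
      have := cnt_pos_iff.2 hne.1
      have := cnt_pos_iff.2 hne.2
      -- Both parts are nonempty, hence strictly smaller, which pays for the level of recursion.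
      rw [if_pos hne]
      exact h₁ S _ _ (ih _ (by omega)) (ih _ (by omega)) h
    · rw [if_neg]
      · exact h₀ S (by omega)
      · rintro ⟨h₁, h₂⟩
        have e := cnt_left_add_right E S
        have := cnt_pos_iff.2 h₁
        have := cnt_pos_iff.2 h₂
        omega

end MatchReconf

namespace MatchReconf

variable {n : ℕ} {E R R' R₀ K K' : Rel n} {S A B P Q : VSet n}

/-! ### Maximum matchings -/

/-- Every edge has exactly one lower and one upper end. -/
theorem cnt_covered (h : IsM K) :
    cnt (fun x => ∃ y, K x y) = cnt (lower K) + cnt (lower K) := by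
  have hs := @h.symm
  have hf := @h.func
  have hi := @h.irrefl
  have e₁ : cnt (fun x => ∃ y, K x y) = cnt (lower K) + cnt fun x => ∃ y, K x y ∧ y < x := by
    refine cnt_eq_add (fun x => ⟨fun ⟨y, hy⟩ => ?_, ?_⟩) (fun x => ?_)
    · rcases lt_trichotomy x y with h' | h' | h'
      · exact .inl ⟨y, hy, h'⟩
      · exact absurd (h' ▸ hy) hi
      · exact .inr ⟨y, hy, h'⟩
    · rintro (⟨y, hy, _⟩ | ⟨y, hy, _⟩) <;> exact ⟨y, hy⟩
    · rintro ⟨y, hy, hxy⟩ ⟨z, hz, hzx⟩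
      exact absurd (hf hy hz ▸ hxy) hzx.not_gt
  have e₂ : (cnt fun x => ∃ y, K x y ∧ y < x) = cnt (lower K) := by
    apply le_antisymm
    · exact cnt_le_of_rel K (fun x ⟨y, hy, h⟩ => ⟨y, ⟨x, hs hy, h⟩, hy⟩)
        fun x x' y _ _ _ h h' => hf (hs h) (hs h')
    · exact cnt_le_of_rel K (fun x ⟨y, hy, h⟩ => ⟨y, ⟨x, hs hy, h⟩, hy⟩)
        fun x x' y _ _ _ h h' => hf (hs h) (hs h')
  omega

theorem IsM.res (h : IsM R) (S : VSet n) : IsM fun x y => S x ∧ S y ∧ R x y where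
  symm h' := ⟨h'.2.1, h'.1, h.symm h'.2.2⟩
  func h₁ h₂ := h.func h₁.2.2 h₂.2.2
  irrefl h' := h.irrefl h'.2.2

theorem cnt_cov_even (h : IsM R) (S : VSet n) : ∃ k, cnt (cov S R) = k + k :=
  ⟨_, (cnt_congr fun x => by unfold cov; grind).trans (cnt_covered (h.res S))⟩

theorem IsM.trunc (h : IsM K) (d : ℕ) : IsM (trunc d K) where
  symm h' := ⟨h.symm h'.1, h'.2.symm⟩
  func h₁ h₂ := h.func h₁.1 h₂.1
  irrefl h' := h.irrefl h'.1

theorem trunc_mono {d d' : ℕ} (h : d ≤ d') {x y : Fin n} (h' : trunc d K x y) :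
    trunc d' K x y :=
  ⟨h'.1, h'.2.imp (fun h' => ⟨h'.1, h'.2.trans h⟩) fun h' => ⟨h'.1, h'.2.trans h⟩⟩

theorem cnt_lower_trunc (d : ℕ) (K : Rel n) :
    cnt (lower (trunc d K)) = min (d / 2) (cnt (lower K)) := by
  rw [← cnt_rank_le]
  refine cnt_congr fun x => ⟨fun ⟨y, h, hxy⟩ => ⟨⟨y, h.1, hxy⟩, ?_⟩, fun ⟨⟨y, h, hxy⟩, hr⟩ =>
    ⟨y, ⟨h, .inl ⟨hxy, by omega⟩⟩, hxy⟩⟩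
  rcases h.2 with h' | h'
  · omega
  · exact absurd h'.1 hxy.not_gt

structure IsMax (E : Rel n) (S : VSet n) (K : Rel n) : Prop where
  isM : IsM K
  sub : ∀ {x y}, K x y → S x ∧ S y ∧ E x y
  max : ∀ R, IsM R → ValidOn E S R → cnt (cov S R) ≤ cnt fun x => ∃ y, K x y

theorem IsM.joinMatching {X : Rel n} {c : ℕ} (hd : ∀ {x}, A x → ¬ B x) (hX : IsM X)
    (hXA : ∀ {x y}, X x y → A x ∧ A y) : IsM (joinMatching A B X c) := by
  have hs := @hX.symm
  have hf := @hX.func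
  have hi := @hX.irrefl
  have h₁ : ∀ x y, zipRel B (uncovered A X) c x y → B x ∧ A y ∧ ∀ z, ¬ X y z :=
    fun x y h => ⟨h.1, h.2.1.1, fun z hz => h.2.1.2 ⟨z, hz⟩⟩
  have h₂ : ∀ x y z, zipRel B (uncovered A X) c x y → zipRel B (uncovered A X) c x z → y = z :=
    fun _ _ _ => zipRel_inj_right
  have h₃ : ∀ x y z, zipRel B (uncovered A X) c x z → zipRel B (uncovered A X) c y z → x = y :=
    fun _ _ _ => zipRel_inj_left
  unfold MatchReconf.joinMatching
  generalize zipRel B (uncovered A X) c = Z at *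
  refine ⟨?_, ?_, ?_⟩
  · grind
  · grind
  · grind

theorem isMax_union (hl : ∀ {x y}, A x → B y → ¬ E x y) (hs : ∀ {x y}, E x y → E y x)
    (hS : ∀ x, S x ↔ A x ∨ B x) (hd : ∀ {x}, A x → ¬ B x)
    (hK : IsMax E A K) (hK' : IsMax E B K') : IsMax E S fun x y => K x y ∨ K' x y where
  isM := by
    have h₁ := @hK.sub
    have h₂ := @hK'.sub
    refine ⟨fun h => h.imp hK.isM.symm hK'.isM.symm, ?_, fun h => h.elim hK.isM.irrefl hK'.isM.irrefl⟩
    rintro x y z (h | h) (h' | h')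
    · exact hK.isM.func h h'
    · exact absurd (h₂ h').1 (hd (h₁ h).1)
    · exact absurd (h₂ h).1 (hd (h₁ h').1)
    · exact hK'.isM.func h h'
  sub {x y} h := by
    have h₁ := @hK.sub
    have h₂ := @hK'.sub
    grind
  max R hR hv := by
    have h₁ := hK.max R hR fun x y hx hy => hv x y ((hS x).2 (.inl hx)) ((hS y).2 (.inl hy))
    have h₂ := hK'.max R hR fun x y hx hy => hv x y ((hS x).2 (.inr hx)) ((hS y).2 (.inr hy))
    have e₁ : cnt (cov S R) = cnt (cov A R) + cnt (cov B R) := by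
      refine cnt_eq_add (fun x => ?_) fun x h h' => hd h.1 h'.1
      unfold cov
      unfold ValidOn at hv
      grind
    have e₂ : cnt (fun x => ∃ y, K x y ∨ K' x y) =
        cnt (fun x => ∃ y, K x y) + cnt fun x => ∃ y, K' x y := by
      refine cnt_eq_add (fun x => by grind) ?_
      rintro x ⟨y, h⟩ ⟨z, h'⟩
      exact hd (hK.sub h).1 (hK'.sub h').1
    omega

/-- A matching covers at most `ν + 2|B|` vertices, where `ν` is the maximum number covered by a
matching inside `A`, and at most the largest even number below or equal to `|A| + |B|`. The
construction covers `2|B|` plus the smaller of `ν` and `|A| - |B|` rounded down to even, which meets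
one of the two bounds. -/
theorem isMax_join (hJ : IsJoin E S A B) (hAB : cnt B ≤ cnt A) (hK : IsMax E A K) :
    IsMax E S (joinMatching A B (trunc (cnt A - cnt B) K) n) := by
  set T := trunc (cnt A - cnt B) K with hT
  have hTM : IsM T := hK.isM.trunc _
  have hTA : ∀ {x y}, T x y → A x ∧ A y := fun h => ⟨(hK.sub h.1).1, (hK.sub h.1).2.1⟩
  have hM : IsM (joinMatching A B T n) := hTM.joinMatching hJ.disj hTA
  have hd := @hJ.disj
  refine ⟨hM, fun {x y} h => ?_, fun R hR hv => ?_⟩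
  · have h₁ := hJ.mem_iff
    have h₂ := @hJ.adj
    have h₃ := @hJ.symm
    rcases h with h | h | h
    · have := hK.sub h.1
      grind
    · have := h.1
      have := h.2.1.1
      grind
    · have := h.1
      have := h.2.1.1
      grind
  · have e₁ := cnt_covered hTM
    have e₂ := cnt_lower_trunc (cnt A - cnt B) K
    rw [← hT] at e₂
    have e₃ : cnt A = cnt (fun x => ∃ y, T x y) + cnt (uncovered A T) := by
      refine cnt_eq_add (fun x => ?_) fun x h h' => h'.2 h
      unfold uncovered
      constructor
      · intro h; by_cases h' : ∃ y, T x y <;> tauto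
      · rintro (⟨y, hy⟩ | h)
        exacts [(hTA hy).1, h.1]
    have h₄ : cnt B ≤ cnt (uncovered A T) := by omega
    have hz : ∀ b, B b → ∃ y, zipRel B (uncovered A T) n b y := fun b hb => by
      obtain ⟨y, hy, e⟩ := exists_rank_eq (one_le_rank hb) ((rank_le_cnt B b).trans h₄)
      exact ⟨y, hb, hy, e.symm, (rank_le_cnt B b).trans (cnt_le B)⟩
    have h₅ : cnt B ≤ cnt fun y => uncovered A T y ∧ ∃ b, zipRel B (uncovered A T) n b y :=
      cnt_le_of_rel (zipRel B (uncovered A T) n)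
        (fun b hb => (hz b hb).imp fun y hy => ⟨⟨hy.2.1, b, hy⟩, hy⟩)
        fun _ _ _ _ _ _ => zipRel_inj_left
    have h₆ : cnt (fun x => ∃ y, T x y) + (cnt B +
        cnt fun y => uncovered A T y ∧ ∃ b, zipRel B (uncovered A T) n b y) ≤
        cnt fun x => ∃ y, joinMatching A B T n x y := by
      rw [← cnt_or (fun x hx hx' => hd hx'.1.1 hx), ← cnt_or]
      · refine cnt_mono fun x hx => ?_
        rcases hx with ⟨y, hy⟩ | hx | ⟨_, y, hy⟩
        · exact ⟨y, .inl hy⟩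
        · obtain ⟨y, hy⟩ := hz x hx
          exact ⟨y, .inr (.inl hy)⟩
        · exact ⟨y, .inr (.inr hy)⟩
      · rintro x ⟨y, hy⟩ (hx | hx)
        · exact hd (hTA hy).1 hx
        · exact hx.1.2 ⟨y, hy⟩
    have e₇ := cov_count hJ hR
    have h₈ := hK.max R hR fun x y hx hy =>
      hv x y ((hJ.mem_iff x).2 (.inl hx)) ((hJ.mem_iff y).2 (.inl hy))
    have e₉ := cnt_covered hK.isM
    have h₁₀ : cnt (cov B R) + (cnt fun b => B b ∧ ∃ x, A x ∧ R b x) ≤ cnt B := by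
      rw [← cnt_or]
      · exact cnt_mono fun x hx => hx.elim And.left And.left
      · rintro x ⟨_, y, hy, h⟩ ⟨_, z, hz, h'⟩
        exact hd hz (hR.func h h' ▸ hy)
    have h₁₁ : cnt (cov S R) ≤ cnt A + cnt B := by
      rw [← cnt_eq_add hJ.mem_iff fun x => hd]
      exact cnt_mono fun _ h => h.1
    obtain ⟨k, hk⟩ := cnt_cov_even hR S
    omega

theorem isMax_maxMatching (hs : ∀ {x y}, E x y → E y x) (hP : P4Free E)
    (S : VSet n) : IsMax E S (maxMatching E S) := by
  refine tree_induction (E := E) hs hP (p := IsMax E) (fun S hS => ⟨⟨id, fun h => h.elim, id⟩,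
    fun h => h.elim, fun R hR hv => ?_⟩) (fun S k₁ k₂ h₁ h₂ _ => ?_) n S
    ((cnt_le S).trans (Nat.le_succ n))
  · obtain ⟨k, hk⟩ := cnt_cov_even hR S
    have : cnt (cov S R) ≤ cnt S := cnt_mono fun _ h => h.1
    omega
  · unfold maxComb
    split_ifs with hu hb
    · exact isMax_union (not_adj_of_isUnion hu) hs (mem_iff_left_right E S)
        (fun {x} => left_right_disjoint E S x) h₁ h₂
    · refine isMax_join (isJoin_big_small hs hu) (cnt_small_le_big E S) ?_
      simpa [bigPart, hb] using h₁
    · refine isMax_join (isJoin_big_small hs hu) (cnt_small_le_big E S) ?_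
      simpa [bigPart, hb] using h₂

/-! ### Jumps -/

/-- Every vertex of `B` is matched to a vertex of `A`. -/
def AllCross (A B : VSet n) (R : Rel n) : Prop := ∀ b, B b → ∃ a, A a ∧ R b a

theorem slack_eq_zero_iff : slack A B R = 0 ↔ AllCross A B R := by
  rw [slack, cnt_eq_zero_iff]
  exact forall_congr' fun b => by rw [not_and, not_not]

theorem AllCross.conj (h : AllCross A B R) (hd : ∀ {x}, A x → ¬ B x) {x y : Fin n} (hx : A x)
    (hy : A y) : AllCross A B (conj R x y) := by
  intro b hb
  obtain ⟨a, ha, hab⟩ := h b hb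
  refine ⟨if a = x then y else if a = y then x else a, by grind, ?_⟩
  rw [conj_apply]
  grind

/-- Inside `A`, the matching `R'` arises from `R` by replacing the edge `x x'` by `p q`. -/
def Replaces (A : VSet n) (R R' : Rel n) (x x' p q : Fin n) : Prop :=
  ∀ u v, A u → A v → (R' u v ↔ (R u v ∧ ¬ (u = x ∧ v = x') ∧ ¬ (u = x' ∧ v = x)) ∨
    (u = p ∧ v = q) ∨ (u = q ∧ v = p))

/-- Swapping `q'` and `p` slides the edge `q q'` to `q p`; if `p` had a mate in `B`, that mate is
now joined to `q'`, which is allowed in a join. -/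
theorem slide_move (hJ : IsJoin E S A B) (hR : IsM R) (hv : ValidOn E S R) (hc : AllCross A B R)
    {p q q' : Fin n} (hp : A p) (hq : A q) (hq' : A q') (hpc : ¬ cov A R p) (h : R q q')
    (hE : E p q) : Legal E S R q' p ∧ AllCross A B (conj R q' p) ∧
      Replaces A R (conj R q' p) q q' p q := by
  have h₁ := @hJ.disj
  have h₂ := @hJ.symm
  have h₃ := hJ.mem_iff
  have h₄ := @hJ.adj
  have h₅ := @hR.symm
  have h₆ := @hR.func
  have h₇ := @hR.irrefl
  unfold cov at hpc
  refine ⟨⟨(h₃ _).2 (.inl hq'), (h₃ _).2 (.inl hp), ?_⟩, hc.conj h₁ hq' hp, ?_⟩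
  · intro u v hu hw
    rw [conj_apply]
    unfold ValidOn at hv
    grind
  · intro u v hu hw
    rw [conj_apply]
    grind

/-- Swapping `q` and `y` turns `p y` into the inner edge `p q`, and a former mate `z` of `q` becomes
the mate of `y`; this needs the edge `y z`. Now `y` has no mate in `A`, so the edge `x x'` can be
opened by swapping `x'` and `y`: it becomes `x y`, and `z`, if present, is joined to `x'`. -/
theorem jump_move (hJ : IsJoin E S A B) (hR : IsM R) (hv : ValidOn E S R) (hc : AllCross A B R)
    {x x' p q y : Fin n} (hx : A x) (hx' : A x') (hxx' : R x x') (hp : A p) (hq : A q) (hy : B y)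
    (hpq : p ≠ q)
    (hqc : ¬ cov A R q) (hpy : R p y) (hE : E p q) (hz : ∀ z, B z → R q z → E y z) :
    LegalSeq E S R [(q, y), (x', y)] ∧ AllCross A B (conj (conj R q y) x' y) ∧
      Replaces A R (conj (conj R q y) x' y) x x' p q := by
  have h₁ := @hJ.disj
  have h₂ := @hJ.symm
  have h₃ := hJ.mem_iff
  have h₄ := @hJ.adj
  have h₅ := @hR.symm
  have h₆ := @hR.func
  have h₇ := @hR.irrefl
  have hl : ValidOn E S (conj R q y) := by
    unfold cov at hqc
    intro u v hu hw
    rw [conj_apply]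
    unfold ValidOn at hv
    grind
  have hR' := hR.conj q y
  have hsx : conj R q y x x' := by
    unfold cov at hqc
    rw [conj_apply]
    grind
  have hpq : conj R q y p q := by
    unfold cov at hqc
    rw [conj_apply]
    grind
  have hAA : ∀ u v, A u → A v → (conj R q y u v ↔ R u v ∨ (u = p ∧ v = q) ∨ (u = q ∧ v = p)) := by
    unfold cov at hqc
    intro u v hu hw
    rw [conj_apply]
    grind
  have hyB : ∀ a, A a → ¬ conj R q y y a := by
    unfold cov at hqc
    intro a ha
    rw [conj_apply]
    grind
  have hc' : ∀ b, B b → b ≠ y → (∃ a, A a ∧ conj R q y b a) ∨ conj R q y b y := by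
    intro b hb hby
    obtain ⟨a, ha, hab⟩ := hc b hb
    by_cases haq : a = q
    · refine .inr ?_
      rw [conj_apply]
      grind
    · refine .inl ⟨a, ha, ?_⟩
      rw [conj_apply]
      grind
  obtain ⟨hl', -, -, -, -⟩ := cross_move hJ hR' hl hx hx' hsx hy hyB
  refine ⟨⟨⟨(h₃ _).2 (.inl hq), (h₃ _).2 (.inr hy), hl⟩, hl', trivial⟩, ?_, ?_⟩
  · clear hl'
    have h₅ := @hR'.symm
    have h₆ := @hR'.func
    intro b hb
    by_cases hby : b = y
    · refine ⟨x, hx, ?_⟩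
      rw [conj_apply]
      grind
    · rcases hc' b hb hby with ⟨a, ha, hab⟩ | h
      · refine ⟨a, ha, ?_⟩
        rw [conj_apply]
        grind
      · refine ⟨x', hx', ?_⟩
        rw [conj_apply]
        grind
  · have hp' : p ≠ x' := by grind
    have hq' : q ≠ x' := by
      unfold cov at hqc
      grind
    have hpx : ∀ v, R x' v → v = x := fun v hv => h₆ hv (h₅ hxx')
    have hsymm := @hR'.symm
    have hirr := @hR'.irrefl
    intro u v hu hw
    have e₁ := hAA u v hu hw
    have e₂ := hyB u hu
    have e₃ := hyB v hw
    have e₄ := hpx u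
    have e₅ := hpx v
    have e₆ := @hsymm u y
    have e₇ := @hirr y
    have e₈ := @h₅ u x'
    have e₉ := @h₅ x' x
    clear hc hc' hAA hyB hsymm hirr hv hl hl' hz h₂ h₄ h₅ h₆ h₇ hpx hpy hqc hpq
    rw [conj_apply (conj R q y)]
    generalize conj R q y = R₁ at *
    grind

end MatchReconf

/-! ### Preparing jumps, and their effect on the potential -/

namespace MatchReconf

variable {n : ℕ} {E R R' R₀ K K' : Rel n} {S A B P Q : VSet n}

theorem allCross_inner_swap (hJ : IsJoin E S A B) (hR : IsM R) (hv : ValidOn E S R)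
    (hc : AllCross A B R) {p a : Fin n} (hp : A p) (ha : A a) (hpc : ¬ cov A R p)
    (hac : ¬ cov A R a) : Legal E S R p a ∧ SameOn A (conj R p a) R ∧ AllCross A B (conj R p a) ∧
      (∀ b, B b → (conj R p a p b ↔ R a b)) ∧ (∀ b, B b → (conj R p a a b ↔ R p b)) ∧
      ∀ c b, A c → c ≠ p → c ≠ a → B b → (conj R p a c b ↔ R c b) := by
  have h₁ := @hJ.disj
  obtain ⟨h₂, h₃, _⟩ := inner_swap hJ hv hR hp ha hpc hac
  refine ⟨h₂, h₃, hc.conj h₁ hp ha, ?_, ?_, ?_⟩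
  · intro b hb
    rw [conj_apply]
    grind
  · intro b hb
    rw [conj_apply]
    grind
  · intro c b hc h₄ h₅ hb
    rw [conj_apply]
    grind

theorem not_cov_of_cross (hR : IsM R) (hd : ∀ {x}, A x → ¬ B x) {a b : Fin n} (hb : B b)
    (h : R a b) : ¬ cov A R a := by
  rintro ⟨_, c, hc, hac⟩
  exact hd hc (hR.func h hac ▸ hb)

theorem Replaces.of_sameOn {R₁ : Rel n} (h : SameOn A R₁ R) {x x' p q : Fin n}
    (hr : Replaces A R₁ R' x x' p q) : Replaces A R R' x x' p q := by
  intro u v hu hw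
  rw [hr u v hu hw, h u v hu hw]

/-- Two ends of an edge `p q` that are free inside `A` can take over from the edge `x x'`. -/
def Jumps (E : Rel n) (S A B : VSet n) (R : Rel n) (x x' p q : Fin n) (k : ℕ) : Prop :=
  ∃ l, l.length ≤ k ∧ LegalSeq E S R l ∧ AllCross A B (applyList l R) ∧
    Replaces A R (applyList l R) x x' p q

theorem Jumps.prepend {x x' p q y z : Fin n} {k : ℕ} (hl : Legal E S R y z)
    (hs : SameOn A (conj R y z) R) (h : Jumps E S A B (conj R y z) x x' p q k) :
    Jumps E S A B R x x' p q (k + 1) := by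
  obtain ⟨l, h₁, h₂, h₃, h₄⟩ := h
  exact ⟨(y, z) :: l, by simpa using h₁, ⟨hl, h₂⟩, h₃, h₄.of_sameOn hs⟩

/-- Exchanging `q` with `a` first gives `q` the cross mate of `a`, if any, which is adjacent to `y`
by assumption; then `jump_move` applies. -/
theorem jumps_of_mate (hJ : IsJoin E S A B) (hR : IsM R) (hv : ValidOn E S R) (hc : AllCross A B R)
    {x x' p q a y : Fin n} (hx : A x) (hx' : A x') (hxx' : R x x') (hp : A p) (hq : A q) (hy : B y)
    (hpq : p ≠ q) (hqc : ¬ cov A R q) (hpy : R p y) (hE : E p q) (ha : A a) (hac : ¬ cov A R a)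
    (hap : a ≠ p) (hz : ∀ z, B z → R a z → E y z) : Jumps E S A B R x x' p q 3 := by
  have hd := @hJ.disj
  obtain ⟨h₁, h₂, h₃, h₄, -, h₅⟩ := allCross_inner_swap hJ hR hv hc hq ha hqc hac
  refine Jumps.prepend h₁ h₂ ?_
  obtain ⟨h₆, h₇, h₈⟩ := jump_move hJ (hR.conj q a) h₁.2.2 h₃ hx hx' ((h₂ _ _ hx hx').2 hxx') hp hq
    hy hpq (fun h => hqc ((h₂.cov_iff q).1 h)) ((h₅ p y hp hpq hap.symm hy).2 hpy) hE
    fun z hz' h => hz z hz' ((h₄ z hz').1 h)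
  exact ⟨_, by simp, h₆, h₇, h₈⟩

/-- A jump needs `p` matched to some `y` in `B`, and `q` either free or matched to a neighbour of
`y`. Swaps inside `A` arrange this: with an edge `y z` in `B` let `p` and `q` take over the mates of
`y` and `z`; with a free vertex let `q` become free. At most two swaps precede the two moves of the
jump. -/
theorem jumps (hJ : IsJoin E S A B) (hi : ∀ {x}, ¬ E x x) (hR : IsM R) (hv : ValidOn E S R)
    (hc : AllCross A B R) (hB : ∃ b, B b)
    (hf : (∃ y z, B y ∧ B z ∧ E y z) ∨ 0 < freeCount S R) {x x' p q : Fin n} (hx : A x)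
    (hx' : A x') (hxx' : R x x') (hp : A p) (hq : A q) (hpc : ¬ cov A R p) (hqc : ¬ cov A R q)
    (hE : E p q) : Jumps E S A B R x x' p q 4 := by
  have hd := @hJ.disj
  have hpq : p ≠ q := fun h => hi (h ▸ hE)
  rcases hf with ⟨y, z, hy, hz, hyz⟩ | hf
  · obtain ⟨a, ha, hay⟩ := hc y hy
    have hac := not_cov_of_cross (A := A) hR hd hy (hR.symm hay)
    obtain ⟨h₁, h₂, h₃, h₄, -, -⟩ := allCross_inner_swap hJ hR hv hc hp ha hpc hac
    have hR₁ := hR.conj p a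
    have hpy := (h₄ y hy).2 (hR.symm hay)
    obtain ⟨a', ha', haz⟩ := h₃ z hz
    refine Jumps.prepend h₁ h₂ (jumps_of_mate hJ hR₁ h₁.2.2 h₃ hx hx' ((h₂ _ _ hx hx').2 hxx')
      hp hq hy hpq (fun h => hqc ((h₂.cov_iff q).1 h)) hpy hE ha'
      (not_cov_of_cross hR₁ hd hz (hR₁.symm haz)) ?_ ?_)
    · rintro rfl
      exact hi (hR₁.func hpy (hR₁.symm haz) ▸ hyz)
    · intro z' hz' h
      rwa [hR₁.func h (hR₁.symm haz)]
  · obtain ⟨w, hw, hwc⟩ : ∃ w, S w ∧ ¬ cov S R w := by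
      by_contra! hcon
      have := cnt_mono hcon
      unfold freeCount at hf
      omega
    have hSA : ∀ u, A u → S u := fun u hu => (hJ.mem_iff u).2 (.inl hu)
    have hSB : ∀ u, B u → S u := fun u hu => (hJ.mem_iff u).2 (.inr hu)
    -- All of `B` is matched, so the uncovered vertex lies in `A`.
    have hwA : A w := by
      refine ((hJ.mem_iff w).1 hw).resolve_right fun hw' => ?_
      obtain ⟨a, ha, h⟩ := hc w hw'
      exact hwc ⟨hw, a, hSA a ha, h⟩
    by_cases hpy : ∃ y, B y ∧ R p y
    · obtain ⟨y, hy, hpy⟩ := hpy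
      obtain ⟨l, h₁, h₂⟩ := jumps_of_mate hJ hR hv hc hx hx' hxx' hp hq hy hpq hqc hpy hE hwA
        (fun ⟨_, v, hv, h⟩ => hwc ⟨hw, v, hSA v hv, h⟩)
        (by rintro rfl; exact hwc ⟨hw, y, hSB y hy, hpy⟩)
        fun z hz h => absurd ⟨hw, z, hSB z hz, h⟩ hwc
      exact ⟨l, by omega, h₂⟩
    -- Here `p` itself is free. Let it trade places with the mate `a` of any `y`; then `a` is the
    -- free vertex that is handed to `q`.
    · obtain ⟨y, hy⟩ := hB
      obtain ⟨a, ha, hay⟩ := hc y hy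
      have hac := not_cov_of_cross (A := A) hR hd hy (hR.symm hay)
      obtain ⟨h₁, h₂, h₃, h₄, h₅, -⟩ := allCross_inner_swap hJ hR hv hc hp ha hpc hac
      refine Jumps.prepend h₁ h₂ (jumps_of_mate hJ (hR.conj p a) h₁.2.2 h₃ hx hx'
        ((h₂ _ _ hx hx').2 hxx') hp hq hy hpq (fun h => hqc ((h₂.cov_iff q).1 h))
        ((h₄ y hy).2 (hR.symm hay)) hE ha (fun h => hac ((h₂.cov_iff a).1 h)) ?_ ?_)
      · rintro rfl
        exact hpy ⟨y, hy, hR.symm hay⟩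
      · intro z hz h
        exact absurd ⟨z, hz, (h₅ z hz).1 h⟩ hpy

section
variable {x x' p q : Fin n}

theorem badCount_le_of_mem (hr : Replaces A R R' x x' p q) (hK : IsM K) (h : K p q) :
    badCount A K R' ≤ badCount A K R := by
  refine cnt_mono fun u ⟨hu, v, hv, h₁, h₂⟩ => ?_
  rw [hr u v hu hv] at h₁
  have := @hK.symm
  exact ⟨hu, v, hv, by grind⟩

theorem badCount_lt (hr : Replaces A R R' x x' p q) (hK : IsM K) (hR : IsM R) (h : K p q)
    (hx : A x) (hx' : A x') (hxx' : R x x') (hxK : ¬ K x x') (hpc : ¬ cov A R p)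
    (hqc : q = x ∨ ¬ cov A R q) : badCount A K R' < badCount A K R := by
  have h₁ := @hK.symm
  have h₂ := @hR.symm
  have h₃ := @hR.func
  have h₄ := @hR.irrefl
  refine cnt_lt (x := x') (fun u ⟨hu, v, hv, h₁, h₂⟩ => ?_)
    ⟨hx', x, hx, h₂ hxx', fun h => hxK (h₁ h)⟩ ?_
  · rw [hr u v hu hv] at h₁
    exact ⟨hu, v, hv, by grind⟩
  · rintro ⟨_, v, hv, h₅, h₆⟩
    rw [hr x' v hx' hv] at h₅
    unfold cov at hpc hqc
    grind

/-- Removing an edge outside `K` frees two bad vertices `x` and `x'`, and only `p` and `q` can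
become bad. The relation matches `p` with `x'`, `q` with `x`, and every other vertex with itself. -/
theorem badCount_le (hr : Replaces A R R' x x' p q) (hK : IsM K) (hR : IsM R)
    (hx : A x) (hx' : A x') (hxx' : R x x') (hxK : ¬ K x x') (hpq : p ≠ q) :
    badCount A K R' ≤ badCount A K R := by
  have h₁ := @hK.symm
  have h₂ := @hR.symm
  have h₃ := @hR.func
  have h₄ := @hR.irrefl
  have key : ∀ u, A u → u ≠ p → u ≠ q → ∀ v, A v → R' u v → R u v ∧ u ≠ x ∧ u ≠ x' := by
    intro u hu hup huq v hv h
    rw [hr u v hu hv] at h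
    have h₅ := @h₃ x v x'
    have h₆ := @h₃ x' v x
    grind
  refine cnt_le_of_rel (fun u v => (u = p ∧ v = x') ∨ (u = q ∧ v = x) ∨ (u ≠ p ∧ u ≠ q ∧ v = u))
    ?_ ?_
  · rintro u ⟨hu, v, hv, h₅, h₆⟩
    by_cases hup : u = p
    · exact ⟨x', ⟨hx', x, hx, h₂ hxx', fun h => hxK (h₁ h)⟩, .inl ⟨hup, rfl⟩⟩
    by_cases huq : u = q
    · exact ⟨x, ⟨hx, x', hx', hxx', hxK⟩, .inr (.inl ⟨huq, rfl⟩)⟩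
    exact ⟨u, ⟨hu, v, hv, (key u hu hup huq v hv h₅).1, h₆⟩, .inr (.inr ⟨hup, huq, rfl⟩)⟩
  · rintro u u' v ⟨hu, w, hw, h₅, h₆⟩ ⟨hu', w', hw', h₅', h₆'⟩ _ h h'
    have e₁ := fun a b => key u hu a b w hw h₅
    have e₂ := fun a b => key u' hu' a b w' hw' h₅'
    have e₃ : x ≠ x' := fun h => h₄ (h ▸ hxx')
    clear key h₁ h₂ h₃ h₄ hr
    grind

end

/-- As long as an inner edge lies outside `K`, some `p` is covered by `K` but not by `R`, since `K`
covers more vertices. Its `K`-mate `q` is either in an inner edge, which slides onto `p q`, or free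
inside `A`, and then a bad edge jumps to `p q`. The removed edge is outside `K`, hence outside `K'`,
so the second count does not grow. Once all inner edges are in `K`, an edge outside `K'` jumps to an
edge of `K'`. -/
theorem lowerable_jumpPotential (hJ : IsJoin E S A B) (hi : ∀ {x}, ¬ E x x) (hR : IsM R)
    (hv : ValidOn E S R) (hc : AllCross A B R) (hB : ∃ b, B b)
    (hf : (∃ y z, B y ∧ B z ∧ E y z) ∨ 0 < freeCount S R)
    (hK : IsM K) (hKA : ∀ {x y}, K x y → A x ∧ A y ∧ E x y) (hK' : IsM K')
    (hKK : ∀ {x y}, K' x y → K x y) (h₁ : cnt (cov A R) < cnt fun x => ∃ y, K x y)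
    (h₂ : cnt (cov A R) ≤ cnt fun x => ∃ y, K' x y) (h : jumpPotential A B K K' R ≠ 0) :
    Lowerable E S (jumpPotential A B K K') R := by
  have hΦ : ∀ {R}, AllCross A B R → jumpPotential A B K K' R = badCount A K R + badCount A K' R :=
    fun {R} hc => if_pos (slack_eq_zero_iff.2 hc)
  have hs := @hR.symm
  rw [hΦ hc] at h
  have key : ∀ x x' p q, Jumps E S A B R x x' p q 4 → (∀ R', Replaces A R R' x x' p q →
      badCount A K R' + badCount A K' R' < badCount A K R + badCount A K' R) →
      Lowerable E S (jumpPotential A B K K') R := by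
    rintro x x' p q ⟨l, h₁, h₂, h₃, h₄⟩ h₅
    refine ⟨l, h₁, h₂, ?_⟩
    rw [hΦ hc, hΦ h₃]
    exact h₅ _ h₄
  by_cases hb : badCount A K R = 0
  · obtain ⟨x, hx, x', hx', hxx', hxK⟩ := cnt_pos_iff.1 (show 0 < badCount A K' R by omega)
    have hRK : ∀ u v, A u → A v → R u v → K u v := by
      intro u v hu hv huv
      by_contra hK
      exact cnt_eq_zero_iff.1 hb u ⟨hu, v, hv, huv, hK⟩
    obtain ⟨p, ⟨q, hpq⟩, hpc⟩ : ∃ p, (∃ q, K' p q) ∧ ¬ cov A R p := by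
      -- If `R` covered everything that `K'` covers, it would cover `x` in addition: inside `K`, the
      -- only possible mate of `x` is `x'`, and `x x'` is not in `K'`. That contradicts `h₂`.
      by_contra! hcon
      have := cnt_lt hcon (x := x) ⟨hx, x', hx', hxx'⟩ fun ⟨y, hy⟩ =>
        hxK (hK.func (hKK hy) (hRK x x' hx hx' hxx') ▸ hy)
      omega
    obtain ⟨hp, hq, hE⟩ := hKA (hKK hpq)
    have hqc : ¬ cov A R q := by
      rintro ⟨_, q', hq', h⟩
      have := hK.func (hRK q q' hq hq' h) (hK.symm (hKK hpq))
      subst this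
      exact hpc ⟨hp, q, hq, hs h⟩
    refine key x x' p q (jumps hJ hi hR hv hc hB hf hx hx' hxx' hp hq hpc hqc hE) fun R' hr => ?_
    have e₁ := badCount_le_of_mem hr hK (hKK hpq)
    have e₂ := badCount_lt hr hK' hR hpq hx hx' hxx' hxK hpc (.inr hqc)
    omega
  · obtain ⟨x, hx, x', hx', hxx', hxK⟩ := cnt_pos_iff.1 (Nat.pos_of_ne_zero hb)
    obtain ⟨p, ⟨q, hpq⟩, hpc⟩ : ∃ p, (∃ q, K p q) ∧ ¬ cov A R p := by
      by_contra! hcon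
      have := cnt_mono hcon
      omega
    obtain ⟨hp, hq, hE⟩ := hKA hpq
    have hne : p ≠ q := fun h => hi (h ▸ hE)
    by_cases hqc : cov A R q
    · obtain ⟨_, q', hq', hqq'⟩ := hqc
      have hqK : ¬ K q q' := fun h => hpc ⟨hp, q, hq, hs (hK.func h (hK.symm hpq) ▸ hqq')⟩
      obtain ⟨h₃, h₄, h₅⟩ := slide_move hJ hR hv hc hp hq hq' hpc hqq' hE
      refine key q q' p q ⟨[(q', p)], by simp, ⟨h₃, trivial⟩, h₄, h₅⟩ fun R' hr => ?_
      have e₁ := badCount_lt hr hK hR hpq hq hq' hqq' hqK hpc (.inl rfl)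
      have e₂ := badCount_le hr hK' hR hq hq' hqq' (fun h => hqK (hKK h)) hne
      omega
    · refine key x x' p q (jumps hJ hi hR hv hc hB hf hx hx' hxx' hp hq hpc hqc hE) fun R' hr => ?_
      have e₁ := badCount_lt hr hK hR hpq hx hx' hxx' hxK hpc (.inr hqc)
      have e₂ := badCount_le hr hK' hR hx hx' hxx' (fun h => hxK (hKK h)) hne
      omega

theorem badCount_le_cnt (A : VSet n) (K R : Rel n) : badCount A K R ≤ cnt A :=
  cnt_mono fun _ h => h.1

/-- With zero slack, exactly `d` vertices are covered inside `A`, so `d` is even. Then `trunc d K`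
covers exactly `d` vertices and, as `d` is below the maximum, `trunc (d + 2) K` covers more. At
potential zero the inner edges lie in `trunc d K`, and they are all of it by counting. -/
theorem search_jumpPotential (hJ : IsJoin E S A B) (hi : ∀ {x}, ¬ E x x) (hR : IsM R)
    (hv : ValidOn E S R) (hs : slack A B R = 0) (hB : ∃ b, B b)
    (hf : (∃ y z, B y ∧ B z ∧ E y z) ∨ 0 < freeCount S R) (hK : IsMax E A K) {d : ℕ}
    (hd : d = cnt A - cnt B - freeCount S R) (hlt : d < cnt (cov A K)) :
    let Φ := jumpPotential A B (trunc (d + 2) K) (trunc d K)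
    let l := search E S Φ R (cnt S + cnt S)
    LegalSeq E S R l ∧ slack A B (applyList l R) = 0 ∧
      SameOn A (applyList l R) (trunc d K) := by
  intro Φ l
  have hΦ : ∀ {R}, slack A B R = 0 → Φ R =
      badCount A (trunc (d + 2) K) R + badCount A (trunc d K) R := fun {R} hc => if_pos hc
  have hAS : cnt A ≤ cnt S := cnt_mono fun u hu => (hJ.mem_iff u).2 (.inl hu)
  have hΦR := hΦ hs
  have b₁ := badCount_le_cnt A (trunc (d + 2) K) R
  have b₂ := badCount_le_cnt A (trunc d K) R
  have b₃ := cnt_le A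
  have hcov : ∀ R', Reach E S R R' → slack A B R' = 0 → cnt (cov A R') = d := by
    intro R' hr h
    obtain ⟨t, h₁, h₂, h₃⟩ := cov_cross_count hJ (hr.isM hR)
    rw [hr.freeCount_eq] at h₃
    omega
  have hcK : cnt (cov A K) = cnt fun x => ∃ y, K x y := by
    have := @hK.sub
    exact cnt_congr fun x => by unfold cov; grind
  have e₀ := cnt_covered hK.isM
  have e₁ := cnt_covered (hK.isM.trunc d)
  have e₂ := cnt_covered (hK.isM.trunc (d + 2))
  rw [cnt_lower_trunc] at e₁ e₂
  obtain ⟨k, hk⟩ := cnt_cov_even hR A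
  have hdk := hcov R .refl hs
  have e₃ : (cnt fun x => ∃ y, trunc d K x y) = d := by omega
  have e₄ : d < cnt fun x => ∃ y, trunc (d + 2) K x y := by omega
  obtain ⟨h₁, h₂⟩ := search_spec (E := E) (S := S) (Φ := Φ) (R := R) (k := cnt S + cnt S)
    (fun R' hr hle hne => by
      have hs' : slack A B R' = 0 := by
        by_contra hs'
        have : Φ R' = n + n + 1 := if_neg hs'
        omega
      have hc' := hcov R' hr hs'
      exact lowerable_jumpPotential hJ hi (hr.isM hR) (hr.validOn hv) (slack_eq_zero_iff.1 hs') hB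
        (by rwa [hr.freeCount_eq]) (hK.isM.trunc _) (fun h => hK.sub h.1) (hK.isM.trunc _)
        (fun h => trunc_mono (by omega) h) (by omega) (by omega) hne) (by omega)
  change Φ (applyList l R) = 0 at h₂
  have hs' : slack A B (applyList l R) = 0 := by
    by_contra hs'
    have : Φ (applyList l R) = n + n + 1 := if_neg hs'
    omega
  have hc' : cnt (cov A (applyList l R)) = d := hcov _ h₁.reach hs'
  rw [hΦ hs'] at h₂
  have h₃ : ∀ x y, A x → A y → applyList l R x y → trunc d K x y := by
    intro x y hx hy h
    by_contra hn
    exact cnt_eq_zero_iff.1 (Nat.eq_zero_of_add_eq_zero_left h₂) x ⟨hx, y, hy, h, hn⟩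
  refine ⟨h₁, hs', fun x y hx hy => ⟨h₃ x y hx hy, fun h => ?_⟩⟩
  obtain ⟨_, z, hz, h'⟩ := eq_of_cnt_le (p := cov A (applyList l R))
    (q := fun x => ∃ y, trunc d K x y) (fun x ⟨hx, y, hy, h⟩ => ⟨y, h₃ x y hx hy h⟩) (by omega) x
    ⟨y, h⟩
  rwa [(hK.isM.trunc d).func h (h₃ x z hx hz h')]

end MatchReconf

namespace MatchReconf

variable {n : ℕ} {E R R' R₀ K K' : Rel n} {S A B P Q : VSet n}

/-! ### Correctness of the canonical moves -/

theorem SameOn.validOn (h : SameOn A R R') (hv : ValidOn E A R) : ValidOn E A R' :=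
  fun x y hx hy hxy => hv x y hx hy ((h x y hx hy).2 hxy)

theorem ValidOn.mono (h : ∀ x, A x → S x) (hv : ValidOn E S R) : ValidOn E A R :=
  fun x y hx hy => hv x y (h x hx) (h y hy)

theorem SameOn.conj (h : SameOn A R R') {x y : Fin n} (hx : A x) (hy : A y) :
    SameOn A (conj R x y) (conj R' x y) :=
  fun u v hu hv => h _ _ ((swap_mem hx hy u).2 hu) ((swap_mem hx hy v).2 hv)

theorem sameOn_conj {x y : Fin n} (hx : ¬ B x) (hy : ¬ B y) : SameOn B (conj R x y) R := by
  intro u v hu hv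
  rw [conj_apply]
  grind

theorem conj_comm (R : Rel n) (x y : Fin n) : conj R x y = conj R y x := by
  unfold conj
  rw [Equiv.swap_comm]

theorem LegalSeq.congr {l : List (Fin n × Fin n)} (hs : SameOn A R R') (h : LegalSeq E A R l) :
    LegalSeq E A R' l ∧ SameOn A (applyList l R) (applyList l R') := by
  induction l generalizing R R' with
  | nil => exact ⟨trivial, hs⟩
  | cons s l ih =>
    obtain ⟨⟨h₁, h₂, h₃⟩, h₄⟩ := h
    have h₅ := hs.conj h₁ h₂
    have := ih h₅ h₄
    exact ⟨⟨⟨h₁, h₂, h₅.validOn h₃⟩, this.1⟩, this.2⟩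

/-- Moves inside `A` only permute which vertices of `A` meet a given vertex of `B`. This is harmless
if all pairs between `A` and `B` are edges, and vacuous if none are. -/
theorem LegalSeq.of_part {l : List (Fin n × Fin n)} (hS : ∀ x, S x ↔ A x ∨ B x)
    (hd : ∀ {x}, A x → ¬ B x) (hs : ∀ {x y}, E x y → E y x)
    (hE : (∀ x y, A x → B y → E x y) ∨ ∀ x y, A x → B y → ¬ E x y) (hv : ValidOn E S R)
    (hR : IsM R) (h : LegalSeq E A R l) :
    LegalSeq E S R l ∧ SameOn B (applyList l R) R := by
  induction l generalizing R with
  | nil => exact ⟨trivial, SameOn.refl _ _⟩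
  | cons s l ih =>
    obtain ⟨⟨h₁, h₂, h₃⟩, h₄⟩ := h
    have h₅ : SameOn B (MatchReconf.conj R s.1 s.2) R := sameOn_conj (hd h₁) (hd h₂)
    have hcross : ∀ x y, A x → B y → MatchReconf.conj R s.1 s.2 x y → E x y := by
      intro x y hx hy hxy
      rcases hE with hE | hE
      · exact hE x y hx hy
      · have hxA := (swap_mem h₁ h₂ x).2 hx
        have hys : Equiv.swap s.1 s.2 y = y :=
          Equiv.swap_apply_of_ne_of_ne (by rintro rfl; exact hd h₁ hy) (by rintro rfl; exact hd h₂ hy)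
        unfold MatchReconf.conj at hxy
        rw [hys] at hxy
        exact absurd (hv _ _ ((hS _).2 (.inl hxA)) ((hS _).2 (.inr hy)) hxy) (hE _ _ hxA hy)
    have h₆ : ValidOn E S (MatchReconf.conj R s.1 s.2) := by
      intro x y hx hy hxy
      rcases (hS x).1 hx with hx' | hx' <;> rcases (hS y).1 hy with hy' | hy'
      · exact h₃ x y hx' hy' hxy
      · exact hcross x y hx' hy' hxy
      · exact hs (hcross y x hy' hx' ((hR.conj _ _).symm hxy))
      · exact hv x y hx hy ((h₅ x y hx' hy').1 hxy)
    have := ih h₆ (hR.conj _ _) h₄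
    exact ⟨⟨⟨(hS _).2 (.inl h₁), (hS _).2 (.inl h₂), h₆⟩, this.1⟩, this.2.trans h₅⟩

/-- At most one legal move, up to changes outside of `S`. -/
def Step (E : Rel n) (S : VSet n) (R R' : Rel n) : Prop :=
  SameOn S R' R ∨ ∃ x y, Legal E S R x y ∧ SameOn S R' (conj R x y)

theorem Step.cnt_cov (h : Step E S R R') : cnt (cov S R') = cnt (cov S R) := by
  rcases h with h | ⟨x, y, h, h'⟩
  · exact cnt_congr h.cov_iff
  · rw [cnt_congr h'.cov_iff, cnt_cov_conj h.1 h.2.1]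

theorem Step.of_same_part (hS : ∀ x, S x ↔ A x ∨ B x) {x y : Fin n}
    (h : Legal E S R x y) (h' : SameOn S R' (conj R x y)) (hxy : A x ↔ A y) : Step E A R R' := by
  have hA : SameOn A R' (MatchReconf.conj R x y) :=
    fun u v hu hv => h' u v ((hS u).2 (.inl hu)) ((hS v).2 (.inl hv))
  by_cases hx : A x
  · exact .inr ⟨x, y, ⟨hx, hxy.1 hx, h.2.2.mono fun u hu => (hS u).2 (.inl hu)⟩, hA⟩
  · exact .inl (hA.trans (sameOn_conj hx fun hy => hx (hxy.2 hy)))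

/-- For a swap of `x` in `A` with `y` in `B`, a mate of `x` in `A` would become a mate of `y`, and a
mate of `y` in `A` is impossible already. With no edges across, the part in `A` is unchanged. -/
theorem Step.union (hS : ∀ x, S x ↔ A x ∨ B x) (hd : ∀ {x}, A x → ¬ B x)
    (hE : ∀ x y, A x → B y → ¬ E x y) (hR : IsM R)
    (hv : ValidOn E S R) (h : Step E S R R') : Step E A R R' := by
  rcases h with h | ⟨x, y, h, h'⟩
  · exact .inl fun u v hu hv => h u v ((hS u).2 (.inl hu)) ((hS v).2 (.inl hv))
  by_cases hxy : A x ↔ A y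
  · exact .of_same_part hS h h' hxy
  wlog hx : A x generalizing x y
  · refine this y x ⟨h.2.1, h.1, ?_⟩ (by rwa [conj_comm]) (by tauto) (by tauto)
    rw [conj_comm]
    exact h.2.2
  obtain ⟨h₁, h₂, h₃⟩ := h
  have hy : B y := ((hS y).1 h₂).resolve_left (by tauto)
  refine .inl fun u v hu hw => ?_
  rw [h' u v ((hS u).2 (.inl hu)) ((hS v).2 (.inl hw))]
  have e₁ := fun z hz => h₃ z y ((hS z).2 (.inl hz)) h₂
  have e₂ := fun z hz => hv z y ((hS z).2 (.inl hz)) h₂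
  have e₃ : ∀ z, A z → ¬ R z y := fun z hz h => hE z y hz hy (e₂ z hz h)
  have e₄ : ∀ z, A z → ¬ conj R x y z y := fun z hz h => hE z y hz hy (e₁ z hz h)
  have e₅ := e₄ u hu
  have e₆ := e₄ v hw
  have e₇ := @hR.symm
  have e₈ := @hR.irrefl
  rw [conj_apply] at e₅ e₆ ⊢
  clear e₁ e₂ e₄ h₃ hv hE
  grind

/-- Let `x` in `A` be swapped with `y` in `B`. Before the move `y` has a mate `z` in `A`, afterwards
a mate `w` in `A`, and `w` was the mate of `x`. Seen from `A`, the edge `x w` has slid to `x z`,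
which is the swap of `w` and `z`; if `z = x`, nothing has changed. -/
theorem Step.join (hJ : IsJoin E S A B) (hR : IsM R) (hv' : ValidOn E S R')
    (hc : AllCross A B R) (hc' : AllCross A B R') (h : Step E S R R') : Step E A R R' := by
  have hS := hJ.mem_iff
  have hd := @hJ.disj
  rcases h with h | ⟨x, y, h, h'⟩
  · exact .inl fun u v hu hv => h u v ((hS u).2 (.inl hu)) ((hS v).2 (.inl hv))
  by_cases hxy : A x ↔ A y
  · exact .of_same_part hS h h' hxy
  wlog hx : A x generalizing x y
  · refine this y x ⟨h.2.1, h.1, ?_⟩ (by rwa [conj_comm]) (by tauto) (by tauto)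
    rw [conj_comm]
    exact h.2.2
  obtain ⟨h₁, h₂, h₃⟩ := h
  have hy : B y := ((hS y).1 h₂).resolve_left (by tauto)
  have e₁ := @hR.symm
  have e₂ := @hR.func
  have e₃ := @hR.irrefl
  have e₄ : SameOn A R' (conj R x y) :=
    fun u v hu hv => h' u v ((hS u).2 (.inl hu)) ((hS v).2 (.inl hv))
  obtain ⟨z, hz, hyz⟩ := hc y hy
  by_cases hxz : z = x
  · refine .inl (e₄.trans fun u v hu hv => ?_)
    rw [conj_apply]
    grind
  obtain ⟨w, hw, hyw⟩ := hc' y hy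
  have e₅ := (h' y w h₂ ((hS w).2 (.inl hw))).1 hyw
  have hxw : R x w := by
    rw [conj_apply] at e₅
    grind
  have e₆ : SameOn A (conj R x y) (conj R w z) := by
    intro u v hu hv
    rw [conj_apply, conj_apply]
    clear hc hc' h' hv' e₄ e₅ h₃
    grind
  have e₇ := e₄.trans e₆
  exact .inr ⟨w, z, ⟨hw, hz, e₇.validOn (hv'.mono fun u hu => (hS u).2 (.inl hu))⟩, e₇⟩

/-- There are two reasons. If `B` spans no edge and nothing is free, every vertex of `B` is covered
and its mate can only be in `A`. If `d` is at least the maximum for `A`, then the count `d + t` of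
vertices covered inside `A` forces `t = 0`, hence no slack. -/
theorem allCross_of_not_jumpCase (hJ : IsJoin E S A B) (hR : IsM R) (hv : ValidOn E S R)
    (hK : IsMax E A (maxMatching E A)) (h₁ : ¬ BalancedCase A B S R) (h₂ : ¬ JumpCase E A B S R) :
    AllCross A B R := by
  have hSA : ∀ u, A u → S u := fun u hu => (hJ.mem_iff u).2 (.inl hu)
  have hSB : ∀ u, B u → S u := fun u hu => (hJ.mem_iff u).2 (.inr hu)
  by_cases h : cnt A - cnt B - freeCount S R < cnt (cov A (maxMatching E A))
  · have h₃ : (∀ y z, B y → B z → ¬ E y z) ∧ freeCount S R = 0 := by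
      unfold JumpCase at h₂
      grind
    intro b hb
    have h₄ : cnt S ≤ cnt (cov S R) := by
      have := h₃.2
      unfold freeCount at this
      omega
    obtain ⟨_, a, ha, hba⟩ := eq_of_cnt_le (p := cov S R) (fun _ h => h.1) h₄ b (hSB b hb)
    refine ⟨a, ((hJ.mem_iff a).1 ha).resolve_right fun ha' => ?_, hba⟩
    exact h₃.1 b a hb ha' (hv b a (hSB b hb) ha hba)
  · rw [← slack_eq_zero_iff]
    obtain ⟨t, h₃, h₄, h₅⟩ := cov_cross_count hJ hR
    have h₆ := hK.max R hR (hv.mono hSA)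
    have h₇ : cnt (cov A (maxMatching E A)) = cnt fun x => ∃ y, maxMatching E A x y := by
      have := @hK.sub
      exact cnt_congr fun x => by unfold cov; grind
    unfold BalancedCase at h₁
    omega

theorem AllCross.not_cov (hc : AllCross A B R) (hR : IsM R) (hd : ∀ {x}, A x → ¬ B x)
    (x : Fin n) : ¬ cov B R x := by
  rintro ⟨hx, y, hy, h⟩
  obtain ⟨a, ha, h'⟩ := hc x hx
  exact hd ha (hR.func h' h ▸ hy)

theorem joinMoves_spec (hJ : IsJoin E S A B) (hi : ∀ {x}, ¬ E x x) (hR : IsM R)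
    (hv : ValidOn E S R) (hK : IsMax E A (maxMatching E A)) (hAB : cnt B ≤ cnt A)
    (hB : ∃ b, B b) {l : List (Fin n × Fin n)} (hl : LegalSeq E A R l) :
    let R₁ := applyList (joinMoves E R A B S l) R
    LegalSeq E S R (joinMoves E R A B S l) ∧ (∀ x, ¬ cov B R₁ x) ∧
      (BalancedCase A B S R → SameOn A R₁ fun _ _ => False) ∧
      (¬ BalancedCase A B S R → JumpCase E A B S R → SameOn A R₁
        (trunc (cnt A - cnt B - freeCount S R) (maxMatching E A))) ∧
      (¬ BalancedCase A B S R → ¬ JumpCase E A B S R → SameOn A R₁ (applyList l R)) := by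
  intro R₁
  have hd := @hJ.disj
  have hSA : ∀ u, A u → S u := fun u hu => (hJ.mem_iff u).2 (.inl hu)
  by_cases h₁ : BalancedCase A B S R
  · have e : joinMoves E R A B S l = search E S (sideCount A B) R (cnt S) := if_pos h₁
    have hk : sideCount A B R ≤ cnt S :=
      cnt_mono fun x hx => (hJ.mem_iff x).2 (hx.imp And.left And.left)
    obtain ⟨h₂, h₃⟩ := search_spec (E := E) (S := S) (fun R' hr _ hne =>
      lowerable_sideCount hJ (hr.isM hR) (hr.validOn hv) (by rwa [hr.freeCount_eq]) (by omega) hne)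
      hk
    rw [← e] at h₂ h₃
    have h₄ := cnt_eq_zero_iff.1 h₃
    refine ⟨h₂, fun x hx => h₄ x (.inr hx), fun _ x y hx hy => ?_, fun h => absurd h₁ h,
      fun h => absurd h₁ h⟩
    exact ⟨fun h => h₄ x (.inl ⟨hx, y, hy, h⟩), False.elim⟩
  by_cases h₂ : JumpCase E A B S R
  · have e : joinMoves E R A B S l = andThen E S (fun _ => jumpPotential A B
      (trunc (cnt A - cnt B - freeCount S R + 2) (maxMatching E A))
      (trunc (cnt A - cnt B - freeCount S R) (maxMatching E A))) (cnt S + cnt S) R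
      (search E S (slack A B) R (cnt S)) := (if_neg h₁).trans (if_pos h₂)
    have hk : slack A B R ≤ cnt S := cnt_mono fun x hx => (hJ.mem_iff x).2 (.inr hx.1)
    obtain ⟨h₃, h₄⟩ := search_spec (E := E) (S := S) (fun R' hr _ hne =>
      lowerable_slack hJ (hr.isM hR) (hr.validOn hv)
        (by rw [hr.freeCount_eq]; unfold BalancedCase at h₁; omega) hne) hk
    obtain ⟨h₅, h₆, h₇⟩ := search_jumpPotential hJ hi (h₃.reach.isM hR) (h₃.reach.validOn hv) h₄ hB
      (by rw [h₃.reach.freeCount_eq]; exact h₂.2) hK (by rw [h₃.reach.freeCount_eq]) h₂.1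
    have h₈ := h₃.append h₅
    rw [← applyList_append] at h₆ h₇
    rw [andThen] at e
    rw [← e] at h₈
    have h₉ : AllCross A B R₁ := by
      rw [← slack_eq_zero_iff]
      change slack A B (applyList (joinMoves E R A B S l) R) = 0
      rw [e]
      exact h₆
    refine ⟨h₈, h₉.not_cov (h₈.reach.isM hR) hd, fun h => absurd h h₁, fun _ _ => ?_,
      fun _ h => absurd h₂ h⟩
    change SameOn A (applyList (joinMoves E R A B S l) R) _
    rw [e]
    exact h₇
  · have e : joinMoves E R A B S l = l := (if_neg h₁).trans (if_neg h₂)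
    obtain ⟨h₃, h₄⟩ := hl.of_part hJ.mem_iff hd hJ.symm (.inl fun _ _ => hJ.adj) hv hR
    have h₅ := (allCross_of_not_jumpCase hJ hR hv hK h₁ h₂).not_cov hR hd
    change _ ∧ (∀ x, ¬ cov B (applyList _ R) x) ∧ (_ → SameOn A (applyList _ R) _) ∧
      (_ → _ → SameOn A (applyList _ R) _) ∧ (_ → _ → SameOn A (applyList _ R) _)
    rw [e]
    exact ⟨h₃, fun x hx => h₅ x ((h₄.cov_iff x).1 hx), fun h => absurd h h₁,
      fun _ h => absurd h h₂, fun _ _ => SameOn.refl _ _⟩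

/-- The moves `f R` lead from `R` to a matching that does not change when a legal move is applied
to `R`. -/
structure Canonical (E : Rel n) (S : VSet n) (f : Rel n → List (Fin n × Fin n)) : Prop where
  legal : ∀ R, IsM R → ValidOn E S R → LegalSeq E S R (f R)
  same : ∀ R R', IsM R → IsM R' → ValidOn E S R → ValidOn E S R' → Step E S R R' →
    SameOn S (applyList (f R) R) (applyList (f R') R')

theorem Canonical.union {f g : Rel n → List (Fin n × Fin n)} (hS : ∀ x, S x ↔ A x ∨ B x)
    (hd : ∀ {x}, A x → ¬ B x) (hs : ∀ {x y}, E x y → E y x) (hE : ∀ x y, A x → B y → ¬ E x y)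
    (hf : Canonical E A f) (hg : Canonical E B g) : Canonical E S fun R => f R ++ g R := by
  have hSA : ∀ u, A u → S u := fun u hu => (hS u).2 (.inl hu)
  have hSB : ∀ u, B u → S u := fun u hu => (hS u).2 (.inr hu)
  have hS' : ∀ x, S x ↔ B x ∨ A x := fun x => (hS x).trans or_comm
  have hd' : ∀ {x}, B x → ¬ A x := fun h h' => hd h' h
  have hE' : ∀ x y, B x → A y → ¬ E x y := fun x y hx hy h => hE y x hy hx (hs h)
  have key : ∀ R, IsM R → ValidOn E S R → LegalSeq E S R (f R ++ g R) ∧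
      SameOn A (applyList (f R ++ g R) R) (applyList (f R) R) ∧
      SameOn B (applyList (f R ++ g R) R) (applyList (g R) R) := by
    intro R hR hv
    obtain ⟨h₁, h₂⟩ := (hf.legal R hR (hv.mono hSA)).of_part hS hd hs (.inr hE) hv hR
    obtain ⟨h₃, h₄⟩ := (hg.legal R hR (hv.mono hSB)).congr h₂.symm
    obtain ⟨h₅, h₆⟩ := h₃.of_part hS' hd' hs (.inr hE') (h₁.reach.validOn hv) (h₁.reach.isM hR)
    rw [applyList_append]
    exact ⟨h₁.append h₅, h₆, h₄.symm⟩
  refine ⟨fun R hR hv => (key R hR hv).1, fun R R' hR hR' hv hv' h => ?_⟩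
  obtain ⟨h₁, h₂, h₃⟩ := key R hR hv
  obtain ⟨h₁', h₂', h₃'⟩ := key R' hR' hv'
  have hA := (h₂.trans (hf.same R R' hR hR' (hv.mono hSA) (hv'.mono hSA)
    (h.union hS hd hE hR hv))).trans h₂'.symm
  have hB := (h₃.trans (hg.same R R' hR hR' (hv.mono hSB) (hv'.mono hSB)
    (h.union hS' hd' hE' hR hv))).trans h₃'.symm
  have hv₁ := h₁.reach.validOn hv
  have hv₂ := h₁'.reach.validOn hv'
  intro x y hx hy
  rcases (hS x).1 hx with hx' | hx' <;> rcases (hS y).1 hy with hy' | hy'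
  · exact hA x y hx' hy'
  · exact iff_of_false (fun h => hE x y hx' hy' (hv₁ x y hx hy h))
      fun h => hE x y hx' hy' (hv₂ x y hx hy h)
  · exact iff_of_false (fun h => hE' x y hx' hy' (hv₁ x y hx hy h))
      fun h => hE' x y hx' hy' (hv₂ x y hx hy h)
  · exact hB x y hx' hy'

/-- The case distinction and `d` depend only on the invariant `freeCount`, so both matchings fall
into the same case and end with the same edges inside `A` and none inside `B`. Counting covered
vertices then gives the same number of cross edges, and `crossTarget` depends on nothing else. -/
theorem Canonical.join {f : Rel n → List (Fin n × Fin n)} (hJ : IsJoin E S A B)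
    (hi : ∀ {x}, ¬ E x x) (hK : IsMax E A (maxMatching E A)) (hAB : cnt B ≤ cnt A)
    (hB : ∃ b, B b) (hf : Canonical E A f) : Canonical E S fun R =>
      andThen E S (crossPotential A B) (cnt B) R (joinMoves E R A B S (f R)) := by
  have hd := @hJ.disj
  have hSA : ∀ u, A u → S u := fun u hu => (hJ.mem_iff u).2 (.inl hu)
  have hj : ∀ R, IsM R → ValidOn E S R → _ := fun R hR hv =>
    joinMoves_spec hJ hi hR hv hK hAB hB (hf.legal R hR (hv.mono hSA))
  refine ⟨fun R hR hv => ?_, fun R R' hR hR' hv hv' h => ?_⟩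
  · obtain ⟨h₁, h₂, -⟩ := hj R hR hv
    exact h₁.append
      (search_crossPotential hJ (h₁.reach.isM hR) (h₁.reach.validOn hv) h₂).1
  · obtain ⟨h₁, h₂, h₃, h₄, h₅⟩ := hj R hR hv
    obtain ⟨h₁', h₂', h₃', h₄', h₅'⟩ := hj R' hR' hv'
    have hfree : freeCount S R' = freeCount S R := by unfold freeCount; rw [h.cnt_cov]
    have hbal : BalancedCase A B S R' ↔ BalancedCase A B S R := by unfold BalancedCase; rw [hfree]
    have hjump : JumpCase E A B S R' ↔ JumpCase E A B S R := by unfold JumpCase; rw [hfree]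
    have hA : SameOn A (applyList (joinMoves E R A B S (f R)) R)
        (applyList (joinMoves E R' A B S (f R')) R') := by
      by_cases hb : BalancedCase A B S R
      · exact (h₃ hb).trans (h₃' (hbal.2 hb)).symm
      have hb' := fun h => hb (hbal.1 h)
      by_cases hc : JumpCase E A B S R
      · have := (h₄' hb' (hjump.2 hc)).symm
        rw [hfree] at this
        exact (h₄ hb hc).trans this
      have hc' := fun h => hc (hjump.1 h)
      refine ((h₅ hb hc).trans ?_).trans (h₅' hb' hc').symm
      exact hf.same R R' hR hR' (hv.mono hSA) (hv'.mono hSA)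
        (h.join hJ hR hv' (allCross_of_not_jumpCase hJ hR hv hK hb hc)
          (allCross_of_not_jumpCase hJ hR' hv' hK hb' hc'))
    have r₁ := h₁.reach
    have r₁' := h₁'.reach
    have hM := r₁.isM hR
    have hM' := r₁'.isM hR'
    obtain ⟨h₆, h₇, h₈, h₉⟩ := search_crossPotential hJ hM (r₁.validOn hv) h₂
    obtain ⟨h₆', h₇', h₈', h₉'⟩ := search_crossPotential hJ hM' (r₁'.validOn hv') h₂'
    have c₁ := cov_count hJ hM
    have c₁' := cov_count hJ hM'
    have hcov := hA.cov_iff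
    have z := cnt_eq_zero_iff.2 h₂
    have z' := cnt_eq_zero_iff.2 h₂'
    rw [r₁.cnt_cov, cnt_congr hcov, z] at c₁
    rw [r₁'.cnt_cov, h.cnt_cov, z'] at c₁'
    have hcross : crossTarget A B (applyList (joinMoves E R A B S (f R)) R) =
        crossTarget A B (applyList (joinMoves E R' A B S (f R')) R') := by
      unfold crossTarget
      congr 1
      · funext x
        rw [hcov x]
      · omega
    simp only [andThen, applyList_append]
    have s₁ := (h₆.reach.isM hM)
    have s₂ := (h₆'.reach.isM hM')
    generalize applyList (joinMoves E R A B S (f R)) R = R₁ at *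
    generalize applyList (joinMoves E R' A B S (f R')) R' = R₁' at *
    generalize applyList (search E S (crossPotential A B R₁) R₁ (cnt B)) R₁ = R₂ at *
    generalize applyList (search E S (crossPotential A B R₁') R₁' (cnt B)) R₁' = R₂' at *
    have hAA := (h₇.trans hA).trans h₇'.symm
    have hcr : ∀ b x, B b → A x → (R₂ b x ↔ R₂' b x) := by
      intro b x hb hx
      rw [h₉ b x hb hx, h₉' b x hb hx, hcross]
    intro x y hx hy
    rcases (hJ.mem_iff x).1 hx with hx' | hx' <;> rcases (hJ.mem_iff y).1 hy with hy' | hy'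
    · exact hAA x y hx' hy'
    · exact ⟨fun h => s₂.symm ((hcr y x hy' hx').1 (s₁.symm h)),
        fun h => s₁.symm ((hcr y x hy' hx').2 (s₂.symm h))⟩
    · exact hcr x y hx' hy'
    · exact iff_of_false (fun h => h₂ x ⟨hx', y, hy', (h₈ x y hx' hy').1 h⟩)
        fun h => h₂' x ⟨hx', y, hy', (h₈' x y hx' hy').1 h⟩

/-- Moves the dependence on `R` into the values of the recursion: `Canonical` compares two
matchings, so the induction must carry functions of `R`. -/
theorem canonMoves_eq_tree (E R : Rel n) (S : VSet n) (j : ℕ) : canonMoves E R S j =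
    tree (leftPart E) (rightPart E) (fun _ => [])
      (fun S f g R => moveComb E R S (f R) (g R)) j S R := by
  unfold canonMoves
  induction j generalizing S with
  | zero => rfl
  | succ j ih =>
    rw [tree, tree, ih, ih]
    split_ifs <;> rfl

theorem canonical_canonMoves (hs : ∀ {x y}, E x y → E y x) (hi : ∀ {x}, ¬ E x x) (hP : P4Free E)
    (j : ℕ) (S : VSet n) (hj : cnt S ≤ j + 1) : Canonical E S fun R => canonMoves E R S j := by
  simp only [canonMoves_eq_tree]
  refine tree_induction (E := E) hs hP (p := Canonical E) (fun S hS => ?_)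
    (fun S f g hf hg hS => ?_) j S hj
  · refine ⟨fun R _ _ => trivial, fun R R' hR hR' _ _ _ x y hx hy => ?_⟩
    -- A set with at most one vertex contains no edges, so there is nothing to compare.
    have hxy : x = y := by
      by_contra hxy
      have := cnt_lt (p := fun z => z = x) (q := S) (by rintro z rfl; exact hx) hy (Ne.symm hxy)
      rw [cnt_singleton] at this
      omega
    subst hxy
    exact iff_of_false hR.irrefl hR'.irrefl
  · unfold moveComb
    by_cases hu : IsUnion E S
    · simp only [if_pos hu]
      exact Canonical.union (mem_iff_left_right E S) (left_right_disjoint E S _) hs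
        (fun x y => not_adj_of_isUnion hu) hf hg
    · simp only [if_neg hu]
      refine Canonical.join (isJoin_big_small (E := E) hs hu) hi
        (isMax_maxMatching (E := E) hs hP _) (cnt_small_le_big E S) ?_ ?_
      · have := parts_nonempty (E := E) hs hP hS
        unfold smallPart
        split_ifs
        exacts [this.2, this.1]
      · by_cases hb : LeftBig E S
        · simpa [bigPart, hb] using hf
        · simpa [bigPart, hb] using hg

end MatchReconf

namespace MatchReconf
open Enc (enc)

/-! ### The sequence of matchings that the moves lead through -/

section
variable {n : ℕ}

open Classical in
/-- Perform a move; record the new matching unless it is the old one. -/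
noncomputable def trailStep (s : Rel n × List (Rel n)) (m : Fin n × Fin n) :
    Rel n × List (Rel n) :=
  (conj s.1 m.1 m.2, if ∀ i j, conj s.1 m.1 m.2 i j ↔ s.1 i j then s.2 else conj s.1 m.1 m.2 :: s.2)

/-- The matchings visited by a list of moves, the last one first. -/
noncomputable def trail (l : List (Fin n × Fin n)) (R : Rel n) : List (Rel n) :=
  (l.foldl trailStep (R, [R])).2

/-- Moves that lead from the matching `R` to a canonical matching of the graph `E`. -/
noncomputable def normalMoves (E R : Rel n) : List (Fin n × Fin n) :=
  canonMoves E R (fun _ => True) n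

noncomputable def normalForm (E R : Rel n) : Rel n := applyList (normalMoves E R) R

/-- A sequence from `M` to `N` by way of their common normal form. -/
noncomputable def route (E M N : Rel n) : List (Rel n) :=
  (trail (normalMoves E M) M).reverse ++ (trail (normalMoves E N) N).tail

theorem length_foldl_trailStep (l : List (Fin n × Fin n)) (s : Rel n × List (Rel n)) :
    (l.foldl trailStep s).2.length ≤ s.2.length + l.length := by
  induction l generalizing s with
  | nil => exact le_rfl
  | cons m l ih =>
    refine (ih _).trans ?_
    have : (trailStep s m).2.length ≤ s.2.length + 1 := by
      unfold trailStep
      split_ifs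
      · exact Nat.le_succ _
      · exact le_rfl
    rw [List.length_cons]
    omega

theorem length_trail_le (l : List (Fin n × Fin n)) (R : Rel n) :
    (trail l R).length ≤ l.length + 1 := by
  have := length_foldl_trailStep l (R, [R])
  rw [List.length_singleton] at this
  unfold trail
  omega

/-- Two trails of at most `16n + 1` matchings share the normal form, which is listed once. -/
theorem length_route_le (E M N : Rel n) : (route E M N).length ≤ 32 * n + 1 := by
  have h₁ := length_trail_le (normalMoves E M) M
  have h₂ := length_trail_le (normalMoves E N) N
  have h₃ : (normalMoves E M).length ≤ _ := length_canonMoves_le M (fun _ => True) n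
  have h₄ : (normalMoves E N).length ≤ _ := length_canonMoves_le N (fun _ => True) n
  have h₅ := cnt_le fun _ : Fin n => True
  rw [route, List.length_append, List.length_reverse, List.length_tail]
  omega

end

/-! ### Running time of the route, and removal of the index -/

namespace PolyT

variable {α β : ℕ → Type} [∀ n, Enc (α n)] [∀ n, Enc (β n)]

variable {E R R' : ∀ n, α n → Rel n} {l : ∀ n, α n → List (Fin n × Fin n)}

theorem relEq (hR : PolyT R) (hR' : PolyT R') :
    PolyT fun n a => ∀ i j, R n a i j ↔ R' n a i j := by
  apply_rules [id, fst, snd, all, iff, hR.comp, hR'.comp, app]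

theorem trail (hl : PolyT l) (hR : PolyT R) : PolyT fun n a => trail (l n a) (R n a) := by
  obtain ⟨q, hq⟩ := Bdd.bdd (σ := Rel)
  obtain ⟨p, hp⟩ := hl.size_le
  have hc : PolyT fun n (x : (α n × Rel n × List (Rel n)) × Fin n × Fin n) =>
      MatchReconf.conj x.1.2.1 x.2.1 x.2.2 := conj id.fst.snd.fst id.snd.fst id.snd.snd
  refine (foldl (σ := fun n => Rel n × List (Rel n)) (γ := fun n => Fin n × Fin n) hl
    (hR.pair (cons hR nil)) (step := fun _ _ => trailStep)
    (hc.pair (iteD (relEq hc id.fst.snd.fst) id.fst.snd.snd (cons hc id.fst.snd.snd)))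
    ⟨q + ((p + 1) * (q + 1) + 1) + 1, fun n a l' hl' => ?_⟩).snd
  have h₁ := length_foldl_trailStep l' (R n a, [R n a])
  have h₂ := hl'.length_le
  have h₃ := (length_le_sz _).trans (hp n a)
  have h₄ : q.eval n ≤ q.eval (n + sz a) := eval_le q (by omega)
  have h₅ := hq n (l'.foldl trailStep (R n a, [R n a])).1
  have h₆ := sz_list_le (l'.foldl trailStep (R n a, [R n a])).2 (q.eval n) fun s _ => hq n s
  rw [List.length_singleton] at h₁
  have h₇ : (l'.foldl trailStep (R n a, [R n a])).2.length * (q.eval n + 1) ≤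
      (p.eval (n + sz a) + 1) * (q.eval (n + sz a) + 1) :=
    Nat.mul_le_mul (by omega) (by omega)
  rw [sz_prod]
  simp only [Polynomial.eval_add, Polynomial.eval_mul, Polynomial.eval_one]
  omega

theorem tail {l : ∀ n, α n → List (β n)} (hl : PolyT l) : PolyT fun n a => (l n a).tail :=
  hl.step .snd fun n a => by
    have : (enc (l n a)).snd = enc (l n a).tail := by
      cases l n a <;> rfl
    rw [← this]
    exact Eval.snd _

theorem normalMoves (hE : PolyT E) (hR : PolyT R) :
    PolyT fun n a => normalMoves (E n a) (R n a) :=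
  canonMoves hE hR (lam true) dim

theorem normalForm (hE : PolyT E) (hR : PolyT R) : PolyT fun n a => normalForm (E n a) (R n a) :=
  applyList (normalMoves hE hR) hR

theorem route (hE : PolyT E) (hR : PolyT R) (hR' : PolyT R') :
    PolyT fun n a => route (E n a) (R n a) (R' n a) :=
  append (reverse (trail (normalMoves hE hR) hR)) (tail (trail (normalMoves hE hR') hR'))

/-- The index of the family can be computed from the input. -/
theorem exists_program {f : ∀ n, Rel n × Rel n × Rel n → β n} (hf : PolyT f) :
    ∃ (P : Program) (p : Polynomial ℕ), ∀ n (a : Rel n × Rel n × Rel n),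
      ∃ t ≤ p.eval (enc a).size, Eval P (enc a) (enc (f n a)) t := by
  obtain ⟨P, p, hP⟩ := hf
  obtain ⟨Q, q, hQ⟩ := pair (length (id (α := fun _ => List Data × Data)).fst)
    (id (α := fun _ => List Data × Data))
  -- The index `n` is the number of rows of the first matrix. `Q` computes this length with the rows
  -- regarded as plain `Data`, at index `0`, whose unary code is `nil`.
  refine ⟨.comp P (.comp Q (.pair .nil .id)),
    p.comp (2 * Polynomial.X) + q + 10 * (Polynomial.X + 1), fun n a => ?_⟩
  have e₀ (l : List (Fin n → Prop)) : enc l = enc (l.map enc) := by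
    induction l with
    | nil => rfl
    | cons x l ih => exact congrArg (Data.cons (enc x)) ih
  have e₁ : enc a = enc ((List.ofFn a.1).map enc, enc a.2) := by
    change Data.cons (enc (List.ofFn a.1)) _ = _
    rw [e₀]
    rfl
  obtain ⟨s, hs, hs'⟩ := hQ 0 ((List.ofFn a.1).map enc, enc a.2)
  obtain ⟨t, ht, ht'⟩ := hP n a
  have hn : n ≤ (enc a).size := by
    have h := length_le_sz (List.ofFn a.1)
    rw [List.length_ofFn] at h
    have h' := sz_prod a
    have : sz a.1 = sz (List.ofFn a.1) := rfl
    have : sz a = (enc a).size := rfl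
    omega
  have e₂ : (enc (((List.ofFn a.1).map enc).length, ((List.ofFn a.1).map enc, enc a.2)) : Data) =
      .cons (unary n) (enc a) := by
    rw [e₁, List.length_map, List.length_ofFn]
    rfl
  rw [e₂, ← e₁] at hs'
  rw [sz, ← e₁, zero_add] at hs
  refine ⟨_, ?_, Eval.comp (Eval.comp (Eval.pair (Eval.nil _) (Eval.id _)) hs') ht'⟩
  have h₁ : p.eval (n + sz a) ≤ p.eval (2 * (enc a).size) := eval_le p (by unfold sz; omega)
  simp only [Polynomial.eval_add, Polynomial.eval_comp, Polynomial.eval_X, Polynomial.eval_mul,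
    Polynomial.eval_ofNat, Polynomial.eval_one]
  omega

end PolyT

end MatchReconf

namespace MatchReconf
open Enc (enc)

variable {n : ℕ} {E R R' : Rel n} {G : SimpleGraph (Fin n)} {M N : Finset (Sym2 (Fin n))}

/-! ### Sets of edges and relations -/

def relOf (M : Finset (Sym2 (Fin n))) : Rel n := fun i j => s(i, j) ∈ M

open Classical in
noncomputable def edgesOf (R : Rel n) : Finset (Sym2 (Fin n)) :=
  Finset.univ.filter fun e => ∃ x y, R x y ∧ e = s(x, y)

theorem relOf_edgesOf (h : IsM R) : relOf (edgesOf R) = R := by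
  funext i j
  have := @h.symm
  simp only [relOf, edgesOf, Finset.mem_filter, Finset.mem_univ, true_and, Sym2.eq_iff, eq_iff_iff]
  grind

theorem relOf_injective : Function.Injective (relOf (n := n)) := by
  intro M N h
  ext e
  induction e with
  | _ x y => exact iff_of_eq (congrFun (congrFun h x) y)

theorem IsMatching.isM (h : IsMatching G M) : IsM (relOf M) where
  symm h' := by rwa [relOf, Sym2.eq_swap]
  func {x y z} h₁ h₂ := by
    by_contra hyz
    refine h.2 _ h₁ _ h₂ (fun h' => hyz ?_) x ⟨Sym2.mem_mk_left _ _, Sym2.mem_mk_left _ _⟩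
    exact Sym2.congr_right.1 h'
  irrefl h' := G.irrefl ((SimpleGraph.mem_edgeSet G).1 (h.1 _ h'))

theorem IsMatching.validOn (h : IsMatching G M) (S : VSet n) : ValidOn G.Adj S (relOf M) :=
  fun _ _ _ _ h' => (SimpleGraph.mem_edgeSet G).1 (h.1 _ h')

theorem isMatching_of_isM (h : IsM (relOf M)) (hv : ValidOn G.Adj (fun _ => True) (relOf M)) :
    IsMatching G M := by
  refine ⟨fun e he => ?_, fun e he f hf hef v hv' => hef ?_⟩
  · induction e with
    | _ x y => exact hv x y trivial trivial he
  · obtain ⟨⟨x, rfl⟩, ⟨y, rfl⟩⟩ := hv'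
    exact congrArg (fun z => s(v, z)) (h.func he hf)

theorem IsCograph.p4Free (h : IsCograph G) : P4Free G.Adj := by
  intro a b c d hab hac had hbc hbd hcd h₁ h₂ h₃ h₄ h₅
  by_contra h₆
  have hinj : Function.Injective ![a, b, c, d] := by
    intro i j hij
    fin_cases i <;> fin_cases j <;> simp_all
  refine h ⟨⟨⟨![a, b, c, d], hinj⟩, fun {i j} => ?_⟩⟩
  have := G.adj_comm
  rw [SimpleGraph.pathGraph_adj]
  fin_cases i <;> fin_cases j <;> simp_all

/-! ### Flips and sliding moves as transpositions -/

theorem mem_symmDiff_iff (x y : Fin n) : s(x, y) ∈ symmDiff M N ↔ ¬ (relOf M x y ↔ relOf N x y) := by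
  rw [Finset.mem_symmDiff, relOf, relOf]
  tauto

theorem isFlip_conj (hM : IsM (relOf M)) (hN : IsM (relOf N)) (h : IsFlip M N) :
    ∃ x y, relOf N = conj (relOf M) x y := by
  obtain ⟨a, b, c, d, hd, h⟩ := h
  -- Two matchings must alternate along the 4-cycle, so exchanging opposite corners maps one to the
  -- other.
  refine ⟨a, c, ?_⟩
  have h' := mem_symmDiff_iff (M := M) (N := N)
  simp only [h, Finset.mem_insert, Finset.mem_singleton, Sym2.eq_iff] at h'
  clear h
  have h₁ := @hM.symm
  have h₂ := @hM.func
  have h₃ := @hN.symm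
  have h₄ := @hN.func
  have h₅ := @hM.irrefl
  have h₆ := @hN.irrefl
  simp only [List.nodup_cons, List.mem_cons, List.not_mem_nil, not_or, or_false] at hd
  funext u v
  have e₁ := (h' a b).1 (by simp)
  have e₂ := (h' b c).1 (by simp)
  have e₃ := (h' c d).1 (by simp)
  have e₄ := (h' d a).1 (by simp)
  rw [eq_iff_iff, conj_apply]
  generalize relOf M = R at *
  generalize relOf N = R' at *
  have f₁ := h' u v
  have f₂ := h' a v
  have f₃ := h' c v
  have f₄ := h' u a
  have f₅ := h' u c
  clear h'
  grind

theorem isSlide_conj (hM : IsM (relOf M)) (hN : IsM (relOf N)) (h : IsSlide M N) :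
    ∃ x y, relOf N = conj (relOf M) x y := by
  obtain ⟨a, b, c, hd, h⟩ := h
  refine ⟨a, c, ?_⟩
  have h' := mem_symmDiff_iff (M := M) (N := N)
  simp only [h, Finset.mem_insert, Finset.mem_singleton, Sym2.eq_iff] at h'
  clear h
  have h₁ := @hM.symm
  have h₂ := @hM.func
  have h₃ := @hN.symm
  have h₄ := @hN.func
  have h₅ := @hM.irrefl
  have h₆ := @hN.irrefl
  simp only [List.nodup_cons, List.mem_cons, List.not_mem_nil, not_or, or_false] at hd
  funext u v
  have e₁ := (h' a b).1 (by simp)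
  have e₂ := (h' b c).1 (by simp)
  rw [eq_iff_iff, conj_apply]
  generalize relOf M = R at *
  generalize relOf N = R' at *
  have f₁ := h' u v
  have f₂ := h' a v
  have f₃ := h' c v
  have f₄ := h' u a
  have f₅ := h' u c
  clear h'
  grind

/-- Two different matchings that differ by a transposition differ by a flip or a sliding move. -/
theorem isFlip_or_isSlide {x y : Fin n} (hM : IsM (relOf M)) (h : relOf N = conj (relOf M) x y)
    (hne : M ≠ N) : IsFlip M N ∨ IsSlide M N := by
  have h₁ := @hM.symm
  have h₂ := @hM.func
  have h₃ := @hM.irrefl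
  have h₀ : ∀ u v, relOf N u v ↔ _ := fun u v => by rw [h, conj_apply]
  have hne' : ¬ ∀ u v, relOf N u v ↔ relOf M u v := fun h =>
    hne (relOf_injective (funext fun u => funext fun v => propext (h u v).symm))
  have slide : ∀ a a' c, [a, a', c].Nodup →
      (∀ u v, ¬ (relOf M u v ↔ relOf N u v) ↔ (u = a ∧ v = a') ∨ (u = a' ∧ v = a) ∨
        (u = a' ∧ v = c) ∨ (u = c ∧ v = a')) → IsSlide M N := by
    intro a a' c hd h
    refine ⟨a, a', c, hd, ?_⟩
    ext e
    induction e with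
    | _ u v =>
      rw [mem_symmDiff_iff, h]
      simp only [Finset.mem_insert, Finset.mem_singleton, Sym2.eq_iff, or_assoc]
  have flip : ∀ a a' c c', [a, a', c, c'].Nodup →
      (∀ u v, ¬ (relOf M u v ↔ relOf N u v) ↔ (u = a ∧ v = a') ∨ (u = a' ∧ v = a) ∨
        (u = a' ∧ v = c) ∨ (u = c ∧ v = a') ∨ (u = c ∧ v = c') ∨ (u = c' ∧ v = c) ∨
        (u = c' ∧ v = a) ∨ (u = a ∧ v = c')) → IsFlip M N := by
    intro a a' c c' hd h
    refine ⟨a, a', c, c', hd, ?_⟩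
    ext e
    induction e with
    | _ u v =>
      rw [mem_symmDiff_iff, h]
      simp only [Finset.mem_insert, Finset.mem_singleton, Sym2.eq_iff, or_assoc]
  simp only [List.nodup_cons, List.mem_cons, List.not_mem_nil, not_or, or_false] at slide flip
  clear hM hne h
  generalize relOf M = R at *
  generalize relOf N = R' at *
  have hxy : x ≠ y := by
    rintro rfl
    refine hne' fun u v => ?_
    rw [h₀]
    grind
  -- An edge `x y` would be fixed by the swap. So the mates of `x` and `y` are other vertices: two
  -- mates give a flip, one gives a slide, none gives no change.
  have hxy' : ¬ R x y := by
    intro hR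
    refine hne' fun u v => ?_
    rw [h₀]
    clear slide flip
    grind
  by_cases ha : ∃ a, R x a
  · obtain ⟨a, ha⟩ := ha
    by_cases hb : ∃ b, R y b
    · obtain ⟨b, hb⟩ := hb
      refine .inl (flip x a y b ?_ fun u v => ?_)
      · clear slide flip; grind
      · rw [h₀]
        clear slide flip hne'
        grind
    · refine .inr (slide x a y ?_ fun u v => ?_)
      · clear slide flip; grind
      · rw [h₀]
        clear slide flip hne'
        grind
  · by_cases hb : ∃ b, R y b
    · obtain ⟨b, hb⟩ := hb
      refine .inr (slide y b x ?_ fun u v => ?_)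
      · clear slide flip; grind
      · rw [h₀]
        clear slide flip hne'
        grind
    · refine absurd (fun u v => ?_) hne'
      rw [h₀]
      clear slide flip
      grind

end MatchReconf

namespace MatchReconf
open Enc (enc)

variable {n : ℕ} {E R R' : Rel n} {G : SimpleGraph (Fin n)} {M N : Finset (Sym2 (Fin n))}

/-! ### Correctness of the algorithm -/

theorem edgesOf_relOf (h : IsM (relOf M)) : edgesOf (relOf M) = M :=
  relOf_injective (relOf_edgesOf h)

theorem canonical_normalMoves (h : IsCograph G) :
    Canonical G.Adj (fun _ => True) (normalMoves G.Adj) :=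
  canonical_canonMoves (fun h => h.symm) G.irrefl h.p4Free n _ ((cnt_le _).trans (Nat.le_succ n))

/-- On the whole vertex set a flip or a slide is a single legal transposition, so `Canonical.same`
applies. -/
theorem normalForm_eq_of_move (h : IsCograph G) (hM : IsMatching G M) (hN : IsMatching G N)
    (hMN : IsFlip M N ∨ IsSlide M N) :
    normalForm G.Adj (relOf M) = normalForm G.Adj (relOf N) := by
  obtain ⟨x, y, hxy⟩ : ∃ x y, relOf N = conj (relOf M) x y :=
    hMN.elim (isFlip_conj hM.isM hN.isM) (isSlide_conj hM.isM hN.isM)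
  have hv := hN.validOn fun _ => True
  have := (canonical_normalMoves h).same _ _ hM.isM hN.isM (hM.validOn _) hv
    (.inr ⟨x, y, ⟨trivial, trivial, hxy ▸ hv⟩, hxy ▸ SameOn.refl _ _⟩)
  exact funext fun u => funext fun v => propext (this u v trivial trivial)

theorem normalForm_eq_of_isReconfSeq (h : IsCograph G) {S : List (Finset (Sym2 (Fin n)))}
    (hS : IsReconfSeq G M N S) : normalForm G.Adj (relOf M) = normalForm G.Adj (relOf N) := by
  obtain ⟨h₁, h₂, h₃, h₄⟩ := hS
  induction S generalizing M with
  | nil => simp at h₁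
  | cons X S ih =>
    obtain rfl : X = M := by simpa using h₁
    cases S with
    | nil =>
      obtain rfl : X = N := by simpa using h₂
      rfl
    | cons Y S =>
      rw [List.isChain_cons_cons] at h₄
      refine (normalForm_eq_of_move h (h₃ X (by simp)) (h₃ Y (by simp)) h₄.1).trans
        (ih rfl (by simpa using h₂) (fun Z hZ => h₃ Z (List.mem_cons_of_mem _ hZ)) h₄.2)

/-- The matchings given by two relations differ by a flip or a sliding move. -/
def Near (R R' : Rel n) : Prop :=
  IsFlip (edgesOf R) (edgesOf R') ∨ IsSlide (edgesOf R) (edgesOf R')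

theorem Near.symm (h : Near R R') : Near R' R := by
  unfold Near IsFlip IsSlide at *
  rwa [symmDiff_comm (edgesOf R')]

theorem near_conj (hR : IsM R) {x y : Fin n} (hne : conj R x y ≠ R) : Near R (conj R x y) := by
  have hR' := hR.conj x y
  have e := relOf_edgesOf hR
  have e' := relOf_edgesOf hR'
  refine isFlip_or_isSlide (x := x) (y := y) (by rwa [e]) (by rw [e, e']) fun h => hne ?_
  rw [← e', ← h, e]

/-- `L` is a sequence of moves, backwards, from `R` to `R'`. -/
structure IsTrail (E R R' : Rel n) (L : List (Rel n)) : Prop where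
  head : L.head? = some R'
  last : L.getLast? = some R
  valid : ∀ X ∈ L, IsM X ∧ ValidOn E (fun _ => True) X
  chain : L.IsChain Near

theorem isTrail_foldl {l : List (Fin n × Fin n)} {s : Rel n × List (Rel n)}
    (h : IsTrail E R s.1 s.2) (hl : LegalSeq E (fun _ => True) s.1 l) :
    IsTrail E R (applyList l s.1) (l.foldl trailStep s).2 := by
  induction l generalizing s with
  | nil => exact h
  | cons m l ih =>
    refine ih (s := trailStep s m) ?_ hl.2
    have hs : IsM s.1 := (h.valid s.1 (List.mem_of_head? h.head)).1
    unfold trailStep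
    split_ifs with hc
    · have e : conj s.1 m.1 m.2 = s.1 := funext fun i => funext fun j => propext (hc i j)
      simp only [e]
      exact h
    · obtain ⟨L, e⟩ : ∃ L, s.2 = s.1 :: L := by
        have := h.head
        cases hL : s.2 with
        | nil => simp [hL] at this
        | cons X L => exact ⟨L, by simp [hL] at this; rw [this]⟩
      have hn := near_conj hs (x := m.1) (y := m.2) fun e => hc fun i j => by rw [e]
      have h₁ := h.last
      have h₂ := h.valid
      have h₃ := h.chain
      rw [e] at h₁ h₂ h₃ ⊢
      refine ⟨rfl, by simpa using h₁, fun X hX => ?_, List.isChain_cons_cons.2 ⟨hn.symm, h₃⟩⟩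
      rcases List.mem_cons.1 hX with rfl | hX
      · exact ⟨hs.conj _ _, hl.1.2.2⟩
      · exact h₂ X hX

theorem isTrail_trail {l : List (Fin n × Fin n)} (hR : IsM R) (hv : ValidOn E (fun _ => True) R)
    (hl : LegalSeq E (fun _ => True) R l) : IsTrail E R (applyList l R) (trail l R) :=
  isTrail_foldl (s := (R, [R])) ⟨rfl, rfl, by simpa using ⟨hR, hv⟩, by simp⟩ hl

/-- Trails are listed backwards: the reversed first one ends at `R₀`, where the second one starts,
so its head is dropped. -/
theorem IsTrail.join {R₀ : Rel n} {L L' : List (Rel n)} (h : IsTrail E R R₀ L)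
    (h' : IsTrail E R' R₀ L') : IsTrail E R' R (L.reverse ++ L'.tail) := by
  obtain ⟨h₁, h₂, h₃, h₄⟩ := h
  obtain ⟨h₁', h₂', h₃', h₄'⟩ := h'
  cases L with
  | nil => simp at h₁
  | cons X L =>
    cases L' with
    | nil => simp at h₁'
    | cons Y L' =>
      obtain rfl : X = R₀ := by simpa using h₁
      obtain rfl : Y = X := by simpa using h₁'
      have e : (Y :: L).reverse ++ (Y :: L').tail = L.reverse ++ Y :: L' := by simp
      refine ⟨?_, ?_, fun Z hZ => ?_, ?_⟩
      · rw [List.head?_append, List.head?_reverse, h₂]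
        rfl
      · rw [e, List.getLast?_append, h₂']
        rfl
      · rcases List.mem_append.1 hZ with hZ | hZ
        · exact h₃ Z (List.mem_reverse.1 hZ)
        · exact h₃' Z (List.mem_of_mem_tail hZ)
      · rw [e, List.isChain_split]
        refine ⟨?_, h₄'⟩
        rw [← List.reverse_cons, List.isChain_reverse]
        exact h₄.imp fun _ _ h => h.symm

theorem isTrail_route (h : IsCograph G) (hM : IsMatching G M) (hN : IsMatching G N)
    (e : normalForm G.Adj (relOf M) = normalForm G.Adj (relOf N)) :
    IsTrail G.Adj (relOf N) (relOf M) (route G.Adj (relOf M) (relOf N)) := by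
  have h₁ := isTrail_trail hM.isM (hM.validOn _)
    ((canonical_normalMoves h).legal _ hM.isM (hM.validOn _))
  have h₂ := isTrail_trail hN.isM (hN.validOn _)
    ((canonical_normalMoves h).legal _ hN.isM (hN.validOn _))
  change IsTrail _ _ (normalForm _ _) _ at h₁ h₂
  rw [e] at h₁
  exact h₁.join h₂

theorem IsTrail.isReconfSeq {L : List (Rel n)} (hM : IsMatching G M) (hN : IsMatching G N)
    (h : IsTrail G.Adj (relOf N) (relOf M) L) : IsReconfSeq G M N (L.map edgesOf) := by
  refine ⟨?_, ?_, fun X hX => ?_, (List.isChain_map _).2 h.chain⟩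
  · rw [List.head?_map, h.head, Option.map_some, edgesOf_relOf hM.isM]
  · rw [List.getLast?_map, h.last, Option.map_some, edgesOf_relOf hN.isM]
  · obtain ⟨R, hR, rfl⟩ := List.mem_map.1 hX
    have e := relOf_edgesOf (h.valid R hR).1
    exact isMatching_of_isM (e.symm ▸ (h.valid R hR).1) (e.symm ▸ (h.valid R hR).2)

theorem isYes_iff {I : Instance} (h : IsCograph I.G) : I.IsYes ↔
    normalForm I.G.Adj (relOf I.init) = normalForm I.G.Adj (relOf I.target) :=
  ⟨fun ⟨_, hS⟩ => normalForm_eq_of_isReconfSeq h hS, fun e => ⟨_, (isTrail_route h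
    I.isMatching_init I.isMatching_target e).isReconfSeq I.isMatching_init I.isMatching_target⟩⟩

/-! ### Agreement of the encodings, and the two algorithms -/

theorem enc_rel (R : Rel n) : enc R = Data.ofRel R := by
  have (l : List (Fin n → Prop)) : enc l = Data.ofList (Data.ofList Data.ofBool)
      (l.map fun f => List.ofFn fun j => @decide (f j) (Classical.propDecidable _)) := by
    induction l with
    | nil => rfl
    | cons f l ih =>
      refine congrArg₂ Data.cons ?_ ih
      have (l : List Prop) : enc l = Data.ofList Data.ofBool
          (l.map fun p => @decide p (Classical.propDecidable _)) := by
        induction l with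
        | nil => rfl
        | cons p l ih => exact congrArg (Data.cons _) ih
      refine (this (List.ofFn f)).trans ?_
      rw [List.map_ofFn]
      rfl
  refine (this (List.ofFn R)).trans ?_
  rw [List.map_ofFn]
  rfl

theorem encode_eq (I : Instance) :
    I.encode = enc (I.G.Adj, relOf I.init, relOf I.target) := by
  change _ = Data.cons (enc I.G.Adj) (Data.cons (enc (relOf I.init)) (enc (relOf I.target)))
  rw [enc_rel, enc_rel, enc_rel]
  rfl

theorem enc_map_edgesOf {L : List (Rel n)} (h : ∀ R ∈ L, IsM R) :
    enc L = Data.ofList encodeEdges (L.map edgesOf) := by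
  induction L with
  | nil => rfl
  | cons R L ih =>
    refine congrArg₂ Data.cons ?_ (ih fun R hR => h R (List.mem_cons_of_mem _ hR))
    rw [enc_rel]
    exact congrArg Data.ofRel (relOf_edgesOf (h R (by simp))).symm

theorem decidableInPolyTime_isYes :
    DecidableInPolyTime Instance.encode (fun I => IsCograph I.G) fun I => I.IsYes := by
  have hE : PolyT fun n (a : Rel n × Rel n × Rel n) => a.1 := PolyT.id.fst
  have hM : PolyT fun n (a : Rel n × Rel n × Rel n) => a.2.1 := PolyT.id.snd.fst
  have hN : PolyT fun n (a : Rel n × Rel n × Rel n) => a.2.2 := PolyT.id.snd.snd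
  obtain ⟨P, p, hP⟩ := ((PolyT.normalForm hE hM).relEq (PolyT.normalForm hE hN)).exists_program
  refine ⟨P, p, fun I hI => ?_⟩
  obtain ⟨t, ht, h⟩ := hP I.n (I.G.Adj, relOf I.init, relOf I.target)
  rw [← encode_eq] at ht h
  refine ⟨@decide _ (Classical.propDecidable _), ?_, t, ht, h⟩
  refine (@decide_eq_true_iff _ (Classical.propDecidable _)).trans (Iff.trans ?_ (isYes_iff hI).symm)
  exact ⟨fun h => funext fun i => funext fun j => propext (h i j), fun h i j => by rw [h]⟩

theorem solvableInPolyTime_isReconfSeq : SolvableInPolyTime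
    (β := fun I => List (Finset (Sym2 (Fin I.n)))) Instance.encode
    (fun _ S => Data.ofList encodeEdges S) (fun I => IsCograph I.G ∧ I.IsYes)
    fun I S => IsReconfSeq I.G I.init I.target S ∧ S.length ≤ 32 * I.n + 1 := by
  have hE : PolyT fun n (a : Rel n × Rel n × Rel n) => a.1 := PolyT.id.fst
  have hM : PolyT fun n (a : Rel n × Rel n × Rel n) => a.2.1 := PolyT.id.snd.fst
  have hN : PolyT fun n (a : Rel n × Rel n × Rel n) => a.2.2 := PolyT.id.snd.snd
  obtain ⟨P, p, hP⟩ := (PolyT.route hE hM hN).exists_program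
  refine ⟨P, p, fun I hI => ?_⟩
  obtain ⟨t, ht, h⟩ := hP I.n (I.G.Adj, relOf I.init, relOf I.target)
  have hr := isTrail_route hI.1 I.isMatching_init I.isMatching_target ((isYes_iff hI.1).1 hI.2)
  rw [← encode_eq] at ht h
  rw [enc_map_edgesOf fun R hR => (hr.valid R hR).1] at h
  refine ⟨_, ⟨hr.isReconfSeq I.isMatching_init I.isMatching_target, ?_⟩, t, ht, h⟩
  rw [List.length_map]
  exact length_route_le _ _ _

end MatchReconf

theorem mainTheorem2 :
    MatchReconf.DecidableInPolyTime MatchReconf.Instance.encode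
        (fun I => MatchReconf.IsCograph I.G) (fun I => I.IsYes) ∧
      ∃ C : ℕ, MatchReconf.SolvableInPolyTime
        (β := fun I => List (Finset (Sym2 (Fin I.n))))
        MatchReconf.Instance.encode
        (fun _ S => MatchReconf.Data.ofList MatchReconf.encodeEdges S)
        (fun I => MatchReconf.IsCograph I.G ∧ I.IsYes)
        (fun I S => MatchReconf.IsReconfSeq I.G I.init I.target S ∧ S.length ≤ C * I.n + 1) :=
  ⟨MatchReconf.decidableInPolyTime_isYes, 32, MatchReconf.solvableInPolyTime_isReconfSeq⟩
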